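/- **Theorem 3.1 (Global existence and energy cascade).** Let $\mathfrak D$ be the set of finite nonnegative Borel measures on the compact extended half-line $[0,\infty]$, with the weak-$*$ topology (tested against $C([0,\infty])$). A nonnegative wave density $f(t,\cdot)$ with energy density $g=pf$ is described by its energy measure $G_t=g(t,p)p^2\,d\mu(p)=f(t,p)p^3\,d\mu(p)\in\mathfrak D$; its energy is $G_t([0,\infty])$ and its mass is $M(G_t)=\int_{[0,\infty]}p^{-1}\,dG_t(p)\in[0,\infty]$ (that is, $\int p^2f\,d\mu$, with $0^{-1}=\infty$, $\infty^{-1}=0$). For a function $\phi$ and real $x\ge y\ge0$ put $$\mathfrak H^1_\phi(x,y)=(x+y)^3\phi(x+y)-2(x^2+y^2)x\phi(x)-4xy^2\phi(y)+(x-y)^3\phi(x-y),$$ $$\mathfrak H^2_\phi(x,y)=(x+y)^2\big[(x+y)\phi(x+y)-x\phi(x)-y\phi(y)\big],$$ and for $\nu\in\mathfrak D$ $$\mathcal Q_\phi(\nu)=2\iint_{\infty>p_1>p_2\ge0}\frac{\mathfrak H^1_\phi(p_1,p_2)}{p_1p_2}\,d\nu(p_1)d\nu(p_2)+\iint_{\infty>p_1=p_2\ge0}\frac{\mathfrak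 H^2_\phi(p_1,p_2)}{p_1p_2}\,d\nu(p_1)d\nu(p_2),$$ where the integrands are taken to be $0$ when $p_2=0$. Call $\phi(t,p)$ *admissible* if for each $T$ there is $C$ such that, for all $0\le t\le T$, $|\mathfrak H^1_{\phi(t)}(x,y)|\le Cxy$ for $0<y<x<\infty$ and $|\mathfrak H^2_{\phi(t)}(x,x)|\le Cx^2$ for $0<x<\infty$. Let $G_0\in\mathfrak D$. A weakly-$*$ continuous $t\mapsto G_t\in\mathfrak D$, $t\in[0,\infty)$, is a *weak solution of type (i)* with initial datum $G_0$ if $$\int\phi(t)\,dG_t-\int\phi(0)\,dG_0=\int_0^t\Big[\int\partial_s\phi(s)\,dG_s+\mathcal Q_{\phi(s)}(G_s)\Big]ds\qquad(t\ge0)$$ for all admissible $\phi\in C^1([0,\infty);C([0,\infty]))$. It is a *weak solution of type (ii)* if $M(G_0)<\infty$, $M(G_t)<\infty$ for all $t$, and the identity holds for all admissible $\phi(t,p)=\psi(t,p)/p+c(t,p)$ with $\psi,c\in C^1([0,\infty);C([0,\infty]))$ and $\psi(t,\cdot)$ compactly supported in $[0,\infty)$ for each $t$. Below, "weak solution" means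 one of either type. Then, with $E=G_0([0,\infty])$: * **Existence.** There is a weak solution of type (i) with initial datum $G_0$ whose value at time $0$ is $G_0$ and with $G_t([0,\infty])=E$ for all $t\ge0$. If $M(G_0)<\infty$, there is a weak solution of type (ii) with initial datum $G_0$ whose value at time $0$ is $G_0$, with $G_t([0,\infty])=E$ for all $t\ge0$ and $M(G_t)$ nonincreasing in $t$ (in particular $M(G_t)\le M(G_0)$). If moreover $G_0(\{0\})=0$ and $G_0(\{\infty\})=0$, then: * **(i)** For every weak solution with initial datum $G_0$, $t\mapsto G_t(\{\infty\})$ is nondecreasing. * **(ii)** If $G_0\ne0$, then for every weak solution with initial datum $G_0$: for each $t_0\ge0$ there is $t_1>t_0$ with $G_{t_1}(\{\infty\})>G_{t_0}(\{\infty\})$; there is $t_*>0$ with $G_{t_*}(\{\infty\})>0$; $G_t(\{0\})=0$ for all $t\ge0$; and for every $\epsilon\in(0,1)$ there is $R_\epsilon\in(0,\infty)$ with $G_t([0,R_\epsilon))\le\epsilon E$ for all $t\ge0$. * **(iii)** If $G_0\neq0$, there are constants $C_1,C_2,T^*,T^{**},r,T_r>0$ depending only on $G_0$ such that for every weak solution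 with initial datum $G_0$: $G_t(\{\infty\})>C_1-C_2/\sqrt t$ for all $t>T^*$; $G_t(\{\infty\})>C_1/2$ for all $t>T^{**}$; and $G_t([r,\infty])\ge C_1$ for all $t>T_r$. * **(iv)** For every weak solution with initial datum $G_0$, $G_t\to E\,\delta_{\{p=\infty\}}$ weakly-$*$ as $t\to\infty$. Finally, without these assumptions on $G_0$: * **(v)** If $G$ is a weak solution with initial datum $E'\delta_{\{p=\infty\}}$, $E'\in[0,\infty)$, then $G_t=E'\delta_{\{p=\infty\}}$ for all $t\ge0$. -/

import Mathlib

open MeasureTheory Filter Topology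
open scoped ENNReal NNReal

namespace ThreeWave

noncomputable section

/-!
The extended half line `[0,∞]` is `ℝ≥0∞` with its usual (compact) topology and Borel sets.
The wave density `f(t,·)` and the energy density `g(t,·) = p f(t,·)` are described by the energy
measure `G t = f(t,p) p³ dμ(p) = g(t,p) p² dμ(p)`, a finite nonnegative measure on `[0,∞]`.
`FiniteMeasure ℝ≥0∞` carries the topology of weak convergence against `C([0,∞])`.
Thus `g p₁ g p₂ H dμ dμ` reads `H / (p₁ p₂) dG dG`.
-/

/-- `𝓗¹_φ(x,y) = (x+y)³ φ(x+y) - 2 (x²+y²) x φ(x) - 4 x y² φ(y) + (x-y)³ φ(x-y)`,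
used only for `y ≤ x < ∞`. -/
def H1 (φ : ℝ≥0∞ → ℝ) (x y : ℝ≥0∞) : ℝ :=
  (x + y).toReal ^ 3 * φ (x + y)
    - 2 * (x.toReal ^ 2 + y.toReal ^ 2) * x.toReal * φ x
    - 4 * x.toReal * y.toReal ^ 2 * φ y
    + (x - y).toReal ^ 3 * φ (x - y)

/-- `𝓗²_φ(x,y) = (x+y)² [(x+y) φ(x+y) - x φ(x) - y φ(y)]`, used only for `x = y < ∞`. -/
def H2 (φ : ℝ≥0∞ → ℝ) (x y : ℝ≥0∞) : ℝ :=
  (x + y).toReal ^ 2 *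
    ((x + y).toReal * φ (x + y) - x.toReal * φ x - y.toReal * φ y)

/-- The weak collision term at the energy measure `ν`, tested with `φ`. The wave numbers
`p₁, p₂` run over the real numbers `≥ 0`. The integrand vanishes at `p₂ = 0`, where `H1` and `H2`
vanish as well. -/
def collision (φ : ℝ≥0∞ → ℝ) (ν : Measure ℝ≥0∞) : ℝ :=
  2 * (∫ z in {z : ℝ≥0∞ × ℝ≥0∞ | z.2 < z.1 ∧ z.1 < ∞},
        H1 φ z.1 z.2 / (z.1.toReal * z.2.toReal) ∂(ν.prod ν))
    + ∫ z in {z : ℝ≥0∞ × ℝ≥0∞ | z.1 = z.2 ∧ z.1 < ∞},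
        H2 φ z.1 z.2 / (z.1.toReal * z.2.toReal) ∂(ν.prod ν)

/-- The integrands of the collision term are bounded, locally uniformly in time; this is what makes
the collision term of the time-dependent test function `φ` an absolutely convergent integral for
every energy measure. -/
def HasBoundedKernels (φ : ℝ → ℝ≥0∞ → ℝ) : Prop :=
  ∀ T : ℝ, ∃ C : ℝ, ∀ t ∈ Set.Icc 0 T,
    (∀ x y : ℝ≥0∞, 0 < y → y < x → x < ∞ → |H1 (φ t) x y| ≤ C * (x.toReal * y.toReal)) ∧
    (∀ x : ℝ≥0∞, 0 < x → x < ∞ → |H2 (φ t) x x| ≤ C * (x.toReal * x.toReal))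

/-- The weak formulation tested with `φ`, whose time derivative is `φ'`:
`∫ φ(t) dG(t) - ∫ φ(0) dG₀ = ∫₀ᵗ [∫ φ'(s) dG(s) + collision term] ds` for all `t ≥ 0`. -/
def WeakIdentity (G₀ : FiniteMeasure ℝ≥0∞) (G : ℝ≥0 → FiniteMeasure ℝ≥0∞)
    (φ φ' : ℝ → ℝ≥0∞ → ℝ) : Prop :=
  ∀ t : ℝ≥0,
    (∫ p, φ t p ∂(G t : Measure ℝ≥0∞)) - (∫ p, φ 0 p ∂(G₀ : Measure ℝ≥0∞)) =
      ∫ s in (0 : ℝ)..t,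
        ((∫ p, φ' s p ∂(G s.toNNReal : Measure ℝ≥0∞))
          + collision (φ s) (G s.toNNReal : Measure ℝ≥0∞))

/-- The time derivative of a curve of continuous functions on `[0,∞]`, one-sided at `0`. -/
def timeDeriv (φ : ℝ → C(ℝ≥0∞, ℝ)) (t : ℝ) : C(ℝ≥0∞, ℝ) :=
  derivWithin φ (Set.Ici 0) t

/-- Weak solution with initial energy measure `G₀`: test functions in
`C¹([0,∞) : C([0,∞]))` with bounded collision integrands. -/
structure IsWeakSolution (G₀ : FiniteMeasure ℝ≥0∞) (G : ℝ≥0 → FiniteMeasure ℝ≥0∞) : Prop where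
  continuous : Continuous G
  weak : ∀ φ : ℝ → C(ℝ≥0∞, ℝ), ContDiffOn ℝ 1 φ (Set.Ici 0) →
    HasBoundedKernels (fun t p => φ t p) →
    WeakIdentity G₀ G (fun t p => φ t p) (fun t p => timeDeriv φ t p)

/-- The mass `∫ p² f dμ = ∫ p g dμ = ∫ p⁻¹ dν` belonging to the energy measure `ν`
(with `0⁻¹ = ∞` and `∞⁻¹ = 0`). -/
def mass (ν : FiniteMeasure ℝ≥0∞) : ℝ≥0∞ :=
  ∫⁻ p, p⁻¹ ∂(ν : Measure ℝ≥0∞)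

/-- The function `ψ(p)/p + c(p)`. For `ψ` in `C_c([0,∞))` and `c` in `C([0,∞])` these form the
larger space of test functions. The value at `p = 0` plays no role: a measure of finite mass
does not charge `{0}`, and `φ(0)` has a zero factor in `H1` and `H2`. -/
def singularTest (ψ c : C(ℝ≥0∞, ℝ)) (p : ℝ≥0∞) : ℝ :=
  (p⁻¹).toReal * ψ p + c p

/-- Weak solution of finite mass: test functions `φ(t,p) = ψ(t,p)/p + c(t,p)` with bounded
collision integrands, where `ψ(t,·)` has compact support in `[0,∞)` and `ψ`, `c` are `C¹` in time. -/
structure IsWeakSolutionFiniteMass (G₀ : FiniteMeasure ℝ≥0∞)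
    (G : ℝ≥0 → FiniteMeasure ℝ≥0∞) : Prop where
  continuous : Continuous G
  mass_initial : mass G₀ < ∞
  mass_finite : ∀ t, mass (G t) < ∞
  weak : ∀ ψ c : ℝ → C(ℝ≥0∞, ℝ),
    ContDiffOn ℝ 1 ψ (Set.Ici 0) → ContDiffOn ℝ 1 c (Set.Ici 0) →
    (∀ t, 0 ≤ t → ∃ R : ℝ≥0, ∀ p : ℝ≥0∞, (R : ℝ≥0∞) ≤ p → ψ t p = 0) →
    HasBoundedKernels (fun t => singularTest (ψ t) (c t)) →
    WeakIdentity G₀ G (fun t => singularTest (ψ t) (c t))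
      (fun t => singularTest (timeDeriv ψ t) (timeDeriv c t))

/-- The Dirac measure `δ_{p = ∞}`. -/
def diracInfty : FiniteMeasure ℝ≥0∞ := ⟨Measure.dirac ∞, inferInstance⟩

end

end ThreeWave

/-! On the diagonal the two collision integrands agree, so the collision term is the integral
against `ν ⊗ ν` of one symmetric kernel `kern φ`, zero as soon as a wave number is `0` or `∞`. With
`F p = p φ p` and `y ≤ x`, the kernel times `x y` is `(x-y)² [F(x+y) + F(x-y) - 2 F x] + 4 x y
[F(x+y) - F x - F y]`, so a concave subadditive `F` makes it nonpositive.

Cascade. For `φ = cap a` one has `F p = min p a`, hence `∫ cap a dG` never increases. Letting `a →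
∞` shows that the energy on `[0,∞)` decreases, `a → 0` that no atom forms at `0`, and `cap a / a ↑
1/p` that the mass decreases. The same functional bounds the energy on `[0,a]` by `m = ∫ cap a dG₀`,
small with `a` uniformly in time. For `x, y ≥ a` the kernel is at most `-4a`, so the functional
loses energy at rate at least `4a G([a,∞))²`; having started below `E`, it forces `G_t([0,∞)) ≤ m +
√(E / (4 a t))` (`IsWeakSolution.real_compl_top_le`). This gives the rate and the convergence to `E
δ_∞`. Growth at infinity recurs after every time because the finite energy is never exhausted: the
kernel of `tent b` is bounded below by a multiple of `tent b` itself, and a Grönwall argument keeps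
`∫ tent b dG` positive (`IsWeakSolution.integral_tent_pos`).

Existence. After normalizing to probability measures, an explicit Euler step restricted to wave
numbers in `[1/R, R]` is the law of a random choice among `x+y`, `x-y`, `x`, `y`
(`exists_euler_step`). Probability measures on `[0,∞]` form a compact space and the schemes are
nearly Lipschitz in time against admissible functions, which are dense by Stone–Weierstrass, so a
subsequence converges at all times (`exists_subseq_tendsto`). The kernel is not continuous up to `0`
and `∞`, so the limit of the quadratic term needs control of both ends: monotonicity of `cap` near
`0`, and the time-integrated dissipation at large finite wave numbers
(`tendsto_integral_collision`).

Finite mass. A solution of type (i) whose datum has finite mass is already of type (ii): singular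
test functions are truncated near `0` with kernels bounded uniformly in the truncation. Conversely
type (ii) implies type (i) by taking no singular part, so every qualitative statement is proved for
type (i) only. -/

namespace ThreeWave

noncomputable section

/-! ### The collision term as the integral of one symmetric kernel. -/

/-- The polynomial expression `H1` for a function of a real variable. -/
def realH1 (f : ℝ → ℝ) (x y : ℝ) : ℝ :=
  (x + y) ^ 3 * f (x + y) - 2 * (x ^ 2 + y ^ 2) * x * f x - 4 * x * y ^ 2 * f y
    + (x - y) ^ 3 * f (x - y)

/-- The collision kernel of the test function `φ`, as a symmetric function on `[0,∞]²`. It vanishes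
as soon as one of the wave numbers is `0` or `∞`. -/
def kern (φ : ℝ≥0∞ → ℝ) (z : ℝ≥0∞ × ℝ≥0∞) : ℝ :=
  H1 φ (max z.1 z.2) (min z.1 z.2) / (z.1.toReal * z.2.toReal)

/-- A function on `[0,∞]` as a function of a real variable. -/
def onReal (φ : ℝ≥0∞ → ℝ) (r : ℝ) : ℝ := φ (ENNReal.ofReal r)

lemma H1_eq_realH1 (φ : ℝ≥0∞ → ℝ) {x y : ℝ≥0∞} (hyx : y ≤ x) (hx : x ≠ ∞) :
    H1 φ x y = realH1 (onReal φ) x.toReal y.toReal := by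
  have hy : y ≠ ∞ := ne_top_of_le_ne_top hx hyx
  have h1 : ENNReal.ofReal (x.toReal + y.toReal) = x + y := by
    rw [← ENNReal.toReal_add hx hy, ENNReal.ofReal_toReal (by simp [hx, hy])]
  have h2 : ENNReal.ofReal (x.toReal - y.toReal) = x - y := by
    rw [← ENNReal.toReal_sub_of_le hyx hx, ENNReal.ofReal_toReal (by simp [hx])]
  simp only [H1, realH1, onReal, h1, h2, ENNReal.ofReal_toReal hx, ENNReal.ofReal_toReal hy,
    ENNReal.toReal_add hx hy, ENNReal.toReal_sub_of_le hyx hx]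

/-- The difference term carries the factor `(x - x)³ = 0`. This is why a single kernel also covers
the diagonal. -/
lemma H1_self (φ : ℝ≥0∞ → ℝ) (x : ℝ≥0∞) : H1 φ x x = H2 φ x x := by
  rcases eq_or_ne x ∞ with rfl | hx
  · simp [H1, H2]
  · simp only [H1, H2, tsub_self, ENNReal.toReal_add hx hx, ENNReal.toReal_zero]
    ring

/-- Division by zero yields zero, and `∞.toReal = 0`, so one condition covers zero and infinite wave
numbers. -/
lemma kern_eq_zero (φ : ℝ≥0∞ → ℝ) {z : ℝ≥0∞ × ℝ≥0∞} (h : z.1.toReal = 0 ∨ z.2.toReal = 0) :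
    kern φ z = 0 := by
  rcases h with h | h <;> simp [kern, h]

lemma kern_swap (φ : ℝ≥0∞ → ℝ) (z : ℝ≥0∞ × ℝ≥0∞) : kern φ z.swap = kern φ z := by
  simp [kern, max_comm, min_comm, mul_comm]

lemma kern_eq (φ : ℝ≥0∞ → ℝ) (z : ℝ≥0∞ × ℝ≥0∞) :
    kern φ z = realH1 (onReal φ) (max z.1.toReal z.2.toReal) (min z.1.toReal z.2.toReal)
      / (z.1.toReal * z.2.toReal) := by
  by_cases h : z.1.toReal = 0 ∨ z.2.toReal = 0
  · rw [kern_eq_zero φ h]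
    rcases h with h | h <;> simp [h]
  · push Not at h
    have h1 : z.1 ≠ ∞ := by rintro h'; simp [h'] at h
    have h2 : z.2 ≠ ∞ := by rintro h'; simp [h'] at h
    rw [kern, H1_eq_realH1 φ (min_le_max) (by simp [h1, h2]), ENNReal.toReal_max h1 h2,
      ENNReal.toReal_min h1 h2]

/-- Every value of the kernel is `0` or given by an ordered pair of positive wave numbers. -/
lemma kern_cases (φ : ℝ≥0∞ → ℝ) (z : ℝ≥0∞ × ℝ≥0∞) :
    kern φ z = 0 ∧ (z.1.toReal = 0 ∨ z.2.toReal = 0) ∨ ∃ x y : ℝ, 0 < y ∧ y ≤ x ∧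
      (z = (ENNReal.ofReal x, ENNReal.ofReal y) ∨ z = (ENNReal.ofReal y, ENNReal.ofReal x)) ∧
      kern φ z = realH1 (onReal φ) x y / (x * y) := by
  by_cases h : z.1.toReal = 0 ∨ z.2.toReal = 0
  · exact Or.inl ⟨kern_eq_zero φ h, h⟩
  · push Not at h
    have h1 : z.1 ≠ ∞ := by rintro h'; simp [h'] at h
    have h2 : z.2 ≠ ∞ := by rintro h'; simp [h'] at h
    have p1 : 0 < z.1.toReal := lt_of_le_of_ne ENNReal.toReal_nonneg h.1.symm
    have p2 : 0 < z.2.toReal := lt_of_le_of_ne ENNReal.toReal_nonneg h.2.symm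
    refine Or.inr ⟨max z.1.toReal z.2.toReal, min z.1.toReal z.2.toReal, lt_min p1 p2,
      min_le_max, ?_, ?_⟩
    · rcases le_total z.1.toReal z.2.toReal with h' | h'
      · right; simp [h', ENNReal.ofReal_toReal, h1, h2]
      · left; simp [h', ENNReal.ofReal_toReal, h1, h2]
    · rw [kern_eq, max_mul_min]

lemma abs_kern_le {φ : ℝ≥0∞ → ℝ} {C : ℝ}
    (hC : 0 ≤ C) (h : ∀ x y : ℝ, 0 < y → y ≤ x → |realH1 (onReal φ) x y| ≤ C * (x * y))
    (z : ℝ≥0∞ × ℝ≥0∞) : |kern φ z| ≤ C := by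
  rcases kern_cases φ z with h0 | ⟨x, y, hy, hyx, -, hk⟩
  · simpa [h0] using hC
  · have hx : 0 < x := hy.trans_le hyx
    rw [hk, abs_div, abs_of_pos (mul_pos hx hy), div_le_iff₀ (mul_pos hx hy)]
    exact h x y hy hyx

lemma abs_realH1_le {φ : ℝ≥0∞ → ℝ} {C : ℝ} (h : ∀ z, |kern φ z| ≤ C) {x y : ℝ} (hy : 0 < y)
    (hyx : y ≤ x) : |realH1 (onReal φ) x y| ≤ C * (x * y) := by
  have hx : 0 < x := hy.trans_le hyx
  have := h (ENNReal.ofReal x, ENNReal.ofReal y)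
  rw [kern_eq] at this
  simp only [ENNReal.toReal_ofReal hx.le, ENNReal.toReal_ofReal hy.le, max_eq_left hyx,
    min_eq_right hyx] at this
  rwa [abs_div, abs_of_pos (mul_pos hx hy), div_le_iff₀ (mul_pos hx hy)] at this

/-- Admissibility in the form used throughout: a uniform bound on one function over all of `[0,∞]²`.
-/
lemma hasBoundedKernels_iff {φ : ℝ → ℝ≥0∞ → ℝ} :
    HasBoundedKernels φ ↔ ∀ T : ℝ, ∃ C : ℝ, 0 ≤ C ∧ ∀ t ∈ Set.Icc 0 T, ∀ z, |kern (φ t) z| ≤ C := by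
  refine forall_congr' fun T => ⟨?_, ?_⟩
  · rintro ⟨C, hC⟩
    -- For `T < 0` the hypothesis is vacuous and `C` may be negative, hence the absolute value.
    refine ⟨|C|, abs_nonneg C, fun t ht => abs_kern_le (abs_nonneg C) fun x y hy hyx => ?_⟩
    have hx : 0 < x := hy.trans_le hyx
    have hle : ENNReal.ofReal y ≤ ENNReal.ofReal x := ENNReal.ofReal_le_ofReal hyx
    have key : |H1 (φ t) (ENNReal.ofReal x) (ENNReal.ofReal y)| ≤ C * (x * y) := by
      rcases hyx.eq_or_lt with rfl | hlt
      · have := (hC t ht).2 (ENNReal.ofReal y) (by simpa) (by simp)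
        rwa [ENNReal.toReal_ofReal hy.le, ← H1_self] at this
      · have := (hC t ht).1 (ENNReal.ofReal x) (ENNReal.ofReal y) (by simpa)
          ((ENNReal.ofReal_lt_ofReal_iff hx).2 hlt) (by simp)
        rwa [ENNReal.toReal_ofReal hy.le, ENNReal.toReal_ofReal hx.le] at this
    rw [H1_eq_realH1 _ hle (by simp), ENNReal.toReal_ofReal hy.le, ENNReal.toReal_ofReal hx.le]
      at key
    exact key.trans (by gcongr; exact le_abs_self C)
  · rintro ⟨C, -, hC⟩
    refine ⟨C, fun t ht => ⟨fun x y hy hyx hx => ?_, fun x hx0 hx => ?_⟩⟩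
    · rw [H1_eq_realH1 _ hyx.le hx.ne]
      exact abs_realH1_le (hC t ht) (ENNReal.toReal_pos hy.ne' (hyx.trans hx).ne)
        (ENNReal.toReal_mono hx.ne hyx.le)
    · rw [← H1_self, H1_eq_realH1 _ le_rfl hx.ne]
      exact abs_realH1_le (hC t ht) (ENNReal.toReal_pos hx0.ne' hx.ne) le_rfl

/-- The kernel of a measurable family of test functions is jointly measurable. -/
lemma measurable_kern_uncurry {α : Type*} [MeasurableSpace α] {φ : α → ℝ≥0∞ → ℝ}
    (hφ : Measurable (Function.uncurry φ)) :
    Measurable fun q : α × (ℝ≥0∞ × ℝ≥0∞) => kern (φ q.1) q.2 := by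
  have key : ∀ {g : α × (ℝ≥0∞ × ℝ≥0∞) → ℝ≥0∞}, Measurable g →
      Measurable fun q : α × (ℝ≥0∞ × ℝ≥0∞) => φ q.1 (g q) :=
    fun hg => hφ.comp (measurable_fst.prodMk hg)
  have comb : ∀ {s d x y u fs fx fy fd : α × (ℝ≥0∞ × ℝ≥0∞) → ℝ}, Measurable s → Measurable d →
      Measurable x → Measurable y → Measurable u → Measurable fs → Measurable fx → Measurable fy →
      Measurable fd → Measurable fun q => (s q ^ 3 * fs q - 2 * (x q ^ 2 + y q ^ 2) * x q * fx q
        - 4 * x q * y q ^ 2 * fy q + d q ^ 3 * fd q) / u q := by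
    intros; fun_prop
  have s1 : Measurable fun q : α × (ℝ≥0∞ × ℝ≥0∞) => q.2.1 := measurable_snd.fst
  have s2 : Measurable fun q : α × (ℝ≥0∞ × ℝ≥0∞) => q.2.2 := measurable_snd.snd
  have hM : Measurable fun q : α × (ℝ≥0∞ × ℝ≥0∞) => max q.2.1 q.2.2 := s1.max s2
  have hN : Measurable fun q : α × (ℝ≥0∞ × ℝ≥0∞) => min q.2.1 q.2.2 := s1.min s2
  have hA : Measurable fun q : α × (ℝ≥0∞ × ℝ≥0∞) => max q.2.1 q.2.2 + min q.2.1 q.2.2 := hM.add hN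
  have hS : Measurable fun q : α × (ℝ≥0∞ × ℝ≥0∞) => max q.2.1 q.2.2 - min q.2.1 q.2.2 := hM.sub hN
  have hU : Measurable fun q : α × (ℝ≥0∞ × ℝ≥0∞) => q.2.1.toReal * q.2.2.toReal :=
    s1.ennreal_toReal.mul s2.ennreal_toReal
  exact comb hA.ennreal_toReal hS.ennreal_toReal hM.ennreal_toReal hN.ennreal_toReal hU
    (key hA) (key hM) (key hN) (key hS)

lemma measurable_kern {φ : ℝ≥0∞ → ℝ} (hφ : Measurable φ) : Measurable (kern φ) := by
  have h0 : Measurable (Function.uncurry fun _ : Unit => φ) := hφ.comp measurable_snd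
  have h := measurable_kern_uncurry h0
  have h1 : Measurable fun z : ℝ≥0∞ × ℝ≥0∞ => ((), z) := measurable_prodMk_left
  have h2 : kern φ = (fun q : Unit × (ℝ≥0∞ × ℝ≥0∞) => kern φ q.2) ∘ fun z => ((), z) := by
    funext z
    rfl
  rw [h2]
  exact h.comp h1

/-- The collision term as one integral of the symmetric kernel. -/
lemma collision_eq {φ : ℝ≥0∞ → ℝ} (hφ : Measurable φ) {C : ℝ} (hC : ∀ z, |kern φ z| ≤ C)
    (ν : Measure ℝ≥0∞) [IsFiniteMeasure ν] : collision φ ν = ∫ z, kern φ z ∂(ν.prod ν) := by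
  have hint : Integrable (kern φ) (ν.prod ν) :=
    Integrable.of_bound (measurable_kern hφ).aestronglyMeasurable C (ae_of_all _ hC)
  have hlt : MeasurableSet {z : ℝ≥0∞ × ℝ≥0∞ | z.2 < z.1} :=
    measurableSet_lt measurable_snd measurable_fst
  have hgt : MeasurableSet {z : ℝ≥0∞ × ℝ≥0∞ | z.1 < z.2} :=
    measurableSet_lt measurable_fst measurable_snd
  have heq : MeasurableSet {z : ℝ≥0∞ × ℝ≥0∞ | z.1 = z.2} :=
    measurableSet_eq_fun measurable_fst measurable_snd
  have hfin : MeasurableSet {z : ℝ≥0∞ × ℝ≥0∞ | z.1 < ∞} :=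
    measurableSet_lt measurable_fst measurable_const
  have e1 : (∫ z in {z : ℝ≥0∞ × ℝ≥0∞ | z.2 < z.1 ∧ z.1 < ∞},
      H1 φ z.1 z.2 / (z.1.toReal * z.2.toReal) ∂(ν.prod ν))
      = ∫ z in {z : ℝ≥0∞ × ℝ≥0∞ | z.2 < z.1}, kern φ z ∂(ν.prod ν) := by
    have hm : MeasurableSet {z : ℝ≥0∞ × ℝ≥0∞ | z.2 < z.1 ∧ z.1 < ∞} := hlt.inter hfin
    rw [← integral_indicator hm, ← integral_indicator hlt]
    congr 1 with z
    by_cases h : z.2 < z.1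
    · by_cases h' : z.1 < ∞
      · simp [Set.indicator, h, h', kern, h.le]
      · have : z.1 = ∞ := by simpa using h'
        simp [Set.indicator, kern, this]
    · simp [Set.indicator, h]
  have e2 : (∫ z in {z : ℝ≥0∞ × ℝ≥0∞ | z.1 = z.2 ∧ z.1 < ∞},
      H2 φ z.1 z.2 / (z.1.toReal * z.2.toReal) ∂(ν.prod ν))
      = ∫ z in {z : ℝ≥0∞ × ℝ≥0∞ | z.1 = z.2}, kern φ z ∂(ν.prod ν) := by
    have hm : MeasurableSet {z : ℝ≥0∞ × ℝ≥0∞ | z.1 = z.2 ∧ z.1 < ∞} := heq.inter hfin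
    rw [← integral_indicator hm, ← integral_indicator heq]
    congr 1 with ⟨x, y⟩
    by_cases h : x = y
    · subst h
      by_cases h' : x < ∞
      · simp [Set.indicator, h', kern, H1_self]
      · have : x = ∞ := by simpa using h'
        simp [Set.indicator, kern, this]
    · simp [Set.indicator, h]
  -- By symmetry both open triangles contribute equally, which accounts for the factor `2` in
  -- `collision`.
  have e3 : (∫ z in {z : ℝ≥0∞ × ℝ≥0∞ | z.1 < z.2}, kern φ z ∂(ν.prod ν))
      = ∫ z in {z : ℝ≥0∞ × ℝ≥0∞ | z.2 < z.1}, kern φ z ∂(ν.prod ν) := by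
    rw [← integral_indicator hgt, ← integral_indicator hlt, ← integral_prod_swap]
    congr 1 with z
    have := kern_swap φ z
    simp only [Set.indicator, Set.mem_ofPred_eq, Prod.fst_swap, Prod.snd_swap, this]
    by_cases h : z.2 < z.1 <;> simp [h]
  have e4 : {z : ℝ≥0∞ × ℝ≥0∞ | z.1 = z.2}ᶜ = {z | z.2 < z.1} ∪ {z | z.1 < z.2} := by
    ext z
    simp only [Set.mem_compl_iff, Set.mem_ofPred_eq, Set.mem_union]
    exact ⟨fun h => (lt_or_gt_of_ne h).symm, fun h => h.elim ne_of_gt ne_of_lt⟩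
  have hd : Disjoint {z : ℝ≥0∞ × ℝ≥0∞ | z.2 < z.1} {z | z.1 < z.2} :=
    Set.disjoint_left.2 fun z h h' => lt_asymm (Set.mem_ofPred_eq ▸ h) h'
  rw [collision, e1, e2, ← integral_add_compl heq hint, e4,
    setIntegral_union hd hgt hint.integrableOn
      hint.integrableOn, e3]
  ring

lemma kern_mul_left (c : ℝ) (φ : ℝ≥0∞ → ℝ) (z : ℝ≥0∞ × ℝ≥0∞) :
    kern (fun p => c * φ p) z = c * kern φ z := by
  simp only [kern, H1]; ring

lemma kern_sub (φ ψ : ℝ≥0∞ → ℝ) (z : ℝ≥0∞ × ℝ≥0∞) :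
    kern (fun p => φ p - ψ p) z = kern φ z - kern ψ z := by
  simp only [kern, H1]; ring

/-- `(x+y)³ + (x-y)³ = 2 (x²+y²) x + 4 x y²`: this identity is the conservation of energy. -/
lemma kern_const (c : ℝ) (z : ℝ≥0∞ × ℝ≥0∞) : kern (fun _ => c) z = 0 := by
  rw [kern_eq, div_eq_zero_iff]
  left
  simp only [realH1, onReal]
  ring

/-! ### Bounds and signs of the kernel, in real variables. -/

/-- If `x f x` is bounded, then so is the kernel of `f` at pairs of comparable wave numbers. -/
lemma abs_realH1_le_of_comparable {f : ℝ → ℝ} {M : ℝ} (hM : ∀ x, 0 ≤ x → |x * f x| ≤ M) {x y : ℝ}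
    (hy : 0 < y) (hyx : y ≤ x) (hxy : x ≤ 2 * y) : |realH1 f x y| ≤ 22 * M * (x * y) := by
  have hx : 0 < x := hy.trans_le hyx
  have hM0 : 0 ≤ M := (abs_nonneg _).trans (hM 0 le_rfl)
  -- In terms of `r f r` the coefficients are quadratic; for `y ≤ x ≤ 2y` they are at most `8`, `8`,
  -- `4` and `2` times `x y`, in total `22`.
  have e : realH1 f x y = (x + y) ^ 2 * ((x + y) * f (x + y)) - 2 * (x ^ 2 + y ^ 2) * (x * f x)
      - 4 * (x * y) * (y * f y) + (x - y) ^ 2 * ((x - y) * f (x - y)) := by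
    simp only [realH1]; ring
  have b1 := abs_le.1 (hM (x + y) (by positivity))
  have b2 := abs_le.1 (hM x hx.le)
  have b3 := abs_le.1 (hM y hy.le)
  have b4 := abs_le.1 (hM (x - y) (by linarith))
  have hq : x ^ 2 ≤ 2 * (x * y) := by nlinarith
  have hq' : y ^ 2 ≤ x * y := by nlinarith
  have hxy0 : 0 < x * y := mul_pos hx hy
  have c1 : |(x + y) ^ 2 * ((x + y) * f (x + y))| ≤ (8 * (x * y)) * M := by
    rw [abs_mul, abs_of_nonneg (sq_nonneg (x + y))]
    exact mul_le_mul (by nlinarith) (abs_le.2 b1) (abs_nonneg _) (by positivity)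
  have c2 : |2 * (x ^ 2 + y ^ 2) * (x * f x)| ≤ (8 * (x * y)) * M := by
    rw [abs_mul, abs_of_nonneg (by positivity : 0 ≤ 2 * (x ^ 2 + y ^ 2))]
    exact mul_le_mul (by nlinarith) (abs_le.2 b2) (abs_nonneg _) (by positivity)
  have c3 : |4 * (x * y) * (y * f y)| ≤ (4 * (x * y)) * M := by
    rw [abs_mul, abs_of_nonneg (by positivity : 0 ≤ 4 * (x * y))]
    exact mul_le_mul le_rfl (abs_le.2 b3) (abs_nonneg _) (by positivity)
  have c4 : |(x - y) ^ 2 * ((x - y) * f (x - y))| ≤ (2 * (x * y)) * M := by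
    rw [abs_mul, abs_of_nonneg (sq_nonneg (x - y))]
    exact mul_le_mul (by nlinarith) (abs_le.2 b4) (abs_nonneg _) (by positivity)
  rw [e]
  rw [abs_le] at *
  constructor <;> linarith [c1.1, c1.2, c2.1, c2.2, c3.1, c3.2, c4.1, c4.2]

/-- The kernel of a Lipschitz function that equals `c / x` near infinity is bounded. -/
lemma abs_realH1_le_of_lipschitz {f : ℝ → ℝ} {A B L c : ℝ} (hA : 0 < A)
    (hB : ∀ x, 0 ≤ x → |f x| ≤ B)
    (hL : ∀ x y, 0 ≤ x → 0 ≤ y → |f x - f y| ≤ L * |x - y|) (hc : ∀ x, A ≤ x → x * f x = c)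
    {x y : ℝ} (hy : 0 < y) (hyx : y ≤ x) :
    |realH1 f x y| ≤ (22 * (A * B + |c|) + 28 * A * B + 8 * A ^ 2 * L) * (x * y) := by
  have hx : 0 < x := hy.trans_le hyx
  have hB0 : 0 ≤ B := (abs_nonneg _).trans (hB 0 le_rfl)
  have hL0 : 0 ≤ L := by
    have := (abs_nonneg _).trans (hL 1 0 zero_le_one le_rfl)
    simpa using this
  have hxy0 : 0 < x * y := mul_pos hx hy
  have hM : ∀ r, 0 ≤ r → |r * f r| ≤ A * B + |c| := by
    intro r hr
    rcases le_total A r with h | h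
    · rw [hc r h]
      have : 0 ≤ A * B := by positivity
      linarith
    · rw [abs_mul, abs_of_nonneg hr]
      have : r * |f r| ≤ A * B := mul_le_mul h (hB r hr) (abs_nonneg _) hA.le
      linarith [abs_nonneg c]
  set M := A * B + |c| with hMdef
  have hM0 : 0 ≤ M := by positivity
  rcases le_total x (2 * y) with h2 | h2
  · refine (abs_realH1_le_of_comparable hM hy hyx h2).trans ?_
    have : 0 ≤ (28 * A * B + 8 * A ^ 2 * L) * (x * y) := by positivity
    nlinarith
  have hyf := abs_le.1 (hM y hy.le)
  -- If `x ≥ 2A` and `x ≥ 2y`, then `x - y ≥ A`, so `r f r = c` at `x` and `x ± y`; their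
  -- contributions cancel because `(x+y)² + (x-y)² = 2 (x²+y²)`.
  rcases le_total (2 * A) x with h3 | h3
  · have e : realH1 f x y = - (4 * (x * y) * (y * f y)) := by
      have k1 := hc (x + y) (by linarith)
      have k2 := hc x (by linarith)
      have k3 := hc (x - y) (by linarith)
      have : realH1 f x y = (x + y) ^ 2 * ((x + y) * f (x + y)) - 2 * (x ^ 2 + y ^ 2) * (x * f x)
        - 4 * (x * y) * (y * f y) + (x - y) ^ 2 * ((x - y) * f (x - y)) := by
        simp only [realH1]; ring
      rw [this, k1, k2, k3]
      ring
    rw [e, abs_neg, abs_mul, abs_of_nonneg (by positivity : 0 ≤ 4 * (x * y))]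
    calc 4 * (x * y) * |y * f y| ≤ 4 * (x * y) * M := by gcongr; exact hM y hy.le
      _ ≤ (22 * M + 28 * A * B + 8 * A ^ 2 * L) * (x * y) := by
        have : 0 ≤ (18 * M + 28 * A * B + 8 * A ^ 2 * L) * (x * y) := by positivity
        linarith
  -- Grouping `x³ f` into increments of `f` leaves a factor `y` in every term, explicit or from the
  -- Lipschitz bound; the surplus powers of `x` are absorbed by `x ≤ 2A`.
  · have e : realH1 f x y = (3 * x * x + 3 * x * y + y * y) * y * f (x + y)
        + x ^ 3 * (f (x + y) - f x) - (3 * x * x - 3 * x * y + y * y) * y * f (x - y)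
        + x ^ 3 * (f (x - y) - f x) - 2 * (y * y) * (x * f x) - 4 * (x * y) * (y * f y) := by
      simp only [realH1]; ring
    have b1 := hB (x + y) (by positivity)
    have b2 := hB (x - y) (by linarith)
    have b3 := hL (x + y) x (by positivity) hx.le
    have b4 := hL (x - y) x (by linarith) hx.le
    rw [show x + y - x = y by ring, abs_of_pos hy] at b3
    rw [show x - y - x = -y by ring, abs_neg, abs_of_pos hy] at b4
    have hx2 : x * x ≤ 2 * A * x := by nlinarith
    have hx3 : x ^ 3 * (L * y) ≤ 4 * A ^ 2 * L * (x * y) := by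
      have : x ^ 2 ≤ 4 * A ^ 2 := by nlinarith
      calc x ^ 3 * (L * y) = x ^ 2 * (L * (x * y)) := by ring
        _ ≤ 4 * A ^ 2 * (L * (x * y)) := by gcongr
        _ = _ := by ring
    have d1 : |(3 * x * x + 3 * x * y + y * y) * y * f (x + y)| ≤ 14 * A * B * (x * y) := by
      rw [abs_mul, abs_of_nonneg (by positivity)]
      calc (3 * x * x + 3 * x * y + y * y) * y * |f (x + y)|
          ≤ (14 * A * x) * y * B := by gcongr; nlinarith
        _ = _ := by ring
    have hq : 0 ≤ 3 * x * x - 3 * x * y + y * y := by nlinarith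
    have d2 : |(3 * x * x - 3 * x * y + y * y) * y * f (x - y)| ≤ 14 * A * B * (x * y) := by
      rw [abs_mul, abs_of_nonneg (mul_nonneg hq hy.le)]
      calc (3 * x * x - 3 * x * y + y * y) * y * |f (x - y)|
          ≤ (14 * A * x) * y * B := by gcongr; nlinarith
        _ = _ := by ring
    have d3 : |x ^ 3 * (f (x + y) - f x)| ≤ 4 * A ^ 2 * L * (x * y) := by
      rw [abs_mul, abs_of_nonneg (by positivity : 0 ≤ x ^ 3)]
      exact (mul_le_mul_of_nonneg_left b3 (by positivity)).trans hx3
    have d4 : |x ^ 3 * (f (x - y) - f x)| ≤ 4 * A ^ 2 * L * (x * y) := by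
      rw [abs_mul, abs_of_nonneg (by positivity : 0 ≤ x ^ 3)]
      exact (mul_le_mul_of_nonneg_left b4 (by positivity)).trans hx3
    have d5 : |2 * (y * y) * (x * f x)| ≤ 2 * M * (x * y) := by
      rw [abs_mul, abs_of_nonneg (by positivity : 0 ≤ 2 * (y * y))]
      calc 2 * (y * y) * |x * f x| ≤ 2 * (x * y) * M := by gcongr; exact hM x hx.le
        _ = _ := by ring
    have d6 : |4 * (x * y) * (y * f y)| ≤ 4 * M * (x * y) := by
      rw [abs_mul, abs_of_nonneg (by positivity : 0 ≤ 4 * (x * y))]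
      calc 4 * (x * y) * |y * f y| ≤ 4 * (x * y) * M := by gcongr; exact hM y hy.le
        _ = _ := by ring
    have : 0 ≤ M * (x * y) := by positivity
    rw [e]
    rw [abs_le] at *
    constructor <;> linarith [d1.1, d1.2, d2.1, d2.2, d3.1, d3.2, d4.1, d4.2, d5.1, d5.2, d6.1, d6.2]

/-- The sign of the kernel when `x f x = min x a`, a concave function. -/
lemma realH1_le_of_min {f : ℝ → ℝ} {a : ℝ} (hf : ∀ r, 0 ≤ r → r * f r = min r a)
    {x y : ℝ} (hy : 0 < y) (hyx : y ≤ x) :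
    realH1 f x y ≤ -(4 * (x * y) * (min x a + min y a - min (x + y) a)) := by
  have hx : 0 < x := hy.trans_le hyx
  have e : realH1 f x y = (x + y) ^ 2 * ((x + y) * f (x + y)) - 2 * (x ^ 2 + y ^ 2) * (x * f x)
      - 4 * (x * y) * (y * f y) + (x - y) ^ 2 * ((x - y) * f (x - y)) := by
    simp only [realH1]; ring
  rw [e, hf _ (by positivity), hf x hx.le, hf y hy.le, hf (x - y) (by linarith)]
  -- Midpoint concavity of `F r = min r a`, used in the splitting into `(x-y)² [F(x+y) + F(x-y) - 2
  -- F x]` and `4 x y [F(x+y) - F x - F y]`.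
  have key : min (x - y) a + min (x + y) a ≤ 2 * min x a := by grind
  nlinarith [mul_nonneg (sq_nonneg (x - y)) (sub_nonneg.2 key)]

/-- A lower bound of the kernel of `r ↦ (1 - b r)₊` by the function itself. -/
lemma le_realH1_of_tent {f : ℝ → ℝ} {b : ℝ} (hb : 0 < b) (hf : ∀ r, 0 ≤ r → f r = max (1 - b * r) 0)
    {x y : ℝ} (hy : 0 < y) (hyx : y ≤ x) :
    -(16 / b * (f x + f y)) * (x * y) ≤ realH1 f x y := by
  have hx : 0 < x := hy.trans_le hyx
  have h0 : ∀ r, 0 ≤ r → 0 ≤ f r := fun r hr => by rw [hf r hr]; exact le_max_right _ _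
  have hge : ∀ r, 0 ≤ r → 1 - b * r ≤ f r := fun r hr => by rw [hf r hr]; exact le_max_left _ _
  have hzero : ∀ r, 0 ≤ r → 1 ≤ b * r → f r = 0 := fun r hr h => by
    rw [hf r hr]; exact max_eq_right (by linarith)
  have fx := h0 x hx.le
  have fy := h0 y hy.le
  have fs := h0 (x + y) (by positivity)
  have fd := h0 (x - y) (by linarith)
  have hmul : ∀ r, 0 ≤ r → b * r * f r ≤ f r := by
    intro r hr
    rcases le_total 1 (b * r) with h | h
    · simp [hzero r hr h]
    · nlinarith [h0 r hr]
  suffices h : -(16 * (f x + f y)) * (x * y) ≤ b * realH1 f x y by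
    have : -(16 / b * (f x + f y)) * (x * y) = (-(16 * (f x + f y)) * (x * y)) / b := by
      field_simp
    rw [this, div_le_iff₀ hb]
    linarith
  have hxy : 0 < x * y := mul_pos hx hy
  have hs : 0 ≤ (x + y) ^ 3 * f (x + y) := by positivity
  have hd : 0 ≤ (x - y) ^ 3 * f (x - y) := mul_nonneg (pow_nonneg (by linarith) 3) fd
  have t4 : b * (4 * x * y ^ 2 * f y) ≤ 4 * (x * y) * f y := by
    have := mul_le_mul_of_nonneg_left (hmul y hy.le) (by positivity : 0 ≤ 4 * (x * y))
    nlinarith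
  have hnn : 0 ≤ (x * y) * f x := by positivity
  have hnn' : 0 ≤ (x * y) * f y := by positivity
  -- Three regimes. If `b x ≥ 1`, then `f x = 0` and the only loss is the `f y` term, where `b y f y
  -- ≤ f y`. If `b x ≤ 1` and `b y ≥ 1/2`, then `x ≤ 2y` and the losses are bounded term by term. If
  -- `b x ≤ 1` and `b y ≤ 1/2`, the cubic terms must be allowed to cancel.
  rcases le_total 1 (b * x) with hbx | hbx
  · have : f x = 0 := hzero x hx.le hbx
    have hs' := mul_nonneg hb.le hs
    have hd' := mul_nonneg hb.le hd
    simp only [realH1, this]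
    simp only [this] at hnn
    nlinarith
  · rcases le_total (1 / 2) (b * y) with hby | hby
    · have t2 : b * (2 * (x ^ 2 + y ^ 2) * x * f x) ≤ 8 * (x * y) * f x := by
        have h1 : 2 * (x ^ 2 + y ^ 2) * x ≤ 4 * x ^ 3 := by nlinarith
        have h2 : b * (4 * x ^ 3) ≤ 8 * (x * y) := by
          have h3 : x ≤ 2 * y := by
            by_contra h'
            push Not at h'
            nlinarith
          nlinarith
        calc b * (2 * (x ^ 2 + y ^ 2) * x * f x) ≤ b * (4 * x ^ 3 * f x) := by gcongr
          _ = b * (4 * x ^ 3) * f x := by ring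
          _ ≤ 8 * (x * y) * f x := by gcongr
      have hs' := mul_nonneg hb.le hs
      have hd' := mul_nonneg hb.le hd
      simp only [realH1]
      nlinarith
    · have hfx : f x = 1 - b * x := by rw [hf x hx.le]; exact max_eq_left (by linarith)
      have hfy : 1 / 2 ≤ f y := (by linarith : 1 / 2 ≤ 1 - b * y).trans (hge y hy.le)
      have k1 := mul_le_mul_of_nonneg_left (hge (x + y) (by positivity))
        (by positivity : 0 ≤ (x + y) ^ 3)
      have k2 := mul_le_mul_of_nonneg_left (hge (x - y) (by linarith))
        (pow_nonneg (by linarith) 3 : 0 ≤ (x - y) ^ 3)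
      -- With `f` replaced by the affine minorant `1 - b r`, the second difference of `r³ f r` has a
      -- negative part of order `x y / b`, which `f y ≥ 1/2` absorbs.
      have k3 : b * ((x + y) ^ 3 * (1 - b * (x + y)) + (x - y) ^ 3 * (1 - b * (x - y))
          - 2 * x ^ 3 * (1 - b * x)) ≥ - (14 * (x * y) * f y) := by
        have id1 : (x + y) ^ 3 * (1 - b * (x + y)) + (x - y) ^ 3 * (1 - b * (x - y))
          - 2 * x ^ 3 * (1 - b * x) = 6 * x * y ^ 2 - b * (12 * x ^ 2 * y ^ 2 + 2 * y ^ 4) := by ring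
        have q1 : 12 * x ^ 2 * y ^ 2 + 2 * y ^ 4 ≤ 14 * x ^ 2 * y ^ 2 := by
          have : y ^ 2 ≤ x ^ 2 := by nlinarith
          nlinarith [mul_le_mul_of_nonneg_left this (sq_nonneg y)]
        have q2 : b * (b * (14 * x ^ 2 * y ^ 2)) ≤ 7 * (x * y) := by
          have e : b * (b * (14 * x ^ 2 * y ^ 2)) = 14 * (b * x) * (b * y) * (x * y) := by ring
          have q : (b * x) * (b * y) ≤ 1 / 2 := by
            have : 0 ≤ b * y := by positivity
            nlinarith
          rw [e]
          nlinarith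
        have q3 : b * (b * (12 * x ^ 2 * y ^ 2 + 2 * y ^ 4)) ≤ b * (b * (14 * x ^ 2 * y ^ 2)) := by
          gcongr
        have q4 : 7 * (x * y) ≤ 14 * (x * y) * f y := by nlinarith
        have q5 : 0 ≤ b * (6 * x * y ^ 2) := by positivity
        rw [id1]
        nlinarith
      have k4 : b * (2 * y ^ 2 * x * f x) ≤ 2 * (x * y) * f x := by
        have : b * y ≤ 1 := by linarith
        have := mul_le_mul_of_nonneg_right this (by positivity : 0 ≤ 2 * (x * y) * f x)
        nlinarith
      have k5 := mul_le_mul_of_nonneg_left (add_le_add k1 k2) hb.le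
      have e : b * realH1 f x y = b * ((x + y) ^ 3 * f (x + y) + (x - y) ^ 3 * f (x - y))
          - b * (2 * x ^ 3 * f x) - b * (2 * y ^ 2 * x * f x) - b * (4 * x * y ^ 2 * f y) := by
        simp only [realH1]; ring
      rw [e]
      rw [hfx] at *
      nlinarith

/-! ### The test functions `cap` and `tent`. -/

/-- The function `min 1 (a / p)` on `[0,∞]`. -/
def cap (a : ℝ≥0) : C(ℝ≥0∞, ℝ) where
  toFun p := (min 1 (a * p⁻¹)).toReal
  continuous_toFun := by
    have : Continuous fun p : ℝ≥0∞ => min 1 ((a : ℝ≥0∞) * p⁻¹) :=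
      continuous_const.min ((ENNReal.continuous_const_mul (by simp)).comp continuous_inv)
    exact ENNReal.continuousOn_toReal.comp_continuous this fun p => by simp

/-- The function `(1 - b p)₊` on `[0,∞]`. -/
def tent (b : ℝ≥0) : C(ℝ≥0∞, ℝ) where
  toFun p := (1 - b * p).toReal
  continuous_toFun := by
    have : Continuous fun p : ℝ≥0∞ => 1 - (b : ℝ≥0∞) * p :=
      (ENNReal.continuous_sub_left (by simp)).comp (ENNReal.continuous_const_mul (by simp))
    exact ENNReal.continuousOn_toReal.comp_continuous this fun p => by simp

lemma cap_apply (a : ℝ≥0) (p : ℝ≥0∞) : cap a p = (min 1 (a * p⁻¹)).toReal := rfl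

lemma tent_apply (b : ℝ≥0) (p : ℝ≥0∞) : tent b p = (1 - b * p).toReal := rfl

lemma cap_nonneg (a : ℝ≥0) (p : ℝ≥0∞) : 0 ≤ cap a p := ENNReal.toReal_nonneg

lemma tent_nonneg (b : ℝ≥0) (p : ℝ≥0∞) : 0 ≤ tent b p := ENNReal.toReal_nonneg

lemma cap_le_one (a : ℝ≥0) (p : ℝ≥0∞) : cap a p ≤ 1 := by
  rw [cap_apply, ← ENNReal.toReal_one]
  exact ENNReal.toReal_mono (by simp) (min_le_left _ _)

lemma tent_le_one (b : ℝ≥0) (p : ℝ≥0∞) : tent b p ≤ 1 := by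
  rw [tent_apply, ← ENNReal.toReal_one]
  exact ENNReal.toReal_mono (by simp) tsub_le_self

@[simp] lemma cap_top (a : ℝ≥0) : cap a ∞ = 0 := by simp [cap_apply]

lemma tent_top {b : ℝ≥0} (hb : 0 < b) : tent b ∞ = 0 := by
  simp [tent_apply, ENNReal.mul_top, hb.ne']

lemma cap_of_le {a : ℝ≥0} (ha : 0 < a) {p : ℝ≥0∞} (hp : p ≤ a) : cap a p = 1 := by
  have : (1 : ℝ≥0∞) ≤ a * p⁻¹ := by
    rw [← div_eq_mul_inv]
    rcases eq_or_ne p 0 with rfl | h0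
    · simp [ENNReal.div_zero, ha.ne']
    · rwa [ENNReal.le_div_iff_mul_le (Or.inl h0) (Or.inl (ne_top_of_le_ne_top (by simp) hp)),
        one_mul]
  simp [cap_apply, this]

lemma cap_ofReal (a : ℝ≥0) {r : ℝ} (hr : 0 < r) : cap a (ENNReal.ofReal r) = min 1 (a / r) := by
  rw [cap_apply, ENNReal.toReal_min (by simp)
    (ENNReal.mul_ne_top (by simp) (by simpa using hr)), ENNReal.toReal_mul, ENNReal.toReal_inv,
    ENNReal.toReal_ofReal hr.le]
  simp [div_eq_mul_inv]

lemma mul_cap_ofReal (a : ℝ≥0) {r : ℝ} (hr : 0 ≤ r) : r * onReal (cap a) r = min r a := by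
  rcases hr.eq_or_lt with rfl | h
  · simp
  · rw [onReal, cap_ofReal a h, mul_min_of_nonneg _ _ hr]
    congr 1
    · ring
    · field_simp

lemma onReal_tent (b : ℝ≥0) {r : ℝ} (hr : 0 ≤ r) : onReal (tent b) r = max (1 - b * r) 0 := by
  have hm : (b : ℝ≥0∞) * ENNReal.ofReal r = ENNReal.ofReal (b * r) := by
    rw [ENNReal.ofReal_mul b.coe_nonneg, ENNReal.ofReal_coe_nnreal]
  rw [onReal, tent_apply, hm, ← ENNReal.ofReal_one, ← ENNReal.ofReal_sub _ (by positivity),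
    ENNReal.toReal_ofReal']

/-- Here `p · cap a p = min p a`, which is concave and subadditive. -/
lemma kern_cap_le (a : ℝ≥0) (z : ℝ≥0∞ × ℝ≥0∞) : kern (cap a) z ≤ 0 := by
  rcases kern_cases (cap a) z with h0 | ⟨x, y, hy, hyx, -, hk⟩
  · exact h0.1.le
  · have hx : 0 < x := hy.trans_le hyx
    rw [hk]
    refine div_nonpos_of_nonpos_of_nonneg ?_ (by positivity)
    refine (realH1_le_of_min (fun r hr => mul_cap_ofReal a hr) hy hyx).trans ?_
    have : 0 ≤ min x (a : ℝ) + min y a - min (x + y) a := by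
      have h0 : (0 : ℝ) ≤ a := a.coe_nonneg
      clear hk
      grind
    have h4 : 0 ≤ 4 * (x * y) * (min x (a : ℝ) + min y a - min (x + y) a) := by positivity
    linarith

/-- Above `a` the minimum is saturated, so the subadditivity defect `min x a + min y a - min (x+y)
a` equals `a`. This quantifies the dissipation. -/
lemma kern_cap_le_of_le (a : ℝ≥0) {z : ℝ≥0∞ × ℝ≥0∞} (h1 : (a : ℝ≥0∞) ≤ z.1)
    (h2 : (a : ℝ≥0∞) ≤ z.2) (ht1 : z.1 ≠ ∞) (ht2 : z.2 ≠ ∞) : kern (cap a) z ≤ -(4 * a) := by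
  rcases kern_cases (cap a) z with h0 | ⟨x, y, hy, hyx, hz, hk⟩
  · have : a = 0 := by
      rcases h0.2 with h | h
      · have : z.1 = 0 := by simpa [ENNReal.toReal_eq_zero_iff, ht1] using h
        simpa [this] using h1
      · have : z.2 = 0 := by simpa [ENNReal.toReal_eq_zero_iff, ht2] using h
        simpa [this] using h2
    rw [h0.1, this]
    simp
  · have hx : 0 < x := hy.trans_le hyx
    have hay : (a : ℝ) ≤ y := by
      have : (a : ℝ≥0∞) ≤ ENNReal.ofReal y := by
        rcases hz with rfl | rfl
        exacts [h2, h1]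
      rw [← ENNReal.ofReal_coe_nnreal] at this
      exact (ENNReal.ofReal_le_ofReal_iff hy.le).1 this
    rw [hk, div_le_iff₀ (by positivity)]
    refine (realH1_le_of_min (fun r hr => mul_cap_ofReal a hr) hy hyx).trans ?_
    rw [min_eq_right (hay.trans hyx), min_eq_right hay, min_eq_right (by linarith)]
    linarith

/-- On the reals `cap a` is `a / max r a`: Lipschitz with constant `1/a`, and `r · cap a r = a`
beyond `a`. -/
lemma exists_abs_kern_cap_le {a : ℝ≥0} (ha : 0 < a) : ∃ C, ∀ z, |kern (cap a) z| ≤ C := by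
  have ha' : (0 : ℝ) < a := ha
  have hv : ∀ r, 0 ≤ r → onReal (cap a) r = a / max r a := by
    intro r hr
    rcases hr.eq_or_lt with rfl | h
    · simp only [onReal, ENNReal.ofReal_zero]
      rw [cap_of_le ha (by simp), max_eq_right ha'.le, div_self ha'.ne']
    · have := mul_cap_ofReal a hr
      have hm : 0 < max r (a : ℝ) := lt_max_of_lt_left h
      rw [eq_div_iff hm.ne']
      apply mul_left_cancel₀ h.ne'
      rw [← mul_assoc, this, min_mul_max]
  have hB : ∀ r, 0 ≤ r → |onReal (cap a) r| ≤ 1 := fun r _ => by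
    rw [onReal, abs_of_nonneg (cap_nonneg _ _)]; exact cap_le_one _ _
  have hL : ∀ x y, 0 ≤ x → 0 ≤ y → |onReal (cap a) x - onReal (cap a) y| ≤ 1 / a * |x - y| := by
    intro x y hx hy
    rw [hv x hx, hv y hy]
    have mx : (a : ℝ) ≤ max x a := le_max_right _ _
    have my : (a : ℝ) ≤ max y a := le_max_right _ _
    have px := ha'.trans_le mx
    have py := ha'.trans_le my
    have hd : |max y (a : ℝ) - max x a| ≤ |y - x| := abs_max_sub_max_le_abs _ _ _
    rw [div_sub_div _ _ px.ne' py.ne', abs_div, abs_of_pos (mul_pos px py),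
      show a * max y (a : ℝ) - max x a * a = a * (max y a - max x a) by ring, abs_mul,
      abs_of_pos ha', div_le_iff₀ (mul_pos px py)]
    calc (a : ℝ) * |max y (a : ℝ) - max x a| ≤ a * |y - x| := by gcongr
      _ = 1 / a * |x - y| * (a * a) := by rw [abs_sub_comm]; field_simp
      _ ≤ 1 / a * |x - y| * (max x a * max y a) := by gcongr
  refine ⟨_, abs_kern_le ?_ fun x y hy hyx => abs_realH1_le_of_lipschitz (A := a) (B := 1)
    (L := 1 / a) (c := a) ha' hB hL (fun x hx => ?_) hy hyx⟩
  · positivity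
  · rw [mul_cap_ofReal a (ha'.le.trans hx), min_eq_right hx]

lemma exists_abs_kern_tent_le {b : ℝ≥0} (hb : 0 < b) : ∃ C, ∀ z, |kern (tent b) z| ≤ C := by
  have hb' : (0 : ℝ) < b := hb
  have hB : ∀ r, 0 ≤ r → |onReal (tent b) r| ≤ 1 := fun r _ => by
    rw [onReal, abs_of_nonneg (tent_nonneg _ _)]; exact tent_le_one _ _
  refine ⟨_, abs_kern_le ?_ fun x y hy hyx => abs_realH1_le_of_lipschitz (A := 1 / b) (B := 1)
    (L := b) (c := 0) (by positivity) hB (fun x y hx hy => ?_) (fun x hx => ?_) hy hyx⟩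
  · positivity
  · rw [onReal_tent b hx, onReal_tent b hy]
    refine (abs_max_sub_max_le_abs _ _ _).trans ?_
    rw [show (1 - b * x - (1 - b * y) : ℝ) = b * (y - x) by ring, abs_mul, abs_of_pos hb',
      abs_sub_comm]
  · have hx0 : 0 ≤ x := le_trans (by positivity) hx
    rw [onReal_tent b hx0, max_eq_right, mul_zero]
    rw [div_le_iff₀ hb'] at hx
    linarith

/-- The loss of `tent b` is controlled by `tent b` itself, the form that a Grönwall argument needs.
-/
lemma le_kern_tent {b : ℝ≥0} (hb : 0 < b) (z : ℝ≥0∞ × ℝ≥0∞) :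
    -(16 / b * (tent b z.1 + tent b z.2)) ≤ kern (tent b) z := by
  have hb' : (0 : ℝ) < b := hb
  rcases kern_cases (tent b) z with h0 | ⟨x, y, hy, hyx, hz, hk⟩
  · rw [h0.1, neg_nonpos]
    have := tent_nonneg b z.1
    have := tent_nonneg b z.2
    positivity
  · have hx : 0 < x := hy.trans_le hyx
    rw [hk, le_div_iff₀ (by positivity)]
    have := le_realH1_of_tent hb' (fun r hr => onReal_tent b hr) hy hyx
    rcases hz with rfl | rfl
    · exact this
    · rw [add_comm]; exact this

/-! ### Measurability in time and integrability. -/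

/-- A weakly continuous curve of finite measures is measurable. -/
lemma measurable_toMeasure_of_continuous {X Y : Type*} [TopologicalSpace X] [MeasurableSpace X]
    [OpensMeasurableSpace X] [TopologicalSpace Y] [HasOuterApproxClosed Y] [MeasurableSpace Y]
    [BorelSpace Y] {κ : X → FiniteMeasure Y} (hκ : Continuous κ) :
    Measurable fun x => (κ x : Measure Y) := by
  have key : ∀ F : Set Y, IsClosed F → Measurable fun x => (κ x : Measure Y) F := by
    intro F hF
    refine measurable_of_tendsto_metrizable (f := fun n x => ∫⁻ y, hF.apprSeq n y ∂(κ x)) ?_ ?_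
    · intro n
      exact (FiniteMeasure.continuous_iff_forall_continuous_lintegral.1 hκ _).measurable
    · exact tendsto_pi_nhds.2 fun x => HasOuterApproxClosed.tendsto_lintegral_apprSeq hF (κ x)
  refine Measurable.measure_of_isPiSystem (S := {s : Set Y | IsClosed s}) ?_ isPiSystem_isClosed
    key (key _ isClosed_univ)
  rw [BorelSpace.measurable_eq (α := Y), borel_eq_generateFrom_isClosed]

/-- Integrals against a measurable family of measures of bounded mass depend measurably on the
parameter. -/
lemma measurable_integral_of_measurable {X Y : Type*} [MeasurableSpace X] [MeasurableSpace Y]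
    {κ : X → Measure Y} (hκ : Measurable κ) {M : ℝ≥0} (hM : ∀ x, κ x Set.univ ≤ M)
    {f : X × Y → ℝ} (hf : Measurable f) : Measurable fun x => ∫ y, f (x, y) ∂(κ x) := by
  let k : ProbabilityTheory.Kernel X Y := ⟨κ, hκ⟩
  have : ProbabilityTheory.IsFiniteKernel k := ⟨M, ENNReal.coe_lt_top, hM⟩
  exact (hf.stronglyMeasurable.integral_kernel_prod_right' (κ := k)).measurable

lemma measurable_prod_of_measurable {X Y : Type*} [MeasurableSpace X] [MeasurableSpace Y]
    {κ : X → Measure Y} [∀ x, IsFiniteMeasure (κ x)] (hκ : Measurable κ) :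
    Measurable fun x => (κ x).prod (κ x) := by
  let κ' : X → FiniteMeasure Y := fun x => ⟨κ x, inferInstance⟩
  have h : Measurable κ' := hκ.subtype_mk
  exact FiniteMeasure.measurable_fun_prod.comp (h.prodMk h)

lemma abs_integral_le_of_abs_le {X : Type*} [MeasurableSpace X] {μ : Measure X} [IsFiniteMeasure μ]
    {f : X → ℝ} {C : ℝ} (hC : ∀ x, |f x| ≤ C) : |∫ x, f x ∂μ| ≤ C * μ.real Set.univ := by
  rw [← Real.norm_eq_abs]
  exact norm_integral_le_of_norm_le_const (ae_of_all _ hC)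

lemma integrable_continuousMap {X : Type*} [TopologicalSpace X] [CompactSpace X]
    [MeasurableSpace X] [OpensMeasurableSpace X] (f : C(X, ℝ)) (μ : Measure X)
    [IsFiniteMeasure μ] : Integrable f μ :=
  Integrable.of_bound f.continuous.measurable.aestronglyMeasurable ‖f‖
    (ae_of_all _ f.norm_coe_le_norm)

lemma integrable_kern {φ : ℝ≥0∞ → ℝ} (hφ : Measurable φ) {C : ℝ} (hC : ∀ z, |kern φ z| ≤ C)
    (μ : Measure (ℝ≥0∞ × ℝ≥0∞)) [IsFiniteMeasure μ] : Integrable (kern φ) μ :=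
  Integrable.of_bound (measurable_kern hφ).aestronglyMeasurable C (ae_of_all _ hC)

/-! ### Conservation of energy and monotone functionals of weak solutions. -/

lemma timeDeriv_of_hasDerivAt {φ : ℝ → C(ℝ≥0∞, ℝ)} {φ' : C(ℝ≥0∞, ℝ)} {t : ℝ} (ht : 0 ≤ t)
    (h : HasDerivAt φ φ' t) : timeDeriv φ t = φ' :=
  h.hasDerivWithinAt.derivWithin (uniqueDiffOn_Ici 0 t ht)

/-- A weak solution of finite mass is a weak solution. -/
lemma IsWeakSolutionFiniteMass.isWeakSolution {G₀ : FiniteMeasure ℝ≥0∞}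
    {G : ℝ≥0 → FiniteMeasure ℝ≥0∞} (hG : IsWeakSolutionFiniteMass G₀ G) : IsWeakSolution G₀ G where
  continuous := hG.continuous
  weak φ hφ hk := by
    have e : ∀ c : C(ℝ≥0∞, ℝ), singularTest 0 c = c := fun c => by
      funext p; simp [singularTest]
    have e0 : ∀ t, timeDeriv (fun _ => 0) t = 0 := fun t => by
      simp [timeDeriv]
    have := hG.weak (fun _ => 0) φ contDiffOn_const hφ (fun _ _ => ⟨0, fun _ _ => rfl⟩)
      (by simpa only [e] using hk)
    simpa only [e, e0] using this

section solution

variable {G₀ : FiniteMeasure ℝ≥0∞} {G : ℝ≥0 → FiniteMeasure ℝ≥0∞}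

/-- The weak formulation for test functions that do not depend on time. -/
lemma IsWeakSolution.integral_sub_integral (hG : IsWeakSolution G₀ G) (φ : C(ℝ≥0∞, ℝ)) {C : ℝ}
    (hC : ∀ z, |kern φ z| ≤ C) (t : ℝ≥0) :
    (∫ p, φ p ∂(G t : Measure ℝ≥0∞)) - ∫ p, φ p ∂(G₀ : Measure ℝ≥0∞) =
      ∫ s in (0 : ℝ)..t, ∫ z, kern φ z
        ∂((G s.toNNReal : Measure ℝ≥0∞).prod (G s.toNNReal : Measure ℝ≥0∞)) := by
  have hb : HasBoundedKernels (fun _ p => φ p) := hasBoundedKernels_iff.2 fun T =>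
    ⟨C, (abs_nonneg _).trans (hC 0), fun _ _ => hC⟩
  have h0 : ∀ s, timeDeriv (fun _ => φ) s = 0 := fun s => by simp [timeDeriv]
  have := hG.weak (fun _ => φ) contDiffOn_const hb t
  simp only [h0, ContinuousMap.zero_apply, integral_zero, zero_add] at this
  rw [this]
  congr 1 with s
  exact collision_eq φ.continuous.measurable hC _

/-- The constant `1` is admissible with zero kernel; energy is conserved once the point `∞` is
counted. -/
lemma IsWeakSolution.mass_eq (hG : IsWeakSolution G₀ G) (t : ℝ≥0) : (G t).mass = G₀.mass := by
  have h1 : ∀ z, kern (1 : C(ℝ≥0∞, ℝ)) z = 0 := kern_const 1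
  have := hG.integral_sub_integral 1 (C := 0) (fun z => by rw [h1]; simp) t
  simp only [h1, integral_zero, intervalIntegral.integral_zero, ContinuousMap.one_apply,
    integral_const, smul_eq_mul, mul_one, sub_eq_zero] at this
  have h : ∀ ν : FiniteMeasure ℝ≥0∞, (ν : Measure ℝ≥0∞).real Set.univ = ν.mass := fun ν => rfl
  rw [h, h] at this
  exact_mod_cast this

lemma IsWeakSolution.measurable (hG : IsWeakSolution G₀ G) :
    Measurable fun s : ℝ => (G s.toNNReal : Measure ℝ≥0∞) :=
  measurable_toMeasure_of_continuous (hG.continuous.comp continuous_real_toNNReal)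

lemma IsWeakSolution.real_univ (hG : IsWeakSolution G₀ G) (t : ℝ≥0) :
    (G t : Measure ℝ≥0∞).real Set.univ = G₀.mass := by
  rw [← hG.mass_eq t]; rfl

lemma IsWeakSolution.measure_univ (hG : IsWeakSolution G₀ G) (t : ℝ≥0) :
    (G t : Measure ℝ≥0∞) Set.univ = G₀.mass := by
  rw [← hG.mass_eq t, FiniteMeasure.ennreal_mass]

lemma IsWeakSolution.measurable_integral (hG : IsWeakSolution G₀ G) {f : ℝ × ℝ≥0∞ → ℝ}
    (hf : Measurable f) :
    Measurable fun s : ℝ => ∫ p, f (s, p) ∂(G s.toNNReal : Measure ℝ≥0∞) :=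
  measurable_integral_of_measurable hG.measurable (M := G₀.mass)
    (fun _ => (hG.measure_univ _).le) hf

lemma IsWeakSolution.measurable_integral_prod (hG : IsWeakSolution G₀ G)
    {f : ℝ × (ℝ≥0∞ × ℝ≥0∞) → ℝ} (hf : Measurable f) :
    Measurable fun s : ℝ => ∫ z, f (s, z)
      ∂((G s.toNNReal : Measure ℝ≥0∞).prod (G s.toNNReal : Measure ℝ≥0∞)) := by
  refine measurable_integral_of_measurable (measurable_prod_of_measurable hG.measurable)
    (M := G₀.mass * G₀.mass) (fun s => ?_) hf
  rw [← Set.univ_prod_univ, Measure.prod_prod, hG.measure_univ, ENNReal.coe_mul]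

lemma IsWeakSolution.intervalIntegrable_kern (hG : IsWeakSolution G₀ G) {φ : ℝ≥0∞ → ℝ}
    (hφ : Measurable φ) {C : ℝ} (hC : ∀ z, |kern φ z| ≤ C) (a b : ℝ) :
    IntervalIntegrable (fun s : ℝ => ∫ z, kern φ z
      ∂((G s.toNNReal : Measure ℝ≥0∞).prod (G s.toNNReal : Measure ℝ≥0∞))) volume a b := by
  rw [intervalIntegrable_iff]
  refine Measure.integrableOn_of_bounded (M := C * (G₀.mass * G₀.mass)) (by simp)
    (hG.measurable_integral_prod ((measurable_kern hφ).comp measurable_snd)).aestronglyMeasurable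
    (ae_of_all _ fun s => ?_)
  refine (abs_integral_le_of_abs_le hC).trans_eq ?_
  rw [← Set.univ_prod_univ, measureReal_prod_prod, hG.real_univ]

/-- The functional `∫ min 1 (a / p) dG` decreases along weak solutions. -/
lemma IsWeakSolution.antitone_integral_cap (hG : IsWeakSolution G₀ G) {a : ℝ≥0} (ha : 0 < a) :
    Antitone fun t => ∫ p, cap a p ∂(G t : Measure ℝ≥0∞) := by
  obtain ⟨C, hC⟩ := exists_abs_kern_cap_le ha
  intro s t hst
  have h1 := hG.integral_sub_integral (cap a) hC s
  have h2 := hG.integral_sub_integral (cap a) hC t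
  have hi := hG.intervalIntegrable_kern (cap a).continuous.measurable hC
  have h3 := intervalIntegral.integral_add_adjacent_intervals (hi 0 s) (hi s t)
  have h4 : ∫ r in (s : ℝ)..t, ∫ z, kern (cap a) z
      ∂((G r.toNNReal : Measure ℝ≥0∞).prod (G r.toNNReal : Measure ℝ≥0∞)) ≤ 0 := by
    rw [← neg_nonneg, ← intervalIntegral.integral_neg]
    refine intervalIntegral.integral_nonneg (by exact_mod_cast hst) fun r _ => ?_
    rw [neg_nonneg]
    exact integral_nonpos fun z => kern_cap_le a z
  change ∫ p, cap a p ∂(G t : Measure ℝ≥0∞) ≤ ∫ p, cap a p ∂(G s : Measure ℝ≥0∞)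
  linarith

lemma IsWeakSolution.integral_cap_le (hG : IsWeakSolution G₀ G) {a : ℝ≥0} (ha : 0 < a) (t : ℝ≥0) :
    ∫ p, cap a p ∂(G t : Measure ℝ≥0∞) ≤ ∫ p, cap a p ∂(G₀ : Measure ℝ≥0∞) := by
  obtain ⟨C, hC⟩ := exists_abs_kern_cap_le ha
  -- The value `G 0` is tied to `G₀` only through the weak identity at time `0`.
  have h1 := hG.integral_sub_integral (cap a) hC 0
  simp only [NNReal.coe_zero, intervalIntegral.integral_same, sub_eq_zero] at h1
  exact (hG.antitone_integral_cap ha zero_le).trans_eq h1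

end solution

lemma measureReal_Iic_le_integral_cap (ν : Measure ℝ≥0∞) [IsFiniteMeasure ν] {a : ℝ≥0}
    (ha : 0 < a) : ν.real (Set.Iic (a : ℝ≥0∞)) ≤ ∫ p, cap a p ∂ν := by
  rw [← integral_indicator_one measurableSet_Iic]
  refine integral_mono ((integrable_const 1).indicator measurableSet_Iic)
    (integrable_continuousMap _ _) fun p => ?_
  by_cases hp : p ∈ Set.Iic (a : ℝ≥0∞)
  · simp [hp, cap_of_le ha hp]
  · simp [hp, cap_nonneg]

/-- As `a → ∞`, `∫ min 1 (a / p) dν` tends to the measure of `[0,∞)`. -/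
lemma tendsto_integral_cap_atTop (ν : Measure ℝ≥0∞) [IsFiniteMeasure ν] :
    Tendsto (fun n : ℕ => ∫ p, cap (n + 1) p ∂ν) atTop (𝓝 (ν.real {∞}ᶜ)) := by
  rw [← integral_indicator_one (measurableSet_singleton _).compl]
  refine tendsto_integral_of_dominated_convergence (fun _ => 1)
    (fun n => (cap _).continuous.measurable.aestronglyMeasurable) (integrable_const _)
    (fun n => ae_of_all _ fun p => ?_) (ae_of_all _ fun p => ?_)
  · rw [Real.norm_of_nonneg (cap_nonneg _ _)]
    exact cap_le_one _ _
  · rcases eq_or_ne p ∞ with rfl | hp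
    · simp
    · lift p to ℝ≥0 using hp
      refine tendsto_atTop_of_eventually_const (i₀ := ⌈p⌉₊) fun n hn => ?_
      rw [cap_of_le (by positivity), Set.indicator_of_mem (by simp), Pi.one_apply]
      have : p ≤ n := (Nat.le_ceil p).trans (by exact_mod_cast hn)
      exact_mod_cast this.trans (le_add_of_nonneg_right zero_le_one)

/-- As `a → 0`, `∫ min 1 (a / p) dν` tends to the measure of `{0}`. -/
lemma tendsto_integral_cap_zero (ν : Measure ℝ≥0∞) [IsFiniteMeasure ν] :
    Tendsto (fun n : ℕ => ∫ p, cap (1 / (n + 1)) p ∂ν) atTop (𝓝 (ν.real {0})) := by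
  rw [← integral_indicator_one (measurableSet_singleton _)]
  refine tendsto_integral_of_dominated_convergence (fun _ => 1)
    (fun n => (cap _).continuous.measurable.aestronglyMeasurable) (integrable_const _)
    (fun n => ae_of_all _ fun p => ?_) (ae_of_all _ fun p => ?_)
  · rw [Real.norm_of_nonneg (cap_nonneg _ _)]
    exact cap_le_one _ _
  · rcases eq_or_ne p 0 with rfl | h0
    · refine tendsto_const_nhds.congr fun n => ?_
      rw [cap_of_le (by positivity) (by simp), Set.indicator_of_mem (by simp), Pi.one_apply]
    · rw [Set.indicator_of_notMem (by simpa using h0)]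
      rcases eq_or_ne p ∞ with rfl | ht
      · simp
      · have hr : 0 < p.toReal := ENNReal.toReal_pos h0 ht
        refine squeeze_zero (fun n => cap_nonneg _ _) (g := fun n : ℕ => 1 / ((n : ℝ) + 1) / p.toReal)
          (fun n => ?_) ?_
        · rw [← ENNReal.ofReal_toReal ht, cap_ofReal _ hr]
          refine (min_le_right _ _).trans ?_
          simp
        · simpa using (tendsto_one_div_add_atTop_nhds_zero_nat (𝕜 := ℝ)).div_const p.toReal

variable {G₀ : FiniteMeasure ℝ≥0∞} {G : ℝ≥0 → FiniteMeasure ℝ≥0∞}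

/-- The energy at finite wave numbers decreases. -/
lemma IsWeakSolution.antitone_real_compl_top (hG : IsWeakSolution G₀ G) :
    Antitone fun t => (G t : Measure ℝ≥0∞).real {∞}ᶜ := fun s t hst =>
  le_of_tendsto_of_tendsto' (tendsto_integral_cap_atTop (G t : Measure ℝ≥0∞))
    (tendsto_integral_cap_atTop (G s : Measure ℝ≥0∞)) fun _ =>
      hG.antitone_integral_cap (by positivity) hst

lemma IsWeakSolution.coe_apply_top (hG : IsWeakSolution G₀ G) (t : ℝ≥0) :
    (G t {∞} : ℝ) = G₀.mass - (G t : Measure ℝ≥0∞).real {∞}ᶜ := by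
  rw [← hG.real_univ t, measureReal_compl (measurableSet_singleton _)]
  simp

lemma IsWeakSolution.monotone_apply_top (hG : IsWeakSolution G₀ G) :
    Monotone fun t => G t {∞} := fun s t hst => by
  rw [← NNReal.coe_le_coe, hG.coe_apply_top, hG.coe_apply_top]
  exact sub_le_sub_left (hG.antitone_real_compl_top hst) _

lemma IsWeakSolution.real_Iic_le (hG : IsWeakSolution G₀ G) {a : ℝ≥0} (ha : 0 < a) (t : ℝ≥0) :
    (G t : Measure ℝ≥0∞).real (Set.Iic (a : ℝ≥0∞)) ≤ ∫ p, cap a p ∂(G₀ : Measure ℝ≥0∞) :=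
  (measureReal_Iic_le_integral_cap _ ha).trans (hG.integral_cap_le ha t)

/-- `cap a` decreases to the indicator of `{0}` as `a → 0`, so the monotonicity of its integrals
passes to the atom at `0`. -/
lemma IsWeakSolution.apply_zero (hG : IsWeakSolution G₀ G) (h0 : G₀ {0} = 0) (t : ℝ≥0) :
    G t {0} = 0 := by
  have h := le_of_tendsto_of_tendsto' (tendsto_integral_cap_zero (G t : Measure ℝ≥0∞))
    (tendsto_integral_cap_zero (G₀ : Measure ℝ≥0∞)) fun n => hG.integral_cap_le (by positivity) t
  rw [FiniteMeasure.measureReal_eq_coe_coeFn, FiniteMeasure.measureReal_eq_coe_coeFn, h0] at h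
  exact le_antisymm (by exact_mod_cast h) zero_le

/-- Supplies a scale `a` depending on the datum only, below which no solution ever holds more than
`ε`. -/
lemma exists_integral_cap_le {ν : FiniteMeasure ℝ≥0∞} (h0 : ν {0} = 0) {ε : ℝ} (hε : 0 < ε) :
    ∃ a : ℝ≥0, 0 < a ∧ ∫ p, cap a p ∂(ν : Measure ℝ≥0∞) ≤ ε := by
  have h := tendsto_integral_cap_zero (ν : Measure ℝ≥0∞)
  rw [FiniteMeasure.measureReal_eq_coe_coeFn, h0] at h
  obtain ⟨n, hn⟩ := (h.eventually (Iic_mem_nhds (by simpa using hε : ((0 : ℝ≥0) : ℝ) < ε))).exists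
  exact ⟨1 / (n + 1), by positivity, hn⟩

/-! ### Dissipation rate, persistence of finite energy, full cascade. -/

/-- The energy at finite wave numbers is spent at a definite rate. -/
lemma IsWeakSolution.real_compl_top_le (hG : IsWeakSolution G₀ G) {a : ℝ≥0} (ha : 0 < a) {t : ℝ≥0}
    (ht : 0 < t) : (G t : Measure ℝ≥0∞).real {∞}ᶜ ≤
      (∫ p, cap a p ∂(G₀ : Measure ℝ≥0∞)) + √(G₀.mass / (4 * a * t)) := by
  set m := ∫ p, cap a p ∂(G₀ : Measure ℝ≥0∞) with hm
  set d := (G t : Measure ℝ≥0∞).real {∞}ᶜ - m with hd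
  suffices d ≤ √(G₀.mass / (4 * a * t)) by linarith
  rcases le_total d 0 with hd0 | hd0
  · exact hd0.trans (Real.sqrt_nonneg _)
  refine Real.le_sqrt_of_sq_le ?_
  have ha' : (0 : ℝ) < a := ha
  have ht' : (0 : ℝ) < t := ht
  rw [le_div_iff₀ (by positivity)]
  obtain ⟨C, hC⟩ := exists_abs_kern_cap_le ha
  have h1 := hG.integral_sub_integral (cap a) hC t
  have h2 : ∫ p, cap a p ∂(G₀ : Measure ℝ≥0∞) ≤ G₀.mass := by
    refine (integral_mono (integrable_continuousMap _ _) (integrable_const 1)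
      (fun p => cap_le_one a p)).trans_eq ?_
    simp only [integral_const, smul_eq_mul, mul_one]
    rfl
  have h3 : 0 ≤ ∫ p, cap a p ∂(G t : Measure ℝ≥0∞) := integral_nonneg fun p => cap_nonneg a p
  -- The functional is lost at rate at least `4 a d²` on all of `[0,t]` and is initially at most the
  -- total energy `E`, so `4 a t d² ≤ E`.
  have h4 : ∀ r ∈ Set.Icc (0 : ℝ) t, ∫ z, kern (cap a) z
      ∂((G r.toNNReal : Measure ℝ≥0∞).prod (G r.toNNReal : Measure ℝ≥0∞)) ≤ -(4 * a * d ^ 2) := by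
    intro r hr
    set ν : Measure ℝ≥0∞ := (G r.toNNReal : Measure ℝ≥0∞)
    set S : Set ℝ≥0∞ := {p | (a : ℝ≥0∞) ≤ p ∧ p < ∞}
    have hS : MeasurableSet S := measurableSet_Ico
    -- At each earlier time the finite energy is at least its value at `t`, and at most `m` of it
    -- lies in `[0,a]`.
    have hdS : d ≤ ν.real S := by
      have hsub : ({∞}ᶜ : Set ℝ≥0∞) ⊆ S ∪ Set.Iic (a : ℝ≥0∞) := fun p hp => by
        rcases le_total (a : ℝ≥0∞) p with h | h
        · exact Or.inl ⟨h, lt_top_iff_ne_top.2 hp⟩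
        · exact Or.inr h
      have k1 : ν.real {∞}ᶜ ≤ ν.real S + ν.real (Set.Iic (a : ℝ≥0∞)) :=
        (measureReal_mono hsub).trans (measureReal_union_le _ _)
      have k2 := hG.real_Iic_le ha r.toNNReal
      have k3 : (G t : Measure ℝ≥0∞).real {∞}ᶜ ≤ ν.real {∞}ᶜ :=
        hG.antitone_real_compl_top (Real.toNNReal_le_iff_le_coe.2 hr.2)
      linarith
    calc ∫ z, kern (cap a) z ∂(ν.prod ν)
        ≤ ∫ z, (S ×ˢ S).indicator (fun _ => -(4 * (a : ℝ))) z ∂(ν.prod ν) := by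
          refine integral_mono (integrable_kern (cap a).continuous.measurable hC _)
            ((integrable_const _).indicator (hS.prod hS)) fun z => ?_
          by_cases hz : z ∈ S ×ˢ S
          · rw [Set.indicator_of_mem hz]
            exact kern_cap_le_of_le a hz.1.1 hz.2.1 hz.1.2.ne hz.2.2.ne
          · rw [Set.indicator_of_notMem hz]
            exact kern_cap_le a z
      _ = -(4 * a * (ν.real S) ^ 2) := by
          rw [integral_indicator_const _ (hS.prod hS), measureReal_prod_prod, smul_eq_mul]
          ring
      _ ≤ -(4 * a * d ^ 2) := by
          gcongr
  have h5 := intervalIntegral.integral_mono_on ht'.le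
    (hG.intervalIntegrable_kern (cap a).continuous.measurable hC 0 t)
    (intervalIntegrable_const (μ := volume)) h4
  rw [intervalIntegral.integral_const, smul_eq_mul, sub_zero] at h5
  nlinarith

/-- A solution keeps some energy at finite wave numbers for all times. -/
lemma IsWeakSolution.integral_tent_pos (hG : IsWeakSolution G₀ G) {b : ℝ≥0} (hb : 0 < b)
    (h0 : 0 < ∫ p, tent b p ∂(G₀ : Measure ℝ≥0∞)) (t : ℝ≥0) :
    0 < ∫ p, tent b p ∂(G t : Measure ℝ≥0∞) := by
  have hb' : (0 : ℝ) < b := hb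
  obtain ⟨C, hC⟩ := exists_abs_kern_tent_le hb
  have hC0 : 0 ≤ C := (abs_nonneg _).trans (hC 0)
  set E : ℝ := ((G₀.mass : ℝ≥0) : ℝ) with hE
  have hE0 : 0 ≤ E := G₀.mass.coe_nonneg
  -- The rate: `16 / b` for each of the two arguments of the kernel bound, times the total mass `E`
  -- of the other factor. With it `exp (c s) ∫ tent b dG_s` cannot fall below its initial value.
  set c : ℝ := 32 / b * E with hc
  have hc0 : 0 ≤ c := by positivity
  have hd : ∀ s : ℝ, HasDerivAt (fun s : ℝ => Real.exp (c * s) • tent b)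
      ((Real.exp (c * s) * c) • tent b) s := fun s => by
    have : HasDerivAt (fun s : ℝ => c * s) c s := by simpa using (hasDerivAt_id s).const_mul c
    exact this.exp.smul_const (tent b)
  have hcd : ContDiffOn ℝ 1 (fun s : ℝ => Real.exp (c * s) • tent b) (Set.Ici 0) := by
    have : ContDiff ℝ 1 fun s : ℝ => Real.exp (c * s) := by fun_prop
    exact (this.smul contDiff_const).contDiffOn
  have hk : ∀ s : ℝ, ∀ z, kern (fun p => (Real.exp (c * s) • tent b) p) z
      = Real.exp (c * s) * kern (tent b) z := fun s z => by
    simp only [ContinuousMap.smul_apply, smul_eq_mul]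
    exact kern_mul_left _ _ z
  have hkb : ∀ s : ℝ, ∀ z, |kern (fun p => (Real.exp (c * s) • tent b) p) z|
      ≤ Real.exp (c * s) * C := fun s z => by
    rw [hk, abs_mul, Real.abs_exp]
    exact mul_le_mul_of_nonneg_left (hC z) (Real.exp_pos _).le
  have hbd : HasBoundedKernels (fun s p => (Real.exp (c * s) • tent b) p) := by
    refine hasBoundedKernels_iff.2 fun T => ⟨Real.exp (c * T) * C, by positivity, fun s hs z => ?_⟩
    refine (hkb s z).trans ?_
    have := mul_le_mul_of_nonneg_left hs.2 hc0
    gcongr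
  have hw := hG.weak _ hcd hbd t
  have hnn : 0 ≤ ∫ s in (0 : ℝ)..t,
        ((∫ p, timeDeriv (fun s : ℝ => Real.exp (c * s) • tent b) s p
            ∂(G s.toNNReal : Measure ℝ≥0∞))
          + collision (fun p => (Real.exp (c * s) • tent b) p)
            (G s.toNNReal : Measure ℝ≥0∞)) := by
    refine intervalIntegral.integral_nonneg t.2 fun s hs => ?_
    set ν : Measure ℝ≥0∞ := (G s.toNNReal : Measure ℝ≥0∞) with hν
    have hνE : ν.real Set.univ = E := hG.real_univ _
    rw [timeDeriv_of_hasDerivAt hs.1 (hd s), collision_eq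
      (Real.exp (c * s) • tent b).continuous.measurable (hkb s)]
    simp only [hk, ContinuousMap.smul_apply, smul_eq_mul, integral_const_mul]
    have key : -(c * ∫ p, tent b p ∂ν) ≤ ∫ z, kern (tent b) z ∂(ν.prod ν) := by
      have hi := integrable_continuousMap (tent b) ν
      have hi1 : Integrable (fun z : ℝ≥0∞ × ℝ≥0∞ => tent b z.1) (ν.prod ν) := hi.comp_fst ν
      have hi2 : Integrable (fun z : ℝ≥0∞ × ℝ≥0∞ => tent b z.2) (ν.prod ν) := hi.comp_snd ν
      calc -(c * ∫ p, tent b p ∂ν)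
          = ∫ z, -(16 / b * (tent b z.1 + tent b z.2)) ∂(ν.prod ν) := by
            rw [integral_neg, integral_const_mul, integral_add hi1 hi2,
              integral_fun_fst (fun p => tent b p), integral_fun_snd (fun p => tent b p), hνE, hc,
              smul_eq_mul]
            ring
        _ ≤ _ := integral_mono ((hi1.add hi2).const_mul _).neg
            (integrable_kern (tent b).continuous.measurable hC _) fun z => le_kern_tent hb z
    have := mul_le_mul_of_nonneg_left key (Real.exp_pos (c * s)).le
    linarith
  rw [← hw] at hnn
  simp only [ContinuousMap.smul_apply, smul_eq_mul, integral_const_mul, mul_zero, Real.exp_zero,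
    one_mul] at hnn
  exact (mul_pos_iff_of_pos_left (Real.exp_pos (c * t))).1 (by linarith)

/-- As `b → 0`, `tent b` increases to the indicator of `[0,∞)`. -/
lemma exists_integral_tent_pos {ν : FiniteMeasure ℝ≥0∞} (h : 0 < (ν : Measure ℝ≥0∞).real {∞}ᶜ) :
    ∃ b : ℝ≥0, 0 < b ∧ 0 < ∫ p, tent b p ∂(ν : Measure ℝ≥0∞) := by
  have ht : Tendsto (fun n : ℕ => ∫ p, tent (1 / (n + 1)) p ∂(ν : Measure ℝ≥0∞)) atTop
      (𝓝 ((ν : Measure ℝ≥0∞).real {∞}ᶜ)) := by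
    rw [← integral_indicator_one (measurableSet_singleton _).compl]
    refine tendsto_integral_of_dominated_convergence (fun _ => 1)
      (fun n => (tent _).continuous.measurable.aestronglyMeasurable) (integrable_const _)
      (fun n => ae_of_all _ fun p => ?_) (ae_of_all _ fun p => ?_)
    · rw [Real.norm_of_nonneg (tent_nonneg _ _)]
      exact tent_le_one _ _
    · rcases eq_or_ne p ∞ with rfl | hp
      · simp only [Set.mem_compl_iff, Set.mem_singleton_iff, not_true_eq_false,
          not_false_eq_true, Set.indicator_of_notMem]
        refine tendsto_const_nhds.congr fun n => (tent_top (by positivity)).symm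
      · rw [Set.indicator_of_mem (by simpa using hp), Pi.one_apply, ← ENNReal.ofReal_toReal hp]
        have h1 : Tendsto (fun n : ℕ => max (1 - 1 / ((n : ℝ) + 1) * p.toReal) 0) atTop (𝓝 1) := by
          have := ((tendsto_one_div_add_atTop_nhds_zero_nat (𝕜 := ℝ)).mul_const p.toReal).const_sub 1
          simpa using this.max (tendsto_const_nhds (x := (0 : ℝ)))
        refine h1.congr fun n => ?_
        have := onReal_tent (1 / (n + 1)) (ENNReal.toReal_nonneg (a := p))
        rw [onReal] at this
        rw [this]
        simp
  obtain ⟨n, hn⟩ := (ht.eventually (lt_mem_nhds h)).exists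
  exact ⟨_, by positivity, hn⟩

lemma IsWeakSolution.real_compl_top_pos (hG : IsWeakSolution G₀ G)
    (h : 0 < (G₀ : Measure ℝ≥0∞).real {∞}ᶜ) (t : ℝ≥0) :
    0 < (G t : Measure ℝ≥0∞).real {∞}ᶜ := by
  obtain ⟨b, hb, hpos⟩ := exists_integral_tent_pos h
  refine (hG.integral_tent_pos hb hpos t).trans_le ?_
  rw [← integral_indicator_one (measurableSet_singleton _).compl]
  refine integral_mono (integrable_continuousMap _ _)
    ((integrable_const 1).indicator (measurableSet_singleton _).compl) fun p => ?_
  rcases eq_or_ne p ∞ with rfl | hp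
  · simp [tent_top hb]
  · rw [Set.indicator_of_mem (by simpa using hp)]
    exact tent_le_one _ _

/-- All energy moves to infinity. -/
lemma IsWeakSolution.tendsto_real_compl_top (hG : IsWeakSolution G₀ G) (h0 : G₀ {0} = 0) :
    Tendsto (fun t => (G t : Measure ℝ≥0∞).real {∞}ᶜ) atTop (𝓝 0) := by
  refine tendsto_order.2 ⟨fun x hx => Eventually.of_forall fun t => hx.trans_le measureReal_nonneg,
    fun x hx => ?_⟩
  -- The scale `a` is fixed before `t` grows: half of the error is the low-energy bound, half the
  -- decaying square root.
  obtain ⟨a, ha, hax⟩ := exists_integral_cap_le h0 (half_pos hx)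
  have hs : Tendsto (fun t : ℝ≥0 => √((G₀.mass : ℝ) / (4 * a * t))) atTop (𝓝 0) := by
    have ha' : (0 : ℝ) < 4 * a := by have : (0 : ℝ) < a := ha; positivity
    have h1 : Tendsto (fun t : ℝ≥0 => 4 * (a : ℝ) * t) atTop atTop :=
      (NNReal.tendsto_coe_atTop.2 tendsto_id).const_mul_atTop ha'
    have h2 := (h1.const_div_atTop (G₀.mass : ℝ)).sqrt
    rwa [Real.sqrt_zero] at h2
  filter_upwards [hs.eventually (gt_mem_nhds (half_pos hx)), eventually_gt_atTop 0] with t h1 h2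
  have := hG.real_compl_top_le ha h2
  linarith

/-- The finite energy is positive at `t₀` yet tends to zero, so it is strictly smaller at some later
time. -/
lemma IsWeakSolution.exists_apply_top_lt (hG : IsWeakSolution G₀ G) (h0 : G₀ {0} = 0)
    (h : 0 < (G₀ : Measure ℝ≥0∞).real {∞}ᶜ) (t₀ : ℝ≥0) :
    ∃ t₁, t₀ < t₁ ∧ G t₀ {∞} < G t₁ {∞} := by
  have hpos := hG.real_compl_top_pos h t₀
  obtain ⟨t₁, h1, h2⟩ := (((hG.tendsto_real_compl_top h0).eventually (gt_mem_nhds hpos)).and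
    (eventually_gt_atTop t₀)).exists
  refine ⟨t₁, h2, ?_⟩
  rw [← NNReal.coe_lt_coe, hG.coe_apply_top, hG.coe_apply_top]
  linarith

/-- Since the total mass is constant, the error against `f` is the integral of `f - f ∞`, which
lives on `[0,∞)` and is at most `2 ‖f‖` times the finite energy. -/
lemma IsWeakSolution.tendsto (hG : IsWeakSolution G₀ G) (h0 : G₀ {0} = 0) :
    Tendsto G atTop (𝓝 (G₀.mass • diracInfty)) := by
  rw [FiniteMeasure.tendsto_iff_forall_integral_tendsto]
  intro f
  rw [tendsto_iff_norm_sub_tendsto_zero]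
  have hlim : ∫ p, f p ∂((G₀.mass • diracInfty : FiniteMeasure ℝ≥0∞) : Measure ℝ≥0∞)
      = G₀.mass * f ∞ := by
    rw [FiniteMeasure.toMeasure_smul, integral_smul_nnreal_measure]
    simp only [diracInfty, FiniteMeasure.toMeasure_mk, integral_dirac, NNReal.smul_def, smul_eq_mul]
  have hbound : ∀ t, ‖(∫ p, f p ∂(G t : Measure ℝ≥0∞)) -
      ∫ p, f p ∂((G₀.mass • diracInfty : FiniteMeasure ℝ≥0∞) : Measure ℝ≥0∞)‖
      ≤ 2 * ‖f‖ * (G t : Measure ℝ≥0∞).real {∞}ᶜ := by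
    intro t
    have hi : Integrable f (G t : Measure ℝ≥0∞) := f.integrable _
    have e : (∫ p, f p ∂(G t : Measure ℝ≥0∞)) - G₀.mass * f ∞
        = ∫ p, (f p - f ∞) ∂(G t : Measure ℝ≥0∞) := by
      rw [integral_sub hi (integrable_const _), integral_const, hG.real_univ, smul_eq_mul]
    have e2 : ∫ p, (f p - f ∞) ∂(G t : Measure ℝ≥0∞)
        = ∫ p in {∞}ᶜ, (f p - f ∞) ∂(G t : Measure ℝ≥0∞) := by
      rw [← integral_indicator (measurableSet_singleton _).compl]
      congr 1 with p
      rcases eq_or_ne p ∞ with rfl | hp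
      · simp
      · rw [Set.indicator_of_mem (by simpa using hp)]
    rw [hlim, e, e2]
    refine norm_setIntegral_le_of_norm_le_const (measure_lt_top _ _) fun p _ => ?_
    refine (norm_sub_le _ _).trans ?_
    linarith [f.norm_coe_le_norm p, f.norm_coe_le_norm ∞]
  refine squeeze_zero (fun _ => norm_nonneg _) hbound ?_
  simpa using (hG.tendsto_real_compl_top h0).const_mul (2 * ‖f‖)

lemma real_compl_top_smul_diracInfty (E : ℝ≥0) :
    ((E • diracInfty : FiniteMeasure ℝ≥0∞) : Measure ℝ≥0∞).real {∞}ᶜ = 0 := by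
  rw [FiniteMeasure.measureReal_eq_coe_coeFn, FiniteMeasure.smul_apply]
  simp [diracInfty, FiniteMeasure.mk_apply]

lemma eq_smul_diracInfty {ν : FiniteMeasure ℝ≥0∞} (h : (ν : Measure ℝ≥0∞).real {∞}ᶜ = 0) :
    ν = ν.mass • diracInfty := by
  refine FiniteMeasure.toMeasure_injective (Measure.ext fun s hs => ?_)
  have h0 : (ν : Measure ℝ≥0∞) {∞}ᶜ = 0 := by
    rwa [measureReal_eq_zero_iff] at h
  rw [FiniteMeasure.toMeasure_smul]
  simp only [diracInfty, FiniteMeasure.toMeasure_mk, Measure.smul_apply, Measure.dirac_apply' _ hs]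
  by_cases ht : ∞ ∈ s
  · have : sᶜ ⊆ {∞}ᶜ := Set.compl_subset_compl.2 (by simpa using ht)
    have h1 : (ν : Measure ℝ≥0∞) sᶜ = 0 := measure_mono_null this h0
    have h2 := measure_add_measure_compl (μ := (ν : Measure ℝ≥0∞)) hs
    rw [h1, add_zero] at h2
    rw [h2, Set.indicator_of_mem ht, ← FiniteMeasure.ennreal_mass]
    simp [ENNReal.smul_def]
  · have : s ⊆ {∞}ᶜ := fun p hp => by rintro rfl; exact ht hp
    rw [measure_mono_null this h0, Set.indicator_of_notMem ht, smul_zero]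

/-- Data concentrated at infinity stay there. -/
lemma IsWeakSolution.eq_smul_diracInfty {E : ℝ≥0} (hG : IsWeakSolution (E • diracInfty) G)
    (t : ℝ≥0) : G t = E • diracInfty := by
  have hm : (E • diracInfty).mass = E := by
    rw [FiniteMeasure.mass, FiniteMeasure.smul_apply]
    simp [diracInfty, FiniteMeasure.mk_apply]
  have hz : (G t : Measure ℝ≥0∞).real {∞}ᶜ ≤ 0 := by
    rw [← real_compl_top_smul_diracInfty E]
    exact le_of_tendsto_of_tendsto' (tendsto_integral_cap_atTop _)
      (tendsto_integral_cap_atTop _) fun n => hG.integral_cap_le (by positivity) t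
  have := ThreeWave.eq_smul_diracInfty (le_antisymm hz measureReal_nonneg)
  rwa [hG.mass_eq, hm] at this

lemma IsWeakSolution.exists_apply_Iio_le (hG : IsWeakSolution G₀ G) (h0 : G₀ {0} = 0)
    (hne : G₀ ≠ 0) {ε : ℝ≥0} (hε : 0 < ε) :
    ∃ R : ℝ≥0, 0 < R ∧ ∀ t, G t (Set.Iio (R : ℝ≥0∞)) ≤ ε * G₀.mass := by
  have hE : 0 < G₀.mass := pos_iff_ne_zero.2 ((FiniteMeasure.mass_nonzero_iff _).2 hne)
  obtain ⟨a, ha, hle⟩ := exists_integral_cap_le h0 (ε := ε * G₀.mass) (by positivity)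
  refine ⟨a, ha, fun t => ?_⟩
  have h1 : G t (Set.Iio (a : ℝ≥0∞)) ≤ G t (Set.Iic (a : ℝ≥0∞)) :=
    (G t).apply_mono Set.Iio_subset_Iic_self
  have h2 := (hG.real_Iic_le ha t).trans hle
  rw [FiniteMeasure.measureReal_eq_coe_coeFn] at h2
  exact h1.trans (by exact_mod_cast h2)

/-- The rate of the cascade, with constants that depend on the initial datum only. -/
lemma exists_cascade_rate (h0 : G₀ {0} = 0) (hne : G₀ ≠ 0) :
    ∃ C₁ C₂ T T' : ℝ, ∃ r : ℝ≥0, ∃ Tr : ℝ,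
      0 < C₁ ∧ 0 < C₂ ∧ 0 < T ∧ 0 < T' ∧ 0 < r ∧ 0 < Tr ∧
      ∀ G : ℝ≥0 → FiniteMeasure ℝ≥0∞, IsWeakSolution G₀ G →
        (∀ t : ℝ≥0, T < t → C₁ - C₂ / √(t : ℝ) < G t {∞}) ∧
        (∀ t : ℝ≥0, T' < t → C₁ / 2 < G t {∞}) ∧
        (∀ t : ℝ≥0, Tr < t → C₁ ≤ G t (Set.Ici (r : ℝ≥0∞))) := by
  have hE : 0 < (G₀.mass : ℝ) :=
    NNReal.coe_pos.2 (pos_iff_ne_zero.2 ((FiniteMeasure.mass_nonzero_iff _).2 hne))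
  set E : ℝ := ((G₀.mass : ℝ≥0) : ℝ) with hEdef
  obtain ⟨a, ha, hle⟩ := exists_integral_cap_le h0 (half_pos hE)
  have ha' : (0 : ℝ) < a := ha
  -- The added `1` turns the estimate into a strict inequality.
  set K : ℝ := √(E / (4 * a)) + 1 with hK
  have hK0 : 0 < K := by positivity
  have key : ∀ G : ℝ≥0 → FiniteMeasure ℝ≥0∞, IsWeakSolution G₀ G → ∀ t : ℝ≥0, 0 < t →
      E / 2 - K / √(t : ℝ) < G t {∞} := by
    intro G hG t ht
    have ht' : (0 : ℝ) < t := ht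
    have h1 := hG.real_compl_top_le ha ht
    have h2 : √((G₀.mass : ℝ) / (4 * a * t)) < K / √(t : ℝ) := by
      rw [← div_div, Real.sqrt_div (by positivity)]
      have := Real.sqrt_pos.2 ht'
      gcongr
      linarith
    rw [hG.coe_apply_top]
    linarith
  -- `C₁ = E / 2` is what `a` leaves outside `[0,a]`; beyond `(4K/E)²` the correction `K / √t` is at
  -- most `E / 4 = C₁ / 2`. The two times `1` are arbitrary, as those estimates hold for every `t >
  -- 0`.
  refine ⟨E / 2, K, 1, (4 * K / E) ^ 2, a, 1, by positivity, hK0, one_pos, by positivity, ha,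
    one_pos, fun G hG => ⟨fun t ht => ?_, fun t ht => ?_, fun t _ => ?_⟩⟩
  · exact key G hG t (by exact_mod_cast zero_lt_one.trans ht)
  · have ht0 : (0 : ℝ) < t := lt_of_le_of_lt (sq_nonneg _) ht
    have h1 := key G hG t (by exact_mod_cast ht0)
    have h2 : 4 * K / E ≤ √(t : ℝ) := Real.le_sqrt_of_sq_le ht.le
    have h3 : K / √(t : ℝ) ≤ E / 4 := by
      rw [div_le_iff₀ (Real.sqrt_pos.2 ht0)]
      rw [div_le_iff₀ hE] at h2
      linarith
    linarith
  · have h1 := (hG.real_Iic_le ha t).trans hle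
    have h2 : (G t : Measure ℝ≥0∞).real Set.univ ≤ (G t : Measure ℝ≥0∞).real (Set.Ici (a : ℝ≥0∞))
        + (G t : Measure ℝ≥0∞).real (Set.Iic (a : ℝ≥0∞)) := by
      refine (measureReal_mono fun p _ => ?_).trans (measureReal_union_le _ _)
      exact (le_total (a : ℝ≥0∞) p)
    rw [hG.real_univ] at h2
    rw [FiniteMeasure.measureReal_eq_coe_coeFn] at h1
    simp only [FiniteMeasure.measureReal_eq_coe_coeFn] at h2
    linarith

/-! ### Finite mass: singular test functions as limits of truncated ones. -/

/-- Multiplying a function with `min 1 (r / δ)` changes the bound of its kernel by a multiple of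
the bound of `r f r` near `0`, uniformly in `δ`. -/
lemma abs_realH1_le_of_cutoff {f g : ℝ → ℝ} {B C δ : ℝ} (hδ : 0 < δ) (hδ1 : δ ≤ 1)
    (hg : ∀ r, 0 < r → g r = min 1 (r / δ) * f r) (hB : ∀ r, 0 < r → r ≤ 3 → |r * f r| ≤ B)
    {x y : ℝ} (hy : 0 < y) (hyx : y ≤ x) (hC : |realH1 f x y| ≤ C * (x * y)) :
    |realH1 g x y| ≤ (C + 22 * B) * (x * y) := by
  have hx : 0 < x := hy.trans_le hyx
  have hB0 : 0 ≤ B := (abs_nonneg _).trans (hB 1 one_pos (by norm_num))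
  have hxy : 0 < x * y := mul_pos hx hy
  set θ : ℝ → ℝ := fun r => min 1 (r / δ) with hθ
  have θ1 : ∀ r, δ ≤ r → θ r = 1 := fun r hr => min_eq_left ((one_le_div hδ).2 hr)
  have θle : ∀ r, θ r ≤ 1 := fun r => min_le_left _ _
  have θnn : ∀ r, 0 ≤ r → 0 ≤ θ r := fun r hr => le_min zero_le_one (by positivity)
  rcases le_total x (2 * y) with h2 | h2
  · have hh : ∀ r, 0 ≤ r → |r * (g r - f r)| ≤ B := by
      intro r hr
      rcases hr.eq_or_lt with rfl | hr0
      · simpa using hB0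
      · rw [hg r hr0]
        rcases le_total δ r with h | h
        · have := θ1 r h
          simp only [hθ] at this
          rw [this]
          simpa using hB0
        · have e : r * (min 1 (r / δ) * f r - f r) = (θ r - 1) * (r * f r) := by
            simp only [hθ]; ring
          rw [e, abs_mul]
          have : |θ r - 1| ≤ 1 := abs_le.2 ⟨by linarith [θnn r hr], by linarith [θle r]⟩
          calc |θ r - 1| * |r * f r| ≤ 1 * B :=
                mul_le_mul this (hB r hr0 (by linarith)) (abs_nonneg _) zero_le_one
            _ = B := one_mul B
    have e : realH1 g x y = realH1 f x y + realH1 (fun r => g r - f r) x y := by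
      simp only [realH1]; ring
    rw [e]
    refine (abs_add_le _ _).trans ?_
    have := abs_realH1_le_of_comparable hh hy hyx h2
    linarith
  · have hxmy : 0 < x - y := by linarith
    -- The cutoff is frozen at `x`; the corrections are differences of `θ` times bounded values of
    -- `r f r`.
    have e : realH1 g x y = θ x * realH1 f x y
        + (θ (x + y) - θ x) * ((x + y) ^ 2 * ((x + y) * f (x + y)))
        + (θ (x - y) - θ x) * ((x - y) ^ 2 * ((x - y) * f (x - y)))
        + (θ x - θ y) * (4 * (x * y) * (y * f y)) := by
      simp only [realH1, hg (x + y) (by positivity), hg x hx, hg y hy, hg (x - y) hxmy]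
      ring
    have t1 : |θ x * realH1 f x y| ≤ C * (x * y) := by
      rw [abs_mul, abs_of_nonneg (θnn x hx.le)]
      calc θ x * |realH1 f x y| ≤ 1 * |realH1 f x y| := by gcongr; exact θle x
        _ ≤ _ := by rwa [one_mul]
    have t4 : |(θ x - θ y) * (4 * (x * y) * (y * f y))| ≤ 4 * B * (x * y) := by
      rcases le_total δ y with h | h
      · rw [θ1 y h, θ1 x (h.trans hyx)]
        simp only [sub_self, zero_mul, abs_zero]
        positivity
      · have d : |θ x - θ y| ≤ 1 :=
          abs_le.2 ⟨by linarith [θnn x hx.le, θle y], by linarith [θnn y hy.le, θle x]⟩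
        rw [abs_mul, abs_mul, abs_of_nonneg (by positivity : 0 ≤ 4 * (x * y))]
        calc |θ x - θ y| * (4 * (x * y) * |y * f y|) ≤ 1 * (4 * (x * y) * B) := by
              gcongr
              exact hB y hy (by linarith)
          _ = _ := by ring
    have t23 : |(θ (x + y) - θ x) * ((x + y) ^ 2 * ((x + y) * f (x + y)))| ≤ 8 * B * (x * y) ∧
        |(θ (x - y) - θ x) * ((x - y) ^ 2 * ((x - y) * f (x - y)))| ≤ 2 * B * (x * y) := by
      -- If `x ≥ 2δ`, then `x - y ≥ δ` and `θ = 1` at all three points. Otherwise the slope `1/δ` of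
      -- `θ` yields the factor `y / x`, and `x + y ≤ 3`, which explains the range in `hB`.
      rcases le_total (2 * δ) x with h | h
      · rw [θ1 x (by linarith), θ1 (x + y) (by linarith), θ1 (x - y) (by linarith)]
        simp only [sub_self, zero_mul, abs_zero]
        constructor <;> positivity
      · have lip : ∀ u v, |θ u - θ v| ≤ |u - v| / δ := fun u v => by
          refine (abs_min_sub_min_le_max 1 (u / δ) 1 (v / δ)).trans ?_
          rw [sub_self, abs_zero, max_eq_right (abs_nonneg _), ← sub_div, abs_div, abs_of_pos hδ]
        have hyδ : y / δ ≤ 2 * (y / x) := by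
          rw [div_le_iff₀ hδ, show 2 * (y / x) * δ = y * (2 * δ) / x by ring, le_div_iff₀ hx]
          exact mul_le_mul_of_nonneg_left h hy.le
        have l1 : |θ (x + y) - θ x| ≤ 2 * (y / x) := by
          have := lip (x + y) x
          rw [show x + y - x = y by ring, abs_of_pos hy] at this
          exact this.trans hyδ
        have l2 : |θ (x - y) - θ x| ≤ 2 * (y / x) := by
          have := lip (x - y) x
          rw [show x - y - x = -y by ring, abs_neg, abs_of_pos hy] at this
          exact this.trans hyδ
        constructor
        · rw [abs_mul, abs_mul, abs_of_nonneg (sq_nonneg (x + y))]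
          calc |θ (x + y) - θ x| * ((x + y) ^ 2 * |(x + y) * f (x + y)|)
              ≤ 2 * (y / x) * ((2 * x) ^ 2 * B) := by
                gcongr
                · linarith
                · exact hB _ (by positivity) (by linarith)
            _ = _ := by field_simp; ring
        · rw [abs_mul, abs_mul, abs_of_nonneg (sq_nonneg (x - y))]
          calc |θ (x - y) - θ x| * ((x - y) ^ 2 * |(x - y) * f (x - y)|)
              ≤ 2 * (y / x) * (x ^ 2 * B) := by
                gcongr
                · linarith
                · exact hB _ hxmy (by linarith)
            _ = _ := by field_simp
    rw [e]
    have n1 := abs_add_le (θ x * realH1 f x y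
        + (θ (x + y) - θ x) * ((x + y) ^ 2 * ((x + y) * f (x + y)))
        + (θ (x - y) - θ x) * ((x - y) ^ 2 * ((x - y) * f (x - y))))
        ((θ x - θ y) * (4 * (x * y) * (y * f y)))
    have n2 := abs_add_le (θ x * realH1 f x y
        + (θ (x + y) - θ x) * ((x + y) ^ 2 * ((x + y) * f (x + y))))
        ((θ (x - y) - θ x) * ((x - y) ^ 2 * ((x - y) * f (x - y))))
    have n3 := abs_add_le (θ x * realH1 f x y)
        ((θ (x + y) - θ x) * ((x + y) ^ 2 * ((x + y) * f (x + y))))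
    have : 0 ≤ B * (x * y) := by positivity
    linarith [t23.1, t23.2]

/-- The function `min 1 (b p)` on `[0,∞]`. -/
def ramp (b : ℝ≥0) : C(ℝ≥0∞, ℝ) where
  toFun p := (min 1 (b * p)).toReal
  continuous_toFun := by
    have : Continuous fun p : ℝ≥0∞ => min 1 ((b : ℝ≥0∞) * p) :=
      continuous_const.min (ENNReal.continuous_const_mul (by simp))
    exact ENNReal.continuousOn_toReal.comp_continuous this fun p => by simp

lemma ramp_apply (b : ℝ≥0) (p : ℝ≥0∞) : ramp b p = (min 1 (b * p)).toReal := rfl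

lemma ramp_nonneg (b : ℝ≥0) (p : ℝ≥0∞) : 0 ≤ ramp b p := ENNReal.toReal_nonneg

lemma ramp_le_one (b : ℝ≥0) (p : ℝ≥0∞) : ramp b p ≤ 1 := by
  rw [ramp_apply, ← ENNReal.toReal_one]
  exact ENNReal.toReal_mono (by simp) (min_le_left _ _)

lemma ramp_top {b : ℝ≥0} (hb : 0 < b) : ramp b ∞ = 1 := by
  simp [ramp_apply, ENNReal.mul_top, hb.ne']

lemma ramp_ofReal (b : ℝ≥0) {r : ℝ} (hr : 0 ≤ r) : ramp b (ENNReal.ofReal r) = min 1 (b * r) := by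
  rw [ramp_apply, ENNReal.toReal_min (by simp) (ENNReal.mul_ne_top (by simp) (by simp)),
    ENNReal.toReal_mul, ENNReal.toReal_ofReal hr]
  simp

/-- The continuous function that agrees with `singularTest ψ c` for `p ≥ 1 / b`. -/
def truncatedTest (b : ℝ≥0) (ψ c : C(ℝ≥0∞, ℝ)) : C(ℝ≥0∞, ℝ) :=
  ψ * ((b : ℝ) • cap (1 / b)) + c * ramp b

/-- Because `b · cap (1/b) p = min b (1/p) = ramp b p / p`, the continuous truncation is
multiplication by the ramp. -/
lemma truncatedTest_eq {b : ℝ≥0} (hb : 0 < b) (ψ c : C(ℝ≥0∞, ℝ)) {p : ℝ≥0∞} (hp : p ≠ 0) :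
    truncatedTest b ψ c p = ramp b p * singularTest ψ c p := by
  have hb' : (0 : ℝ) < b := hb
  simp only [truncatedTest, ContinuousMap.add_apply, ContinuousMap.mul_apply,
    ContinuousMap.smul_apply, smul_eq_mul, singularTest]
  rcases eq_or_ne p ∞ with rfl | ht
  · simp [ramp_top hb]
  · have hr : 0 < p.toReal := ENNReal.toReal_pos hp ht
    have e : (b : ℝ) * cap (1 / b) p = ramp b p * (p⁻¹).toReal := by
      rw [← ENNReal.ofReal_toReal ht, cap_ofReal _ hr, ramp_ofReal _ hr.le, ENNReal.toReal_inv,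
        ENNReal.toReal_ofReal hr.le, mul_min_of_nonneg _ _ hb'.le,
        min_mul_of_nonneg _ _ (inv_nonneg.2 hr.le), min_comm]
      simp only [NNReal.coe_div, NNReal.coe_one]
      congr 1 <;> field_simp
    rw [e]
    ring

lemma tendsto_truncatedTest (ψ c : C(ℝ≥0∞, ℝ)) {p : ℝ≥0∞} (hp : p ≠ 0) :
    Tendsto (fun n : ℕ => truncatedTest (n + 1) ψ c p) atTop (𝓝 (singularTest ψ c p)) := by
  obtain ⟨N, hN⟩ := ENNReal.exists_nat_gt (ENNReal.inv_ne_top.2 hp)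
  refine tendsto_atTop_of_eventually_const (i₀ := N) fun n hn => ?_
  rw [truncatedTest_eq (by positivity) ψ c hp]
  have h1 : (1 : ℝ≥0∞) ≤ ((n + 1 : ℝ≥0) : ℝ≥0∞) * p := by
    have hle : p⁻¹ ≤ ((n + 1 : ℝ≥0) : ℝ≥0∞) := by
      refine hN.le.trans ?_
      have : (N : ℝ≥0) ≤ n + 1 := by exact_mod_cast hn.trans n.le_succ
      exact_mod_cast this
    rw [mul_comm]
    exact (ENNReal.inv_le_iff_le_mul (by simp) (by simp)).1 hle
  rw [ramp_apply, min_eq_left h1, ENNReal.toReal_one, one_mul]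

lemma abs_truncatedTest_le {b : ℝ≥0} (hb : 0 < b) (ψ c : C(ℝ≥0∞, ℝ)) {p : ℝ≥0∞} (hp : p ≠ 0) :
    |truncatedTest b ψ c p| ≤ (p⁻¹).toReal * ‖ψ‖ + ‖c‖ := by
  rw [truncatedTest_eq hb ψ c hp, abs_mul, abs_of_nonneg (ramp_nonneg b p)]
  calc ramp b p * |singularTest ψ c p| ≤ 1 * |singularTest ψ c p| := by
        gcongr; exact ramp_le_one b p
    _ ≤ |(p⁻¹).toReal * ψ p| + |c p| := by rw [one_mul]; exact abs_add_le _ _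
    _ ≤ _ := by
      rw [abs_mul, abs_of_nonneg ENNReal.toReal_nonneg]
      have h1 : |ψ p| ≤ ‖ψ‖ := ψ.norm_coe_le_norm p
      have h2 : |c p| ≤ ‖c‖ := c.norm_coe_le_norm p
      gcongr

lemma measurable_singularTest (ψ c : C(ℝ≥0∞, ℝ)) : Measurable (singularTest ψ c) :=
  (measurable_inv.ennreal_toReal.mul ψ.continuous.measurable).add c.continuous.measurable

/-- The bound does not depend on `b`: on `(0,3]`, `p` times the singular test function is `ψ + p c`,
at most `‖ψ‖ + 3 ‖c‖`, and the cutoff estimate applies with `δ = 1/b ≤ 1`. -/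
lemma abs_kern_truncatedTest_le {b : ℝ≥0} (hb : 1 ≤ b) {ψ c : C(ℝ≥0∞, ℝ)} {C : ℝ}
    (hC : ∀ z, |kern (singularTest ψ c) z| ≤ C) (z : ℝ≥0∞ × ℝ≥0∞) :
    |kern (truncatedTest b ψ c) z| ≤ C + 22 * (‖ψ‖ + 3 * ‖c‖) := by
  have hb0 : 0 < b := one_pos.trans_le hb
  have hb' : (1 : ℝ) ≤ b := hb
  refine abs_kern_le ?_ (fun x y hy hyx => abs_realH1_le_of_cutoff (f := onReal (singularTest ψ c))
    (δ := 1 / b) (by positivity) ?_ (fun r hr => ?_) (fun r hr hr3 => ?_) hy hyx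
      (abs_realH1_le hC hy hyx)) z
  · have := (abs_nonneg _).trans (hC z)
    positivity
  · rw [div_le_one (by positivity)]; exact hb'
  · have h0 : ENNReal.ofReal r ≠ 0 := by simpa using hr
    rw [onReal, onReal, truncatedTest_eq hb0 ψ c h0, ramp_ofReal b hr.le]
    congr 2
    field_simp
  · have e : r * onReal (singularTest ψ c) r
        = ψ (ENNReal.ofReal r) + r * c (ENNReal.ofReal r) := by
      rw [onReal, singularTest, ENNReal.toReal_inv, ENNReal.toReal_ofReal hr.le]
      field_simp
    rw [e]
    refine (abs_add_le _ _).trans ?_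
    rw [abs_mul, abs_of_pos hr]
    have h1 : |ψ (ENNReal.ofReal r)| ≤ ‖ψ‖ := ψ.norm_coe_le_norm _
    have h2 : |c (ENNReal.ofReal r)| ≤ ‖c‖ := c.norm_coe_le_norm _
    gcongr

lemma tendsto_kern_truncatedTest (ψ c : C(ℝ≥0∞, ℝ)) (z : ℝ≥0∞ × ℝ≥0∞) :
    Tendsto (fun n : ℕ => kern (truncatedTest (n + 1) ψ c) z) atTop
      (𝓝 (kern (singularTest ψ c) z)) := by
  simp only [kern_eq]
  refine Tendsto.div_const ?_ _
  set x := max z.1.toReal z.2.toReal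
  set y := min z.1.toReal z.2.toReal
  have hy : 0 ≤ y := le_min ENNReal.toReal_nonneg ENNReal.toReal_nonneg
  have hyx : y ≤ x := min_le_max
  have hx : 0 ≤ x := hy.trans hyx
  -- At `r = 0` the truncated functions equal `(n+1) ψ 0` and may diverge, but there the coefficient
  -- vanishes.
  have key : ∀ r, 0 ≤ r → ∀ m : ℝ, (r = 0 → m = 0) →
      Tendsto (fun n : ℕ => m * onReal (truncatedTest (n + 1) ψ c) r) atTop
      (𝓝 (m * onReal (singularTest ψ c) r)) := by
    intro r hr m hm
    rcases hr.eq_or_lt with rfl | h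
    · simp [hm rfl]
    · exact (tendsto_truncatedTest ψ c (by simpa using h)).const_mul m
  simp only [realH1]
  refine (((key _ (by positivity) _ ?_).sub (key _ hx _ ?_)).sub (key _ hy _ ?_)).add
    (key _ (by linarith) _ ?_)
  all_goals intro h; simp [h]

lemma integrable_inv_toReal {ν : FiniteMeasure ℝ≥0∞} (h : mass ν < ∞) :
    Integrable (fun p : ℝ≥0∞ => (p⁻¹).toReal) (ν : Measure ℝ≥0∞) :=
  integrable_toReal_of_lintegral_ne_top measurable_inv.aemeasurable h.ne

lemma ae_ne_zero_of_mass {ν : FiniteMeasure ℝ≥0∞} (h : mass ν < ∞) :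
    ∀ᵐ p ∂(ν : Measure ℝ≥0∞), p ≠ 0 := by
  filter_upwards [ae_lt_top measurable_inv h.ne] with p hp h0
  simp [h0] at hp

lemma tendsto_integral_truncatedTest {ν : FiniteMeasure ℝ≥0∞} (h : mass ν < ∞)
    (ψ c : C(ℝ≥0∞, ℝ)) :
    Tendsto (fun n : ℕ => ∫ p, truncatedTest (n + 1) ψ c p ∂(ν : Measure ℝ≥0∞)) atTop
      (𝓝 (∫ p, singularTest ψ c p ∂(ν : Measure ℝ≥0∞))) := by
  refine tendsto_integral_of_dominated_convergence (fun p => (p⁻¹).toReal * ‖ψ‖ + ‖c‖)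
    (fun n => (ContinuousMap.continuous _).measurable.aestronglyMeasurable)
    (((integrable_inv_toReal h).mul_const _).add (integrable_const _)) (fun n => ?_) ?_
  · filter_upwards [ae_ne_zero_of_mass h] with p hp
    exact abs_truncatedTest_le (by positivity) ψ c hp
  · filter_upwards [ae_ne_zero_of_mass h] with p hp
    exact tendsto_truncatedTest ψ c hp

lemma abs_integral_truncatedTest_le {b : ℝ≥0} (hb : 0 < b) {ν : FiniteMeasure ℝ≥0∞}
    (h : mass ν < ∞) (ψ c : C(ℝ≥0∞, ℝ)) :
    |∫ p, truncatedTest b ψ c p ∂(ν : Measure ℝ≥0∞)|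
      ≤ (mass ν).toReal * ‖ψ‖ + (ν : Measure ℝ≥0∞).real Set.univ * ‖c‖ := by
  have hi := (integrable_inv_toReal h).mul_const ‖ψ‖
  have hae : ∀ᵐ p ∂(ν : Measure ℝ≥0∞), ‖truncatedTest b ψ c p‖ ≤ (p⁻¹).toReal * ‖ψ‖ + ‖c‖ := by
    filter_upwards [ae_ne_zero_of_mass h] with p hp
    exact abs_truncatedTest_le hb ψ c hp
  refine (norm_integral_le_of_norm_le (hi.add (integrable_const _)) hae).trans_eq ?_
  rw [integral_add' hi (integrable_const _), integral_mul_const, integral_const, smul_eq_mul,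
    integral_toReal measurable_inv.aemeasurable (ae_lt_top measurable_inv h.ne), mass]

/-- Monotone convergence, as `(n+1) · cap (1/(n+1)) p = min (n+1) (1/p)` increases to `1/p`. The
mass thereby inherits the monotonicity of the `cap` functionals. -/
lemma mass_eq_iSup (ν : FiniteMeasure ℝ≥0∞) : mass ν = ⨆ n : ℕ, ENNReal.ofReal
    (((n : ℝ) + 1) * ∫ p, cap (1 / (n + 1)) p ∂(ν : Measure ℝ≥0∞)) := by
  have hcap : ∀ (n : ℕ) (p : ℝ≥0∞),
      ENNReal.ofReal (((n : ℝ) + 1) * cap (1 / (n + 1)) p) = min ((n : ℝ≥0∞) + 1) p⁻¹ := by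
    intro n p
    have hn : ENNReal.ofReal ((n : ℝ) + 1) = (n : ℝ≥0∞) + 1 := by
      rw [ENNReal.ofReal_add (by positivity) zero_le_one]; simp
    rw [ENNReal.ofReal_mul (by positivity), hn, cap_apply, ENNReal.ofReal_toReal (by simp),
      Monotone.map_min (f := fun x => ((n : ℝ≥0∞) + 1) * x) (fun _ _ h => mul_le_mul' le_rfl h), mul_one,
      ← mul_assoc]
    have : ((n : ℝ≥0∞) + 1) * ((1 / (n + 1) : ℝ≥0) : ℝ≥0∞) = 1 := by
      have h : ((n : ℝ≥0) + 1) * (1 / (n + 1)) = 1 := by field_simp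
      exact_mod_cast h
    rw [this, one_mul]
  have hsup : ∀ p : ℝ≥0∞, p⁻¹ = ⨆ n : ℕ, min ((n : ℝ≥0∞) + 1) p⁻¹ := by
    intro p
    have ht : ⨆ n : ℕ, ((n : ℝ≥0∞) + 1) = ⊤ := by
      rw [eq_top_iff, ← ENNReal.iSup_natCast]
      exact iSup_mono fun n => le_self_add
    have := iSup_inf_eq (fun n : ℕ => (n : ℝ≥0∞) + 1) p⁻¹
    rwa [ht, top_inf_eq] at this
  rw [mass, lintegral_congr hsup, lintegral_iSup]
  · congr 1 with n
    rw [← integral_const_mul, ofReal_integral_eq_lintegral_ofReal]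
    · exact lintegral_congr fun p => (hcap n p).symm
    · exact (integrable_continuousMap _ _).const_mul _
    · exact ae_of_all _ fun p => mul_nonneg (by positivity) (cap_nonneg _ _)
  · exact fun n => measurable_const.min measurable_inv
  · intro m n hmn p
    exact min_le_min (by gcongr) le_rfl

section solution

variable {G₀ : FiniteMeasure ℝ≥0∞} {G : ℝ≥0 → FiniteMeasure ℝ≥0∞}

lemma IsWeakSolution.antitone_mass (hG : IsWeakSolution G₀ G) :
    Antitone fun t => mass (G t) := fun s t hst => by
  simp only [mass_eq_iSup]
  refine iSup_mono fun n => ENNReal.ofReal_le_ofReal ?_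
  exact mul_le_mul_of_nonneg_left
    (hG.antitone_integral_cap (a := 1 / (n + 1)) (by positivity) hst) (by positivity)

lemma IsWeakSolution.mass_le (hG : IsWeakSolution G₀ G) (t : ℝ≥0) : mass (G t) ≤ mass G₀ := by
  simp only [mass_eq_iSup]
  refine iSup_mono fun n => ENNReal.ofReal_le_ofReal ?_
  exact mul_le_mul_of_nonneg_left
    (hG.integral_cap_le (a := 1 / (n + 1)) (by positivity) t) (by positivity)

/-- Test functions are only regular on `[0,∞)`; extending them constantly to negative times gives
curves on all of `ℝ`. -/
lemma continuous_comp_max_zero {φ : ℝ → C(ℝ≥0∞, ℝ)} (hφ : ContinuousOn φ (Set.Ici 0)) :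
    Continuous fun s => φ (max s 0) :=
  hφ.comp_continuous (by fun_prop) fun _ => Set.mem_Ici.2 (le_max_right _ _)

lemma continuousOn_timeDeriv {φ : ℝ → C(ℝ≥0∞, ℝ)} (hφ : ContDiffOn ℝ 1 φ (Set.Ici 0)) :
    ContinuousOn (timeDeriv φ) (Set.Ici 0) :=
  hφ.continuousOn_derivWithin (uniqueDiffOn_Ici 0) le_rfl

lemma measurable_uncurry_of_continuous {φ : ℝ → C(ℝ≥0∞, ℝ)} (hφ : Continuous φ) :
    Measurable (Function.uncurry fun s p => φ s p) := by
  have : Continuous fun q : ℝ × ℝ≥0∞ => φ q.1 q.2 := by fun_prop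
  exact this.measurable

lemma IsWeakSolution.aestronglyMeasurable_integrand (hG : IsWeakSolution G₀ G)
    {φ φ' : ℝ → C(ℝ≥0∞, ℝ)} (hφ : ContinuousOn φ (Set.Ici 0)) (hφ' : ContinuousOn φ' (Set.Ici 0))
    {T C : ℝ} (hT : 0 ≤ T) (hC : ∀ s ∈ Set.Icc 0 T, ∀ z, |kern (φ s) z| ≤ C) :
    AEStronglyMeasurable (fun s : ℝ => (∫ p, φ' s p ∂(G s.toNNReal : Measure ℝ≥0∞))
      + collision (φ s) (G s.toNNReal : Measure ℝ≥0∞)) (volume.restrict (Set.uIoc 0 T)) := by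
  have h1 := hG.measurable_integral
    (measurable_uncurry_of_continuous (continuous_comp_max_zero hφ'))
  have h2 := hG.measurable_integral_prod (measurable_kern_uncurry
    (measurable_uncurry_of_continuous (continuous_comp_max_zero hφ)))
  refine (h1.add h2).aestronglyMeasurable.congr
    (ae_restrict_of_forall_mem measurableSet_uIoc fun s hs => ?_)
  rw [Set.uIoc_of_le hT] at hs
  simp only [Pi.add_apply, Function.uncurry_apply_pair, max_eq_left hs.1.le]
  rw [collision_eq (φ s).continuous.measurable (hC s ⟨hs.1.le, hs.2⟩)]

/-- A weak solution with initial datum of finite mass is a weak solution of finite mass. -/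
lemma IsWeakSolution.isWeakSolutionFiniteMass (hG : IsWeakSolution G₀ G) (hm : mass G₀ < ∞) :
    IsWeakSolutionFiniteMass G₀ G where
  continuous := hG.continuous
  mass_initial := hm
  mass_finite t := (hG.mass_le t).trans_lt hm
  weak ψ c hψ hc _ hk t := by
    have hmt : ∀ t, mass (G t) < ∞ := fun t => (hG.mass_le t).trans_lt hm
    obtain ⟨C, hC0, hC⟩ := hasBoundedKernels_iff.1 hk t
    have bound : ∀ {χ : ℝ → C(ℝ≥0∞, ℝ)}, ContinuousOn χ (Set.Ici 0) →
        ∀ T : ℝ, ∃ M, 0 ≤ M ∧ ∀ s ∈ Set.Icc (0 : ℝ) T, ‖χ s‖ ≤ M := fun {χ} hχ T => by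
      obtain ⟨M, hM⟩ := isCompact_Icc.exists_bound_of_continuousOn
        (hχ.mono (Set.Icc_subset_Ici_self : Set.Icc (0 : ℝ) T ⊆ _))
      exact ⟨max M 0, le_max_right _ _, fun s hs => (hM s hs).trans (le_max_left _ _)⟩
    obtain ⟨Mψ, -, hMψ⟩ := bound hψ.continuousOn t
    obtain ⟨Mc, -, hMc⟩ := bound hc.continuousOn t
    obtain ⟨Nψ, hNψ0, hNψ⟩ := bound (continuousOn_timeDeriv hψ) t
    obtain ⟨Nc, hNc0, hNc⟩ := bound (continuousOn_timeDeriv hc) t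
    set φ : ℕ → ℝ → C(ℝ≥0∞, ℝ) := fun n s => truncatedTest (n + 1) (ψ s) (c s) with hφ
    have hcd : ∀ n, ContDiffOn ℝ 1 (φ n) (Set.Ici 0) := fun n =>
      (hψ.mul contDiffOn_const).add (hc.mul contDiffOn_const)
    have hder : ∀ n, ∀ s, 0 ≤ s →
        timeDeriv (φ n) s = truncatedTest (n + 1) (timeDeriv ψ s) (timeDeriv c s) := by
      intro n s hs
      have d1 := ((hψ.differentiableOn one_ne_zero s hs).hasDerivWithinAt.mul_const
        (((n + 1 : ℝ≥0) : ℝ) • cap (1 / (n + 1))))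
      have d2 := ((hc.differentiableOn one_ne_zero s hs).hasDerivWithinAt.mul_const
        (ramp (n + 1)))
      exact (d1.add d2).derivWithin (uniqueDiffOn_Ici 0 s hs)
    have hkb : ∀ n, ∀ T : ℝ, ∀ C M N : ℝ, (∀ s ∈ Set.Icc 0 T, ∀ z,
        |kern (singularTest (ψ s) (c s)) z| ≤ C) → (∀ s ∈ Set.Icc 0 T, ‖ψ s‖ ≤ M) →
        (∀ s ∈ Set.Icc 0 T, ‖c s‖ ≤ N) →
        ∀ s ∈ Set.Icc 0 T, ∀ z, |kern (φ n s) z| ≤ C + 22 * (M + 3 * N) := by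
      intro n T C M N h1 h2 h3 s hs z
      refine (abs_kern_truncatedTest_le (by simp) (h1 s hs) z).trans ?_
      have := h2 s hs
      have := h3 s hs
      linarith
    have hkt : ∀ n, ∀ s ∈ Set.Icc (0 : ℝ) t, ∀ z, |kern (φ n s) z| ≤ C + 22 * (Mψ + 3 * Mc) :=
      fun n => hkb n t C Mψ Mc hC hMψ hMc
    have hbd : ∀ n, HasBoundedKernels (fun s p => φ n s p) := by
      intro n
      refine hasBoundedKernels_iff.2 fun T => ?_
      obtain ⟨C', hC'0, hC'⟩ := hasBoundedKernels_iff.1 hk T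
      obtain ⟨M, hM0, hM⟩ := bound hψ.continuousOn T
      obtain ⟨N, hN0, hN⟩ := bound hc.continuousOn T
      exact ⟨C' + 22 * (M + 3 * N), by positivity, hkb n T C' M N hC' hM hN⟩
    have hid := fun n => hG.weak (φ n) (hcd n) (hbd n) t
    -- Both sides of the identities for the truncated functions converge by dominated convergence:
    -- `1/p` is integrable because the mass stays below that of `G₀`, and the kernels share one
    -- bound.
    have lhs := ((tendsto_integral_truncatedTest (hmt t) (ψ t) (c t)).sub
      (tendsto_integral_truncatedTest hm (ψ 0) (c 0)))
    refine tendsto_nhds_unique lhs ?_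
    refine Tendsto.congr (fun n => (hid n).symm) ?_
    have ht0 : (0 : ℝ) ≤ t := t.2
    set E : ℝ := ((G₀.mass : ℝ≥0) : ℝ)
    refine intervalIntegral.tendsto_integral_filter_of_dominated_convergence
      (fun _ => ((mass G₀).toReal * Nψ + E * Nc) + (C + 22 * (Mψ + 3 * Mc)) * (E * E))
      (Eventually.of_forall fun n => hG.aestronglyMeasurable_integrand (hcd n).continuousOn
        (continuousOn_timeDeriv (hcd n)) ht0 (hkt n))
      (Eventually.of_forall fun n => ae_of_all _ fun s hs => ?_) intervalIntegrable_const
      (ae_of_all _ fun s hs => ?_)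
    · rw [Set.uIoc_of_le ht0] at hs
      have hs' : s ∈ Set.Icc (0 : ℝ) t := ⟨hs.1.le, hs.2⟩
      change ‖(∫ p, timeDeriv (φ n) s p ∂(G s.toNNReal : Measure ℝ≥0∞))
        + collision (φ n s) (G s.toNNReal : Measure ℝ≥0∞)‖ ≤ _
      rw [hder n s hs.1.le, collision_eq (φ n s).continuous.measurable (hkt n s hs')]
      refine (norm_add_le _ _).trans (add_le_add ?_ ?_)
      · refine (abs_integral_truncatedTest_le (by positivity) (hmt _) _ _).trans ?_
        rw [hG.real_univ]
        gcongr
        · exact hm.ne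
        · exact hG.mass_le _
        · exact hNψ s hs'
        · exact hNc s hs'
      · refine (abs_integral_le_of_abs_le (hkt n s hs')).trans_eq ?_
        rw [← Set.univ_prod_univ, measureReal_prod_prod, hG.real_univ]
    · rw [Set.uIoc_of_le ht0] at hs
      have hs' : s ∈ Set.Icc (0 : ℝ) t := ⟨hs.1.le, hs.2⟩
      have e1 := collision_eq (measurable_singularTest (ψ s) (c s)) (hC s hs')
        (G s.toNNReal : Measure ℝ≥0∞)
      have e2 := fun n => collision_eq (φ n s).continuous.measurable (hkt n s hs')
        (G s.toNNReal : Measure ℝ≥0∞)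
      simp only [hder _ s hs.1.le, e1, e2]
      refine (tendsto_integral_truncatedTest (hmt _) _ _).add
        (tendsto_integral_of_dominated_convergence (fun _ => C + 22 * (Mψ + 3 * Mc))
          (fun n => (measurable_kern (φ n s).continuous.measurable).aestronglyMeasurable)
          (integrable_const _) (fun n => ae_of_all _ fun z => hkt n s hs' z)
          (ae_of_all _ fun z => tendsto_kern_truncatedTest (ψ s) (c s) z))

end solution

/-! ### Compactness for curves of probability measures on `[0,∞]`. -/

/-- Integration against a finite measure as a continuous functional. -/
def integralFunctional {X : Type*} [TopologicalSpace X] [CompactSpace X] [MeasurableSpace X]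
    [OpensMeasurableSpace X] (μ : Measure X) [IsFiniteMeasure μ] : C(X, ℝ) →L[ℝ] ℝ :=
  LinearMap.mkContinuous
    { toFun := fun f => ∫ x, f x ∂μ
      map_add' := fun f g =>
        integral_add (integrable_continuousMap f μ) (integrable_continuousMap g μ)
      map_smul' := fun c f => integral_const_mul c f } (μ.real Set.univ) fun f => by
    rw [mul_comm]
    exact norm_integral_le_of_norm_le_const (ae_of_all _ f.norm_coe_le_norm)

lemma abs_integral_le_norm {X : Type*} [TopologicalSpace X] [CompactSpace X]
    [MeasurableSpace X] [OpensMeasurableSpace X] (f : C(X, ℝ)) (μ : Measure X)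
    [IsProbabilityMeasure μ] : |∫ x, f x ∂μ| ≤ ‖f‖ := by
  simpa using abs_integral_le_of_abs_le (μ := μ) f.norm_coe_le_norm

/-- The pairing of continuous functions and probability measures is jointly continuous. -/
lemma continuous_integral_pairing {X : Type*} [TopologicalSpace X] [CompactSpace X]
    [MeasurableSpace X] [OpensMeasurableSpace X] :
    Continuous fun q : C(X, ℝ) × ProbabilityMeasure X => ∫ x, q.1 x ∂(q.2 : Measure X) := by
  refine continuous_iff_continuousAt.2 fun ⟨f, μ⟩ => ?_
  have h1 : Tendsto (fun q : C(X, ℝ) × ProbabilityMeasure X => ∫ x, f x ∂(q.2 : Measure X))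
      (𝓝 (f, μ)) (𝓝 (∫ x, f x ∂(μ : Measure X))) := by
    have := ProbabilityMeasure.tendsto_iff_forall_integral_tendsto.1
      (continuous_snd.tendsto (f, μ) : Tendsto (Prod.snd : C(X, ℝ) × ProbabilityMeasure X → _) _ _)
      (BoundedContinuousFunction.mkOfCompact f)
    simpa using this
  have h2 : Tendsto (fun q : C(X, ℝ) × ProbabilityMeasure X =>
      ∫ x, (q.1 - f) x ∂(q.2 : Measure X)) (𝓝 (f, μ)) (𝓝 0) := by
    refine squeeze_zero_norm (a := fun q => ‖q.1 - f‖) (fun q => ?_) ?_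
    · rw [Real.norm_eq_abs]
      exact abs_integral_le_norm (q.1 - f) (q.2 : Measure X)
    · exact tendsto_iff_norm_sub_tendsto_zero.1 (continuous_fst.tendsto (f, μ))
  have h3 := h1.add h2
  rw [add_zero] at h3
  refine h3.congr fun q => ?_
  have := (integralFunctional (q.2 : Measure X)).map_add f (q.1 - f)
  rw [add_sub_cancel] at this
  exact this.symm

/-- Test functions, constant in time, with bounded collision kernel. -/
def Admissible (φ : C(ℝ≥0∞, ℝ)) : Prop := ∃ C, ∀ z, |kern φ z| ≤ C

/-- Functions on `[0,∞]` that are Lipschitz continuous on `[0,∞)` and constant near `∞`. -/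
def lipschitzSubalgebra : Subalgebra ℝ C(ℝ≥0∞, ℝ) where
  carrier := {φ | ∃ A L c : ℝ, 0 < A ∧ 0 ≤ L ∧ (∀ x y, 0 ≤ x → 0 ≤ y →
    |onReal φ x - onReal φ y| ≤ L * |x - y|) ∧ ∀ x, A ≤ x → onReal φ x = c}
  mul_mem' := by
    rintro φ ψ ⟨A₁, L₁, c₁, hA₁, hL₁, h₁, e₁⟩ ⟨A₂, L₂, c₂, hA₂, hL₂, h₂, e₂⟩
    refine ⟨max A₁ A₂, ‖φ‖ * L₂ + ‖ψ‖ * L₁, c₁ * c₂, lt_max_of_lt_left hA₁, by positivity,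
      fun x y hx hy => ?_, fun x hx => ?_⟩
    · have e : onReal (φ * ψ : C(ℝ≥0∞, ℝ)) x - onReal (φ * ψ : C(ℝ≥0∞, ℝ)) y =
          onReal φ x * (onReal ψ x - onReal ψ y)
          + onReal ψ y * (onReal φ x - onReal φ y) := by
        simp only [onReal, ContinuousMap.mul_apply]; ring
      rw [e]
      refine (abs_add_le _ _).trans ?_
      rw [abs_mul, abs_mul, add_mul, mul_assoc, mul_assoc]
      have b1 : |onReal φ x| ≤ ‖φ‖ := φ.norm_coe_le_norm _
      have b2 : |onReal ψ y| ≤ ‖ψ‖ := ψ.norm_coe_le_norm _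
      have := h₁ x y hx hy
      have := h₂ x y hx hy
      gcongr
    · have k1 := e₁ x ((le_max_left _ _).trans hx)
      have k2 := e₂ x ((le_max_right _ _).trans hx)
      simp only [onReal] at k1 k2 ⊢
      rw [ContinuousMap.mul_apply, k1, k2]
  add_mem' := by
    rintro φ ψ ⟨A₁, L₁, c₁, hA₁, hL₁, h₁, e₁⟩ ⟨A₂, L₂, c₂, hA₂, hL₂, h₂, e₂⟩
    refine ⟨max A₁ A₂, L₁ + L₂, c₁ + c₂, lt_max_of_lt_left hA₁, by positivity,
      fun x y hx hy => ?_, fun x hx => ?_⟩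
    · have e : onReal (φ + ψ : C(ℝ≥0∞, ℝ)) x - onReal (φ + ψ : C(ℝ≥0∞, ℝ)) y =
          (onReal φ x - onReal φ y)
          + (onReal ψ x - onReal ψ y) := by
        simp only [onReal, ContinuousMap.add_apply]; ring
      rw [e, add_mul]
      exact (abs_add_le _ _).trans (add_le_add (h₁ x y hx hy) (h₂ x y hx hy))
    · have k1 := e₁ x ((le_max_left _ _).trans hx)
      have k2 := e₂ x ((le_max_right _ _).trans hx)
      simp only [onReal] at k1 k2 ⊢
      rw [ContinuousMap.add_apply, k1, k2]
  algebraMap_mem' c := ⟨1, 0, c, one_pos, le_rfl, fun x y _ _ => by simp [onReal],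
    fun x _ => by simp [onReal]⟩

/-- Subtracting the value near `∞` leaves the kernel unchanged and makes `r f r` vanish for large
`r`, so `abs_realH1_le_of_lipschitz` applies with limit constant `0`. -/
lemma admissible_of_mem_lipschitzSubalgebra {φ : C(ℝ≥0∞, ℝ)} (h : φ ∈ lipschitzSubalgebra) :
    Admissible φ := by
  obtain ⟨A, L, c, hA, hL, h, e⟩ := h
  have hk : ∀ z, kern φ z = kern (fun p => φ p - c) z := fun z => by
    rw [kern_sub, kern_const, sub_zero]
  have hB : ∀ x, 0 ≤ x → |onReal (fun p => φ p - c) x| ≤ ‖φ‖ + |c| := fun x _ =>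
    (abs_sub _ _).trans (by have : |φ (ENNReal.ofReal x)| ≤ ‖φ‖ := φ.norm_coe_le_norm _; gcongr)
  refine ⟨22 * (A * (‖φ‖ + |c|) + |(0 : ℝ)|) + 28 * A * (‖φ‖ + |c|) + 8 * A ^ 2 * L, fun z => ?_⟩
  rw [hk]
  refine abs_kern_le ?_ (fun x y hy hyx => abs_realH1_le_of_lipschitz (A := A) (B := ‖φ‖ + |c|)
    (L := L) (c := 0) hA hB (fun x y hx hy => ?_) (fun x hx => ?_) hy hyx) z
  · positivity
  · simpa [onReal] using h x y hx hy
  · have := e x hx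
    simp only [onReal] at this ⊢
    rw [this, sub_self, mul_zero]

/-- For `x < r < y` the tent that reaches zero at `r` is positive at `x` and zero at `y`. -/
lemma separatesPoints_lipschitzSubalgebra : lipschitzSubalgebra.SeparatesPoints := by
  have hmem : ∀ b : ℝ≥0, 0 < b → tent b ∈ lipschitzSubalgebra := by
    intro b hb
    have hb' : (0 : ℝ) < b := hb
    refine ⟨1 / b, b, 0, by positivity, hb'.le, fun x y hx hy => ?_, fun x hx => ?_⟩
    · rw [onReal_tent b hx, onReal_tent b hy]
      refine (abs_max_sub_max_le_abs _ _ _).trans ?_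
      rw [show (1 - b * x - (1 - b * y) : ℝ) = b * (y - x) by ring, abs_mul, abs_of_pos hb',
        abs_sub_comm]
    · have hx0 : 0 ≤ x := le_trans (by positivity) hx
      rw [onReal_tent b hx0, max_eq_right]
      rw [div_le_iff₀ hb'] at hx
      linarith
  have key : ∀ x y : ℝ≥0∞, x < y → ∃ f ∈ lipschitzSubalgebra, f x ≠ f y := by
    intro x y hxy
    obtain ⟨r, hxr, hry⟩ := ENNReal.lt_iff_exists_nnreal_btwn.1 hxy
    have hr : 0 < r := by
      have := zero_le.trans_lt hxr
      exact_mod_cast this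
    have hb : 0 < r⁻¹ := inv_pos.2 hr
    have hinv : ((r⁻¹ : ℝ≥0) : ℝ≥0∞) * r = 1 := by exact_mod_cast inv_mul_cancel₀ hr.ne'
    have hb0 : ((r⁻¹ : ℝ≥0) : ℝ≥0∞) ≠ 0 := by exact_mod_cast hb.ne'
    refine ⟨tent r⁻¹, hmem _ hb, ?_⟩
    have h1 : tent r⁻¹ y = 0 := by
      rw [tent_apply, tsub_eq_zero_of_le, ENNReal.toReal_zero]
      rw [← hinv]
      gcongr
    have h2 : 0 < tent r⁻¹ x := by
      rw [tent_apply]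
      refine ENNReal.toReal_pos (tsub_pos_of_lt ?_).ne' (by simp)
      rw [← hinv]
      exact ENNReal.mul_lt_mul_right hb0 (by simp) hxr
    rw [h1]
    exact h2.ne'
  intro x y hxy
  rcases lt_or_gt_of_ne hxy with h | h
  · obtain ⟨f, hf, hne⟩ := key x y h
    exact ⟨f, ⟨f, hf, rfl⟩, hne⟩
  · obtain ⟨f, hf, hne⟩ := key y x h
    exact ⟨f, ⟨f, hf, rfl⟩, hne.symm⟩

/-- Admissible functions separate probability measures. -/
lemma eq_of_forall_admissible {μ ν : ProbabilityMeasure ℝ≥0∞}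
    (h : ∀ φ : C(ℝ≥0∞, ℝ), Admissible φ →
      ∫ p, φ p ∂(μ : Measure ℝ≥0∞) = ∫ p, φ p ∂(ν : Measure ℝ≥0∞)) : μ = ν := by
  have hcl : IsClosed {φ : C(ℝ≥0∞, ℝ) | integralFunctional (μ : Measure ℝ≥0∞) φ
      = integralFunctional (ν : Measure ℝ≥0∞) φ} :=
    isClosed_eq (ContinuousLinearMap.continuous _) (ContinuousLinearMap.continuous _)
  have hall : ∀ φ : C(ℝ≥0∞, ℝ), integralFunctional (μ : Measure ℝ≥0∞) φ
      = integralFunctional (ν : Measure ℝ≥0∞) φ := by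
    intro φ
    have htop := ContinuousMap.subalgebra_topologicalClosure_eq_top_of_separatesPoints
      lipschitzSubalgebra separatesPoints_lipschitzSubalgebra
    have hmem : φ ∈ lipschitzSubalgebra.topologicalClosure := by rw [htop]; trivial
    exact closure_minimal (fun ψ hψ => h ψ (admissible_of_mem_lipschitzSubalgebra hψ)) hcl hmem
  have key : (μ : Measure ℝ≥0∞) = ν :=
    ext_of_forall_integral_eq_of_IsFiniteMeasure fun f => hall f.toContinuousMap
  exact Subtype.ext key

/-- By compactness it suffices that `μ` is the only cluster point, which holds since admissible
functions separate probability measures. -/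
lemma tendsto_of_forall_admissible {α : Type*} {l : Filter α} {f : α → ProbabilityMeasure ℝ≥0∞}
    {μ : ProbabilityMeasure ℝ≥0∞} (h : ∀ φ : C(ℝ≥0∞, ℝ), Admissible φ →
      Tendsto (fun i => ∫ p, φ p ∂(f i : Measure ℝ≥0∞)) l (𝓝 (∫ p, φ p ∂(μ : Measure ℝ≥0∞)))) :
    Tendsto f l (𝓝 μ) := by
  refine le_nhds_of_unique_clusterPt fun ν hν => ?_
  obtain ⟨U, hU, hUν⟩ := mapClusterPt_iff_ultrafilter.1 hν
  refine eq_of_forall_admissible fun φ hφ => ?_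
  have h1 : Tendsto (fun i => ∫ p, φ p ∂(f i : Measure ℝ≥0∞)) U
      (𝓝 (∫ p, φ p ∂(ν : Measure ℝ≥0∞))) :=
    (continuous_integral_pairing.tendsto (φ, ν)).comp (tendsto_const_nhds.prodMk_nhds hUν)
  exact tendsto_nhds_unique h1 ((h φ hφ).mono_left hU)

/-- A sequence of curves of probability measures that are asymptotically Lipschitz when tested with
admissible functions has a subsequence that converges at all times. -/
lemma exists_subseq_tendsto {u : ℕ → ℝ≥0 → ProbabilityMeasure ℝ≥0∞} {δ : ℕ → ℝ}
    (hδ : Tendsto δ atTop (𝓝 0)) (hu : ∀ φ : C(ℝ≥0∞, ℝ), Admissible φ → ∃ C : ℝ, 0 ≤ C ∧ ∀ n s t,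
      |(∫ p, φ p ∂(u n s : Measure ℝ≥0∞)) - ∫ p, φ p ∂(u n t : Measure ℝ≥0∞)|
        ≤ C * (dist s t + δ n)) :
    ∃ k : ℕ → ℕ, StrictMono k ∧ ∃ m : ℝ≥0 → ProbabilityMeasure ℝ≥0∞, Continuous m ∧
      ∀ t, Tendsto (fun n => u (k n) t) atTop (𝓝 (m t)) := by
  set d : ℕ → ℝ≥0 := TopologicalSpace.denseSeq ℝ≥0
  -- The product over a dense sequence of times is compact, so one subsequence serves all these
  -- times at once.
  obtain ⟨x, k, hk, hx⟩ := CompactSpace.tendsto_subseq (fun n (j : ℕ) => u n (d j))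
  have hxj : ∀ j, Tendsto (fun n => u (k n) (d j)) atTop (𝓝 (x j)) := fun j =>
    (tendsto_pi_nhds.1 hx) j
  have hkδ := hδ.comp hk.tendsto_atTop
  have pair : ∀ (φ : C(ℝ≥0∞, ℝ)) {l : Filter ℕ} {f : ℕ → ProbabilityMeasure ℝ≥0∞} {μ},
      Tendsto f l (𝓝 μ) → Tendsto (fun i => ∫ p, φ p ∂(f i : Measure ℝ≥0∞)) l
        (𝓝 (∫ p, φ p ∂(μ : Measure ℝ≥0∞))) := fun φ _ _ μ h =>
    (continuous_integral_pairing.tendsto (φ, μ)).comp (tendsto_const_nhds.prodMk_nhds h)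
  have hex : ∀ t, ∃ μ, Tendsto (fun n => u (k n) t) atTop (𝓝 μ) := by
    intro t
    obtain ⟨μ, hμ⟩ := exists_clusterPt_of_compactSpace (map (fun n => u (k n) t) atTop)
    obtain ⟨U, hU, hUμ⟩ := mapClusterPt_iff_ultrafilter.1 hμ
    refine ⟨μ, tendsto_of_forall_admissible fun φ hφ => ?_⟩
    obtain ⟨C, hC0, hC⟩ := hu φ hφ
    -- The Lipschitz estimate survives in the limit without `δ`. It ties any cluster point at `t` to
    -- the limits at dense times, which forces convergence of the whole subsequence at `t`.
    have h1 : ∀ j, |(∫ p, φ p ∂(μ : Measure ℝ≥0∞)) - ∫ p, φ p ∂(x j : Measure ℝ≥0∞)|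
        ≤ C * (dist t (d j) + 0) := by
      intro j
      refine le_of_tendsto_of_tendsto' (((pair φ hUμ).sub ((pair φ (hxj j)).mono_left hU)).abs)
        ((((tendsto_const_nhds (x := dist t (d j))).add (hkδ.mono_left hU)).const_mul C)) ?_
      exact fun n => hC (k n) t (d j)
    rw [Metric.tendsto_atTop]
    intro ε hε
    obtain ⟨j, hj⟩ : ∃ j, C * dist t (d j) < ε / 4 := by
      obtain ⟨j, hj⟩ := (TopologicalSpace.denseRange_denseSeq ℝ≥0).exists_dist_lt t
        (show 0 < ε / (4 * (C + 1)) by positivity)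
      refine ⟨j, ?_⟩
      have : dist t (d j) * (4 * (C + 1)) < ε := by rwa [lt_div_iff₀ (by positivity)] at hj
      nlinarith [dist_nonneg (x := t) (y := d j)]
    have e1 : ∀ᶠ n in atTop, C * δ (k n) < ε / 4 := by
      have := hkδ.const_mul C
      rw [mul_zero] at this
      exact this.eventually (gt_mem_nhds (by positivity))
    have e2 : ∀ᶠ n in atTop, |(∫ p, φ p ∂(u (k n) (d j) : Measure ℝ≥0∞))
        - ∫ p, φ p ∂(x j : Measure ℝ≥0∞)| < ε / 4 :=
      (Metric.tendsto_nhds.1 (pair φ (hxj j))) (ε / 4) (by positivity)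
    obtain ⟨N, hN⟩ := eventually_atTop.1 (e1.and e2)
    refine ⟨N, fun n hn => ?_⟩
    obtain ⟨q1, q2⟩ := hN n hn
    have q3 := hC (k n) t (d j)
    have q4 := h1 j
    rw [Real.dist_eq]
    rw [abs_le] at q3 q4
    rw [abs_lt] at q2 ⊢
    constructor <;> nlinarith
  choose m hm using hex
  refine ⟨k, hk, m, continuous_iff_continuousAt.2 fun t => tendsto_of_forall_admissible
    fun φ hφ => ?_, hm⟩
  obtain ⟨C, hC0, hC⟩ := hu φ hφ
  have h1 : ∀ s, |(∫ p, φ p ∂(m s : Measure ℝ≥0∞)) - ∫ p, φ p ∂(m t : Measure ℝ≥0∞)|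
      ≤ C * dist s t := by
    intro s
    have := (((tendsto_const_nhds (x := dist s t)).add hkδ).const_mul C)
    rw [add_zero] at this
    exact le_of_tendsto_of_tendsto' (((pair φ (hm s)).sub (pair φ (hm t))).abs) this
      fun n => hC (k n) s t
  rw [tendsto_iff_norm_sub_tendsto_zero]
  refine squeeze_zero (fun _ => norm_nonneg _) h1 ?_
  have : Continuous fun s : ℝ≥0 => C * dist s t := by fun_prop
  simpa using this.tendsto t

/-! ### The Euler scheme and its discrete dissipation estimates. -/

/-- The wave numbers `p` with `1 / R ≤ p ≤ R`. -/
def window (R : ℝ) : Set ℝ≥0∞ := {p | 1 / R ≤ p.toReal ∧ p.toReal ≤ R}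

lemma measurableSet_window (R : ℝ) : MeasurableSet (window R) :=
  ENNReal.measurable_toReal measurableSet_Icc

lemma integral_map_withDensity_ofReal {X Y : Type*} [MeasurableSpace X] [MeasurableSpace Y]
    {M : Measure X} {w : X → ℝ} (hw : Measurable w) (hw0 : ∀ x, 0 ≤ w x) {f : X → Y}
    (hf : Measurable f) {φ : Y → ℝ} (hφ : Measurable φ) :
    ∫ y, φ y ∂((M.withDensity fun x => ENNReal.ofReal (w x)).map f) = ∫ x, w x * φ (f x) ∂M := by
  rw [integral_map hf.aemeasurable hφ.aestronglyMeasurable,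
    integral_withDensity_eq_integral_toReal_smul hw.ennreal_ofReal (by simp)]
  simp [ENNReal.toReal_ofReal (hw0 _)]

lemma isFiniteMeasure_map_withDensity_ofReal {X Y : Type*} [MeasurableSpace X] [MeasurableSpace Y]
    {M : Measure X} [IsFiniteMeasure M] {w : X → ℝ} (hw : ∀ x, w x ≤ 1) (f : X → Y) :
    IsFiniteMeasure ((M.withDensity fun x => ENNReal.ofReal (w x)).map f) := by
  have : IsFiniteMeasure (M.withDensity fun x => ENNReal.ofReal (w x)) := by
    refine isFiniteMeasure_withDensity (ne_top_of_le_ne_top (b := M Set.univ) (by simp) ?_)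
    calc ∫⁻ x, ENNReal.ofReal (w x) ∂M ≤ ∫⁻ _, 1 ∂M :=
          lintegral_mono fun x => by simpa using hw x
      _ = M Set.univ := lintegral_one
  infer_instance

/-- One explicit Euler step of the equation in which only the pairs in a window interact. The new
measure is the law of a mixture of `x + y`, `x - y`, `x` and `y`. -/
lemma exists_euler_step {R ε : ℝ} (hR : 1 ≤ R) (hε : 0 ≤ ε) (hεR : 8 * ε * R ^ 3 ≤ 1)
    (μ : ProbabilityMeasure ℝ≥0∞) : ∃ μ' : ProbabilityMeasure ℝ≥0∞, ∀ φ : ℝ≥0∞ → ℝ, Measurable φ →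
      (∃ K, ∀ p, |φ p| ≤ K) → ∫ p, φ p ∂(μ' : Measure ℝ≥0∞) = (∫ p, φ p ∂(μ : Measure ℝ≥0∞)) +
        ε * ∫ z in window R ×ˢ window R, kern φ z ∂((μ : Measure ℝ≥0∞).prod (μ : Measure ℝ≥0∞)) := by
  have hR0 : 0 < R := one_pos.trans_le hR
  set M := (μ : Measure ℝ≥0∞).prod (μ : Measure ℝ≥0∞) with hM
  set B := window R ×ˢ window R with hBdef
  have hB : MeasurableSet B := (measurableSet_window R).prod (measurableSet_window R)
  set e : ℝ≥0∞ × ℝ≥0∞ → ℝ := B.indicator fun _ => ε with he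
  have hem : Measurable e := measurable_const.indicator hB
  set X : ℝ≥0∞ × ℝ≥0∞ → ℝ≥0∞ := fun z => max z.1 z.2 with hX
  set Y : ℝ≥0∞ × ℝ≥0∞ → ℝ≥0∞ := fun z => min z.1 z.2 with hY
  set S : ℝ≥0∞ × ℝ≥0∞ → ℝ≥0∞ := fun z => max z.1 z.2 + min z.1 z.2 with hS
  set D : ℝ≥0∞ × ℝ≥0∞ → ℝ≥0∞ := fun z => max z.1 z.2 - min z.1 z.2 with hD
  have mX : Measurable X := measurable_fst.max measurable_snd
  have mY : Measurable Y := measurable_fst.min measurable_snd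
  have mS : Measurable S := mX.add mY
  have mD : Measurable D := mX.sub mY
  have rX := mX.ennreal_toReal
  have rY := mY.ennreal_toReal
  have rS := mS.ennreal_toReal
  have rD := mD.ennreal_toReal
  set q : ℝ≥0∞ × ℝ≥0∞ → ℝ := fun z => z.1.toReal * z.2.toReal with hq
  have mq : Measurable q := measurable_fst.ennreal_toReal.mul measurable_snd.ennreal_toReal
  -- The gain coefficients of the kernel are the weights of `x+y` and `x-y`. The losses are taken
  -- from `1/2` each for `x` and `y`, since the mean of `φ x` and `φ y` over `μ ⊗ μ` is `∫ φ dμ`.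
  set w₁ : ℝ≥0∞ × ℝ≥0∞ → ℝ := fun z => e z * ((S z).toReal ^ 3 / q z) with hw₁
  set w₂ : ℝ≥0∞ × ℝ≥0∞ → ℝ := fun z => e z * ((D z).toReal ^ 3 / q z) with hw₂
  set w₃ : ℝ≥0∞ × ℝ≥0∞ → ℝ := fun z => 1 / 2 - e z *
    (2 * ((X z).toReal ^ 2 + (Y z).toReal ^ 2) * (X z).toReal / q z) with hw₃
  set w₄ : ℝ≥0∞ × ℝ≥0∞ → ℝ := fun z => 1 / 2 - e z *
    (4 * (X z).toReal * (Y z).toReal ^ 2 / q z) with hw₄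
  have m₁ : Measurable w₁ := hem.mul ((rS.pow_const 3).div mq)
  have m₂ : Measurable w₂ := hem.mul ((rD.pow_const 3).div mq)
  have m₃ : Measurable w₃ := measurable_const.sub (hem.mul
    (((((rX.pow_const 2).add (rY.pow_const 2)).const_mul 2).mul rX).div mq))
  have m₄ : Measurable w₄ := measurable_const.sub (hem.mul
    (((rX.const_mul 4).mul (rY.pow_const 2)).div mq))
  have he0 : ∀ z, 0 ≤ e z := fun z => Set.indicator_nonneg (fun _ _ => hε) z
  have hq0 : ∀ z, 0 ≤ q z := fun z => mul_nonneg ENNReal.toReal_nonneg ENNReal.toReal_nonneg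
  have n₁ : ∀ z, 0 ≤ w₁ z := fun z => mul_nonneg (he0 z)
    (div_nonneg (pow_nonneg ENNReal.toReal_nonneg 3) (hq0 z))
  have n₂ : ∀ z, 0 ≤ w₂ z := fun z => mul_nonneg (he0 z)
    (div_nonneg (pow_nonneg ENNReal.toReal_nonneg 3) (hq0 z))
  have win : ∀ z ∈ B, 0 < (Y z).toReal ∧ 1 / R ≤ (Y z).toReal ∧ (Y z).toReal ≤ (X z).toReal ∧
      (X z).toReal ≤ R ∧ q z = (X z).toReal * (Y z).toReal := by
    rintro z ⟨⟨a1, a2⟩, b1, b2⟩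
    have hR1 : 0 < 1 / R := by positivity
    have t1 : z.1 ≠ ∞ := by rintro h; rw [h] at a1; simp at a1; linarith
    have t2 : z.2 ≠ ∞ := by rintro h; rw [h] at b1; simp at b1; linarith
    simp only [hX, hY, hq, ENNReal.toReal_max t1 t2, ENNReal.toReal_min t1 t2, max_mul_min]
    exact ⟨lt_min (by linarith) (by linarith), le_min a1 b1, min_le_max, max_le a2 b2, trivial⟩
  have hR3 : 1 ≤ R ^ 3 := one_le_pow₀ hR
  have n₃ : ∀ z, 0 ≤ w₃ z := by
    intro z
    by_cases hz : z ∈ B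
    · obtain ⟨h1, h2, h3, h4, h5⟩ := win z hz
      simp only [hw₃, he, Set.indicator_of_mem hz, h5]
      set x := (X z).toReal
      set y := (Y z).toReal
      have hx : 0 < x := h1.trans_le h3
      -- In the window the loss coefficients are at most `4 R³`, so `8 ε R³ ≤ 1` keeps the weights
      -- `w₃`, `w₄` nonnegative.
      have k : 2 * (x ^ 2 + y ^ 2) * x / (x * y) ≤ 4 * R ^ 3 := by
        rw [div_le_iff₀ (mul_pos hx h1)]
        have k1 : x ^ 2 ≤ R ^ 2 := by gcongr
        have k2 : y ^ 2 ≤ x ^ 2 := by gcongr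
        have k3 : 1 ≤ R * y := by rwa [div_le_iff₀' hR0] at h2
        calc 2 * (x ^ 2 + y ^ 2) * x ≤ 2 * (R ^ 2 + R ^ 2) * x := by gcongr; exact h3.trans h4
          _ = 4 * R ^ 2 * x * 1 := by ring
          _ ≤ 4 * R ^ 2 * x * (R * y) := by gcongr
          _ = _ := by ring
      have := mul_le_mul_of_nonneg_left k hε
      linarith
    · simp [hw₃, he, hz]
  have n₄ : ∀ z, 0 ≤ w₄ z := by
    intro z
    by_cases hz : z ∈ B
    · obtain ⟨h1, h2, h3, h4, h5⟩ := win z hz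
      simp only [hw₄, he, Set.indicator_of_mem hz, h5]
      set x := (X z).toReal
      set y := (Y z).toReal
      have hx : 0 < x := h1.trans_le h3
      have k : 4 * x * y ^ 2 / (x * y) ≤ 4 * R ^ 3 := by
        rw [div_le_iff₀ (mul_pos hx h1)]
        have k1 : y ≤ R ^ 3 := (h3.trans h4).trans (le_self_pow₀ hR (by norm_num))
        calc 4 * x * y ^ 2 = 4 * y * (x * y) := by ring
          _ ≤ 4 * R ^ 3 * (x * y) := by gcongr
      have := mul_le_mul_of_nonneg_left k hε
      linarith
    · simp [hw₄, he, hz]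
  have hsum : ∀ (φ : ℝ≥0∞ → ℝ) z, w₁ z * φ (S z) + w₂ z * φ (D z) + w₃ z * φ (X z) + w₄ z * φ (Y z)
      = 1 / 2 * (φ z.1 + φ z.2) + ε * B.indicator (kern φ) z := by
    intro φ z
    have e1 : φ (X z) + φ (Y z) = φ z.1 + φ z.2 := by
      rcases le_total z.1 z.2 with h | h
      · simp [hX, hY, h, add_comm]
      · simp [hX, hY, h]
    have e2 : ε * B.indicator (kern φ) z = e z * kern φ z := by
      by_cases hz : z ∈ B <;> simp [he, hz]
    rw [e2, ← e1]
    simp only [hw₁, hw₂, hw₃, hw₄, kern, H1, hS, hD, hX, hY, hq]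
    ring
  have hsum1 : ∀ z, w₁ z + w₂ z + w₃ z + w₄ z = 1 := by
    intro z
    have := hsum (fun _ => 1) z
    have h0 : B.indicator (kern fun _ => 1) z = 0 := by
      simp only [Set.indicator_apply_eq_zero]; exact fun _ => kern_const 1 z
    rw [h0] at this
    linarith
  set ν₁ := (M.withDensity fun z => ENNReal.ofReal (w₁ z)).map S with hν₁
  set ν₂ := (M.withDensity fun z => ENNReal.ofReal (w₂ z)).map D with hν₂
  set ν₃ := (M.withDensity fun z => ENNReal.ofReal (w₃ z)).map X with hν₃
  set ν₄ := (M.withDensity fun z => ENNReal.ofReal (w₄ z)).map Y with hν₄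
  have l₁ : ∀ z, w₁ z ≤ 1 := fun z => by linarith [hsum1 z, n₂ z, n₃ z, n₄ z]
  have l₂ : ∀ z, w₂ z ≤ 1 := fun z => by linarith [hsum1 z, n₁ z, n₃ z, n₄ z]
  have l₃ : ∀ z, w₃ z ≤ 1 := fun z => by linarith [hsum1 z, n₁ z, n₂ z, n₄ z]
  have l₄ : ∀ z, w₄ z ≤ 1 := fun z => by linarith [hsum1 z, n₁ z, n₂ z, n₃ z]
  have f₁ : IsFiniteMeasure ν₁ := isFiniteMeasure_map_withDensity_ofReal l₁ S
  have f₂ : IsFiniteMeasure ν₂ := isFiniteMeasure_map_withDensity_ofReal l₂ D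
  have f₃ : IsFiniteMeasure ν₃ := isFiniteMeasure_map_withDensity_ofReal l₃ X
  have f₄ : IsFiniteMeasure ν₄ := isFiniteMeasure_map_withDensity_ofReal l₄ Y
  have key : ∀ φ : ℝ≥0∞ → ℝ, Measurable φ → (∃ K, ∀ p, |φ p| ≤ K) →
      ∫ p, φ p ∂(ν₁ + ν₂ + ν₃ + ν₄) = (∫ p, φ p ∂(μ : Measure ℝ≥0∞)) +
        ε * ∫ z in B, kern φ z ∂M := by
    rintro φ hφ ⟨K, hK⟩
    have hint : ∀ ν : Measure ℝ≥0∞, IsFiniteMeasure ν → Integrable φ ν := fun ν _ =>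
      Integrable.of_bound hφ.aestronglyMeasurable K (ae_of_all _ hK)
    have hwint : ∀ (w : ℝ≥0∞ × ℝ≥0∞ → ℝ) (f : ℝ≥0∞ × ℝ≥0∞ → ℝ≥0∞), Measurable w → (∀ z, 0 ≤ w z) →
        (∀ z, w z ≤ 1) → Measurable f → Integrable (fun z => w z * φ (f z)) M := by
      intro w f hw hw0 hw1 hf
      refine Integrable.of_bound (hw.mul (hφ.comp hf)).aestronglyMeasurable K
        (ae_of_all _ fun z => ?_)
      rw [Real.norm_eq_abs, abs_mul, abs_of_nonneg (hw0 z)]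
      calc w z * |φ (f z)| ≤ 1 * K := mul_le_mul (hw1 z) (hK _) (abs_nonneg _) zero_le_one
        _ = K := one_mul K
    have i₁ := hwint w₁ S m₁ n₁ l₁ mS
    have i₂ := hwint w₂ D m₂ n₂ l₂ mD
    have i₃ := hwint w₃ X m₃ n₃ l₃ mX
    have i₄ := hwint w₄ Y m₄ n₄ l₄ mY
    have i₁₂ : Integrable (fun z => w₁ z * φ (S z) + w₂ z * φ (D z)) M := i₁.add i₂
    have i₁₂₃ : Integrable (fun z => w₁ z * φ (S z) + w₂ z * φ (D z) + w₃ z * φ (X z)) M :=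
      i₁₂.add i₃
    have hφμ := hint (μ : Measure ℝ≥0∞) inferInstance
    have j₁ : Integrable (fun z : ℝ≥0∞ × ℝ≥0∞ => φ z.1) M := hφμ.comp_fst _
    have j₂ : Integrable (fun z : ℝ≥0∞ × ℝ≥0∞ => φ z.2) M := hφμ.comp_snd _
    have j₁₂ : Integrable (fun z : ℝ≥0∞ × ℝ≥0∞ => 1 / 2 * (φ z.1 + φ z.2)) M :=
      (j₁.add j₂).const_mul (1 / 2)
    have hall : Integrable (fun z => w₁ z * φ (S z) + w₂ z * φ (D z) + w₃ z * φ (X z)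
        + w₄ z * φ (Y z)) M := ((i₁.add i₂).add i₃).add i₄
    have hk : Integrable (fun z => ε * B.indicator (kern φ) z) M := by
      have := hall.sub j₁₂
      refine this.congr (ae_of_all _ fun z => ?_)
      simp only [Pi.sub_apply, hsum φ z]
      ring
    rw [integral_add_measure (hint _ inferInstance) (hint _ f₄),
      integral_add_measure (hint _ inferInstance) (hint _ f₃),
      integral_add_measure (hint _ f₁) (hint _ f₂),
      integral_map_withDensity_ofReal m₁ n₁ mS hφ, integral_map_withDensity_ofReal m₂ n₂ mD hφ,
      integral_map_withDensity_ofReal m₃ n₃ mX hφ, integral_map_withDensity_ofReal m₄ n₄ mY hφ,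
      ← integral_add i₁ i₂, ← integral_add i₁₂ i₃, ← integral_add i₁₂₃ i₄]
    simp only [hsum φ]
    rw [integral_add j₁₂ hk, integral_const_mul, integral_const_mul,
      integral_add j₁ j₂, integral_fun_fst φ, integral_fun_snd φ, integral_indicator hB]
    simp only [probReal_univ, one_smul]
    ring
  have hprob : IsProbabilityMeasure (ν₁ + ν₂ + ν₃ + ν₄) := by
    have := key (fun _ => 1) measurable_const ⟨1, by simp⟩
    have h0 : ∀ z, kern (fun _ => (1 : ℝ)) z = 0 := kern_const 1
    simp only [h0, integral_const, smul_eq_mul, mul_one, mul_zero, add_zero,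
      probReal_univ] at this
    exact ⟨by rw [← ofReal_measureReal, this, ENNReal.ofReal_one]⟩
  exact ⟨⟨ν₁ + ν₂ + ν₃ + ν₄, hprob⟩, key⟩

/-- The Euler scheme for the equation in which only the pairs in a window interact. -/
structure IsEulerScheme (R ε : ℝ) (u : ℕ → ProbabilityMeasure ℝ≥0∞) : Prop where
  step : ∀ i, ∀ φ : ℝ≥0∞ → ℝ, Measurable φ → (∃ K, ∀ p, |φ p| ≤ K) →
    ∫ p, φ p ∂(u (i + 1) : Measure ℝ≥0∞) = (∫ p, φ p ∂(u i : Measure ℝ≥0∞)) +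
      ε * ∫ z in window R ×ˢ window R, kern φ z ∂((u i : Measure ℝ≥0∞).prod (u i : Measure ℝ≥0∞))

lemma exists_isEulerScheme {R ε : ℝ} (hR : 1 ≤ R) (hε : 0 ≤ ε) (hεR : 8 * ε * R ^ 3 ≤ 1)
    (μ : ProbabilityMeasure ℝ≥0∞) : ∃ u, u 0 = μ ∧ IsEulerScheme R ε u := by
  choose F hF using exists_euler_step hR hε hεR
  exact ⟨fun i => Nat.rec μ (fun _ ν => F ν) i, rfl, ⟨fun i => hF _⟩⟩

namespace IsEulerScheme

variable {R ε : ℝ} {u : ℕ → ProbabilityMeasure ℝ≥0∞}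

lemma integral_eq (h : IsEulerScheme R ε u) (i : ℕ) (φ : C(ℝ≥0∞, ℝ)) :
    ∫ p, φ p ∂(u (i + 1) : Measure ℝ≥0∞) = (∫ p, φ p ∂(u i : Measure ℝ≥0∞)) +
      ε * ∫ z in window R ×ˢ window R, kern φ z
        ∂((u i : Measure ℝ≥0∞).prod (u i : Measure ℝ≥0∞)) :=
  h.step i φ φ.continuous.measurable ⟨‖φ‖, φ.norm_coe_le_norm⟩

lemma abs_integral_kern_le {φ : ℝ≥0∞ → ℝ} {C : ℝ} (hC : ∀ z, |kern φ z| ≤ C)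
    (μ : ProbabilityMeasure ℝ≥0∞) (s : Set (ℝ≥0∞ × ℝ≥0∞)) :
    |∫ z in s, kern φ z ∂((μ : Measure ℝ≥0∞).prod (μ : Measure ℝ≥0∞))| ≤ C := by
  have hC0 : 0 ≤ C := (abs_nonneg _).trans (hC 0)
  refine (abs_integral_le_of_abs_le hC).trans ?_
  have : (((μ : Measure ℝ≥0∞).prod (μ : Measure ℝ≥0∞)).restrict s).real Set.univ ≤ 1 := by
    rw [measureReal_restrict_apply_univ]
    exact measureReal_le_one
  nlinarith

lemma abs_integral_sub_le (h : IsEulerScheme R ε u) (hε : 0 ≤ ε) (φ : C(ℝ≥0∞, ℝ)) {C : ℝ}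
    (hC : ∀ z, |kern φ z| ≤ C) (i k : ℕ) :
    |(∫ p, φ p ∂(u (i + k) : Measure ℝ≥0∞)) - ∫ p, φ p ∂(u i : Measure ℝ≥0∞)| ≤ ε * C * k := by
  induction k with
  | zero => simp
  | succ k ih =>
    have e := h.integral_eq (i + k) φ
    have b := mul_le_mul_of_nonneg_left
      (abs_integral_kern_le hC (u (i + k)) (window R ×ˢ window R)) hε
    rw [← abs_of_nonneg hε, ← abs_mul, abs_of_nonneg hε] at b
    rw [← add_assoc, e]
    push_cast
    rw [abs_le] at *
    constructor <;> linarith [b.1, b.2, ih.1, ih.2]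

/-- Discrete monotonicity of `cap a`. The point `0` is removed because kernels ignore the value
there; the bound then tends to zero with `a` even if the datum has an atom at `0`. -/
lemma integral_indicator_cap_le (h : IsEulerScheme R ε u) (hε : 0 ≤ ε) (a : ℝ≥0) (i : ℕ) :
    ∫ p in {0}ᶜ, cap a p ∂(u i : Measure ℝ≥0∞) ≤ ∫ p in {0}ᶜ, cap a p ∂(u 0 : Measure ℝ≥0∞) := by
  have hm : MeasurableSet ({0}ᶜ : Set ℝ≥0∞) := (measurableSet_singleton 0).compl
  set φ : ℝ≥0∞ → ℝ := ({0}ᶜ : Set ℝ≥0∞).indicator (cap a) with hφ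
  have hφm : Measurable φ := (cap a).continuous.measurable.indicator hm
  have hφb : ∀ p, |φ p| ≤ 1 := fun p => by
    by_cases hp : p = 0
    · simp [hφ, hp]
    · rw [hφ, Set.indicator_of_mem (by simpa using hp), abs_of_nonneg (cap_nonneg a p)]
      exact cap_le_one a p
  have hk : ∀ z, kern φ z ≤ 0 := by
    intro z
    have : kern φ z = kern (cap a) z := by
      rcases kern_cases φ z with h0 | ⟨x, y, hy, hyx, hz, hk⟩
      · rw [h0.1, kern_eq_zero _ h0.2]
      · have hx : 0 < x := hy.trans_le hyx
        have hpos : ∀ r, 0 < r → onReal φ r = onReal (cap a) r := fun r hr => by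
          rw [onReal, hφ, Set.indicator_of_mem (by simpa using hr), onReal]
        have e : realH1 (onReal φ) x y = realH1 (onReal (cap a)) x y := by
          simp only [realH1, hpos _ hx, hpos _ hy, hpos _ (add_pos hx hy)]
          rcases hyx.eq_or_lt with rfl | hlt
          · simp
          · rw [hpos _ (sub_pos.2 hlt)]
        rw [hk, e, kern_eq]
        rcases hz with rfl | rfl
        · simp [ENNReal.toReal_ofReal hx.le, ENNReal.toReal_ofReal hy.le, hyx]
        · simp [ENNReal.toReal_ofReal hx.le, ENNReal.toReal_ofReal hy.le, hyx, mul_comm]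
    rw [this]
    exact kern_cap_le a z
  have main : ∫ p, φ p ∂(u i : Measure ℝ≥0∞) ≤ ∫ p, φ p ∂(u 0 : Measure ℝ≥0∞) := by
    induction i with
    | zero => exact le_rfl
    | succ i ih =>
      rw [h.step i φ hφm ⟨1, hφb⟩]
      have : ∫ z in window R ×ˢ window R, kern φ z
        ∂((u i : Measure ℝ≥0∞).prod (u i : Measure ℝ≥0∞)) ≤ 0 := integral_nonpos fun z => hk z
      nlinarith
  rwa [hφ, integral_indicator hm, integral_indicator hm] at main

/-- Each step lowers `∫ cap a`, which lies in `[0,1]`, by at least the corresponding summand, and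
the differences telescope. The condition `1 ≤ a` places `[a, R]` inside the window. -/
lemma sum_sq_le (h : IsEulerScheme R ε u) (hR : 1 ≤ R) (hε : 0 ≤ ε) {a : ℝ≥0} (ha : 1 ≤ a)
    (n : ℕ) : ∑ i ∈ Finset.range n, ε * (4 * a) *
      (u i : Measure ℝ≥0∞).real {p | (a : ℝ≥0∞) ≤ p ∧ p.toReal ≤ R ∧ p ≠ ∞} ^ 2 ≤ 1 := by
  set S : Set ℝ≥0∞ := {p | (a : ℝ≥0∞) ≤ p ∧ p.toReal ≤ R ∧ p ≠ ∞} with hSdef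
  have hS : MeasurableSet S := by
    have h1 : MeasurableSet {p : ℝ≥0∞ | p.toReal ≤ R} := ENNReal.measurable_toReal measurableSet_Iic
    exact measurableSet_Ici.inter (h1.inter (measurableSet_singleton ∞).compl)
  obtain ⟨C, hC⟩ := exists_abs_kern_cap_le (one_pos.trans_le ha)
  have hsub : S ⊆ window R := by
    rintro p ⟨h1, h2, h3⟩
    refine ⟨?_, h2⟩
    have k : ((1 : ℝ≥0) : ℝ≥0∞) ≤ p := le_trans (by exact_mod_cast ha) h1
    have : 1 ≤ p.toReal := by
      have := ENNReal.toReal_mono h3 k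
      simpa using this
    exact (div_le_one_of_le₀ hR (by linarith)).trans this
  have hstep : ∀ i, ε * (4 * a) * (u i : Measure ℝ≥0∞).real S ^ 2 ≤
      (∫ p, cap a p ∂(u i : Measure ℝ≥0∞)) - ∫ p, cap a p ∂(u (i + 1) : Measure ℝ≥0∞) := by
    intro i
    set M := (u i : Measure ℝ≥0∞).prod (u i : Measure ℝ≥0∞)
    have hi : Integrable (kern (cap a)) M := integrable_kern (cap a).continuous.measurable hC _
    have k : ∫ z in window R ×ˢ window R, kern (cap a) z ∂M
        ≤ -(4 * a) * (u i : Measure ℝ≥0∞).real S ^ 2 := by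
      calc ∫ z in window R ×ˢ window R, kern (cap a) z ∂M
          ≤ ∫ z in S ×ˢ S, kern (cap a) z ∂M := by
            have := setIntegral_mono_set (f := fun z => -kern (cap a) z) (s := S ×ˢ S)
              (t := window R ×ˢ window R) (μ := M) hi.neg.integrableOn
              (ae_of_all _ fun z => neg_nonneg.2 (kern_cap_le a z))
              (Set.prod_mono hsub hsub).eventuallyLE
            simp only [integral_neg] at this
            linarith
        _ ≤ ∫ z in S ×ˢ S, -(4 * (a : ℝ)) ∂M := by
            refine setIntegral_mono_on hi.integrableOn integrableOn_const (hS.prod hS) fun z hz => ?_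
            exact kern_cap_le_of_le a hz.1.1 hz.2.1 hz.1.2.2 hz.2.2.2
        _ = _ := by
            rw [setIntegral_const, measureReal_prod_prod, smul_eq_mul]
            ring
    rw [h.integral_eq i (cap a)]
    nlinarith [mul_le_mul_of_nonneg_left k hε]
  refine (Finset.sum_le_sum fun i _ => hstep i).trans ?_
  rw [Finset.sum_range_sub']
  have h1 : ∫ p, cap a p ∂(u 0 : Measure ℝ≥0∞) ≤ 1 := by
    have := integral_mono (integrable_continuousMap (cap a) (u 0 : Measure ℝ≥0∞))
      (integrable_const 1) (fun p => cap_le_one a p)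
    simpa using this
  have h2 : 0 ≤ ∫ p, cap a p ∂(u n : Measure ℝ≥0∞) := integral_nonneg fun p => cap_nonneg a p
  linarith

end IsEulerScheme

lemma floor_div_eq {τ r : ℝ} (hτ : 0 < τ) {i : ℕ}
    (hr : r ∈ Set.Ioo (i * τ) ((i + 1 : ℕ) * τ)) : ⌊r / τ⌋₊ = i := by
  have h0 : 0 ≤ r / τ := div_nonneg ((mul_nonneg (Nat.cast_nonneg i) hτ.le).trans hr.1.le) hτ.le
  refine (Nat.floor_eq_iff h0).2 ⟨?_, ?_⟩
  · rw [le_div_iff₀ hτ]; exact hr.1.le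
  · rw [div_lt_iff₀ hτ]; exact_mod_cast hr.2

/-- A sum of integrals over consecutive intervals of the same length. -/
lemma sum_integral_eq_integral_floor {τ : ℝ} (hτ : 0 < τ) {f : ℕ → ℝ → ℝ} {N : ℕ}
    (hf : ∀ i, IntervalIntegrable (f i) volume (i * τ) ((i + 1 : ℕ) * τ)) :
    ∑ i ∈ Finset.range N, ∫ r in (i * τ : ℝ)..((i + 1 : ℕ) * τ), f i r
      = ∫ r in (0 : ℝ)..(N * τ), f ⌊r / τ⌋₊ r := by
  have hle : ∀ i : ℕ, (i * τ : ℝ) ≤ (i + 1 : ℕ) * τ := fun i => by gcongr; simp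
  have hE : ∀ i : ℕ, Set.EqOn (f i) (fun r => f ⌊r / τ⌋₊ r)
      (Set.uIoo (i * τ : ℝ) ((i + 1 : ℕ) * τ)) := fun i r hr => by
    rw [Set.uIoo_of_le (hle i)] at hr
    simp only [floor_div_eq hτ hr]
  have := intervalIntegral.sum_integral_adjacent_intervals (f := fun r => f ⌊r / τ⌋₊ r)
    (μ := volume) (a := fun i : ℕ => (i * τ : ℝ)) (n := N)
    fun i _ => (hf i).congr_uIoo (hE i)
  simp only [Nat.cast_zero, zero_mul] at this
  rw [← this]
  exact Finset.sum_congr rfl fun i _ => intervalIntegral.integral_congr_uIoo (hE i)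

/-! ### Replacing the window by a continuous cutoff. -/

/-- A continuous cutoff that equals `1` on `[1/L, L]` and vanishes off `[1/(2L), 2L]`. -/
def cutoff (L : ℝ≥0) : C(ℝ≥0∞, ℝ) where
  toFun p := min 1 (2 * tent (1 / (2 * L)) p) * (1 - min 1 (2 * tent L p))

lemma cutoff_apply (L : ℝ≥0) (p : ℝ≥0∞) :
    cutoff L p = min 1 (2 * tent (1 / (2 * L)) p) * (1 - min 1 (2 * tent L p)) := rfl

lemma cutoff_nonneg (L : ℝ≥0) (p : ℝ≥0∞) : 0 ≤ cutoff L p :=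
  mul_nonneg (le_min zero_le_one (mul_nonneg zero_le_two (tent_nonneg _ _)))
    (sub_nonneg.2 (min_le_left _ _))

lemma cutoff_le_one (L : ℝ≥0) (p : ℝ≥0∞) : cutoff L p ≤ 1 :=
  mul_le_one₀ (min_le_left _ _) (sub_nonneg.2 (min_le_left _ _))
    (sub_le_self _ (le_min zero_le_one (mul_nonneg zero_le_two (tent_nonneg _ _))))

lemma cutoff_top {L : ℝ≥0} (hL : 0 < L) : cutoff L ∞ = 0 := by
  rw [cutoff_apply, tent_top (by positivity)]; simp

lemma cutoff_ofReal {L : ℝ≥0} {r : ℝ} (hr : 0 ≤ r) : cutoff L (ENNReal.ofReal r) =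
    min 1 (2 * max (1 - 1 / (2 * L) * r) 0) * (1 - min 1 (2 * max (1 - L * r) 0)) := by
  have h1 := onReal_tent (1 / (2 * L)) hr
  have h2 := onReal_tent L hr
  simp only [onReal] at h1 h2
  rw [cutoff_apply, h1, h2]
  push_cast
  rfl

lemma cutoff_eq_one {L : ℝ≥0} (hL : 0 < L) {r : ℝ} (h1 : 1 / L ≤ r) (h2 : r ≤ L) :
    cutoff L (ENNReal.ofReal r) = 1 := by
  have hL' : (0 : ℝ) < L := hL
  have hr : 0 ≤ r := le_trans (by positivity) h1
  rw [div_le_iff₀ hL'] at h1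
  have k : 1 / (2 * (L : ℝ)) * r ≤ 1 / 2 := by
    rw [one_div_mul_eq_div, div_le_iff₀ (by positivity)]; linarith
  rw [cutoff_ofReal hr, max_eq_left (by linarith), max_eq_right (a := 1 - L * r) (by linarith),
    min_eq_left (by linarith)]
  simp

lemma cutoff_eq_zero {L : ℝ≥0} (hL : 0 < L) {r : ℝ} (hr : 0 ≤ r)
    (h : r ≤ 1 / (2 * L) ∨ 2 * L ≤ r) : cutoff L (ENNReal.ofReal r) = 0 := by
  have hL' : (0 : ℝ) < L := hL
  rw [cutoff_ofReal hr]
  rcases h with h | h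
  · rw [le_div_iff₀ (by positivity)] at h
    rw [max_eq_left (a := 1 - L * r) (by linarith),
      min_eq_left (a := 1) (b := 2 * (1 - L * r)) (by linarith), sub_self, mul_zero]
  · have k : 1 ≤ 1 / (2 * (L : ℝ)) * r := by
      rw [one_div_mul_eq_div, le_div_iff₀ (by positivity)]; linarith
    rw [max_eq_right (a := 1 - 1 / (2 * (L : ℝ)) * r) (by linarith)]
    simp

/-- The collision kernel, cut off to pairs in a compact subset of `(0,∞)²`, depends continuously on
the test function. -/
lemma exists_continuous_cutoff_mul_kern {L : ℝ≥0} (hL : 0 < L) :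
    ∃ Ψ : C(ℝ≥0∞, ℝ) → C(ℝ≥0∞ × ℝ≥0∞, ℝ), Continuous Ψ ∧
      ∀ φ z, Ψ φ z = cutoff L z.1 * cutoff L z.2 * kern φ z := by
  have hL' : (0 : ℝ) < L := hL
  set lo : ℝ≥0∞ := ENNReal.ofReal (1 / (2 * L)) with hlo
  set hi : ℝ≥0∞ := ENNReal.ofReal (1 / (2 * L) + 2 * L) with hhi
  have hlohi : lo ≤ hi := ENNReal.ofReal_le_ofReal (by linarith)
  have hlo0 : 0 < lo := ENNReal.ofReal_pos.2 (by positivity)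
  -- Clamping keeps the denominators positive and changes nothing where the cutoff is nonzero; `hi`
  -- contains the extra `1/(2L)` so that `lo ≤ hi` is automatic.
  set c : ℝ≥0∞ → ℝ := fun p => (max lo (min p hi)).toReal with hc
  have hfin : ∀ p, max lo (min p hi) ≠ ∞ := fun p =>
    (max_lt ENNReal.ofReal_lt_top ((min_le_right _ _).trans_lt ENNReal.ofReal_lt_top)).ne
  have hcc : Continuous c := by
    refine ENNReal.continuousOn_toReal.comp_continuous (by fun_prop) hfin
  have hc0 : ∀ p, 0 < c p := fun p =>
    ENNReal.toReal_pos (hlo0.trans_le (le_max_left _ _)).ne' (hfin p)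
  let F : C(ℝ≥0∞, ℝ) × (ℝ≥0∞ × ℝ≥0∞) → ℝ := fun q => cutoff L q.2.1 * cutoff L q.2.2 *
    (realH1 (onReal q.1) (max (c q.2.1) (c q.2.2)) (min (c q.2.1) (c q.2.2))
      / (c q.2.1 * c q.2.2))
  have hev : ∀ g : C(ℝ≥0∞, ℝ) × (ℝ≥0∞ × ℝ≥0∞) → ℝ, Continuous g →
      Continuous fun q : C(ℝ≥0∞, ℝ) × (ℝ≥0∞ × ℝ≥0∞) => onReal q.1 (g q) := fun g hg =>
    continuous_eval.comp (continuous_fst.prodMk (ENNReal.continuous_ofReal.comp hg))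
  have hc1 : Continuous fun q : C(ℝ≥0∞, ℝ) × (ℝ≥0∞ × ℝ≥0∞) => c q.2.1 :=
    hcc.comp (by fun_prop)
  have hc2 : Continuous fun q : C(ℝ≥0∞, ℝ) × (ℝ≥0∞ × ℝ≥0∞) => c q.2.2 :=
    hcc.comp (by fun_prop)
  have hF : Continuous F := by
    refine Continuous.mul (by fun_prop) (Continuous.div ?_ (hc1.mul hc2) fun q =>
      (mul_pos (hc0 _) (hc0 _)).ne')
    have hmax := hc1.max hc2
    have hmin := hc1.min hc2
    have e1 := hev _ (hmax.add hmin)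
    have e2 := hev _ hmax
    have e3 := hev _ hmin
    have e4 := hev _ (hmax.sub hmin)
    simp only [realH1]
    fun_prop
  -- Currying turns joint continuity into continuity in the test function with values in
  -- `C([0,∞]²)`.
  refine ⟨ContinuousMap.curry ⟨F, hF⟩, ContinuousMap.continuous _, fun φ z => ?_⟩
  change F (φ, z) = _
  have key : ∀ p, cutoff L p = 0 ∨ c p = p.toReal := by
    intro p
    rcases eq_or_ne p ∞ with rfl | hp
    · exact Or.inl (cutoff_top hL)
    rw [← ENNReal.ofReal_toReal hp]
    have h0 : 0 ≤ p.toReal := ENNReal.toReal_nonneg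
    by_cases h : p.toReal ≤ 1 / (2 * L) ∨ 2 * L ≤ p.toReal
    · exact Or.inl (cutoff_eq_zero hL h0 h)
    · push Not at h
      right
      have : (0 : ℝ) < 1 / (2 * L) := by positivity
      simp only [hc]
      rw [min_eq_left (ENNReal.ofReal_le_ofReal (by linarith)),
        max_eq_right (ENNReal.ofReal_le_ofReal h.1.le)]
  simp only [F]
  rcases key z.1 with h1 | h1
  · simp [h1]
  rcases key z.2 with h2 | h2
  · simp [h2]
  rw [h1, h2, kern_eq]

/-- The finite wave numbers `p` with `L ≤ p ≤ R`. -/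
def farWindow (L : ℝ≥0) (R : ℝ) : Set ℝ≥0∞ := {p | (L : ℝ≥0∞) ≤ p ∧ p.toReal ≤ R ∧ p ≠ ∞}

lemma measurableSet_farWindow (L : ℝ≥0) (R : ℝ) : MeasurableSet (farWindow L R) := by
  have h1 : MeasurableSet {p : ℝ≥0∞ | p.toReal ≤ R} := ENNReal.measurable_toReal measurableSet_Iic
  exact measurableSet_Ici.inter (h1.inter (measurableSet_singleton ∞).compl)

lemma measurable_floor_comp {g : ℕ → ℝ} (τ : ℝ) : Measurable fun r : ℝ => g ⌊r / τ⌋₊ :=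
  (measurable_from_nat (f := g)).comp (Nat.measurable_floor.comp (measurable_id.div_const τ))

lemma intervalIntegrable_of_measurable_of_abs_le {f : ℝ → ℝ} (hf : Measurable f) {t K : ℝ}
    (ht : 0 ≤ t) (hK : ∀ r ∈ Set.Ioc 0 t, |f r| ≤ K) : IntervalIntegrable f volume 0 t := by
  rw [intervalIntegrable_iff_integrableOn_Ioc_of_le ht]
  exact Measure.integrableOn_of_bounded (M := K) (by simp) hf.aestronglyMeasurable
    ((ae_restrict_iff' measurableSet_Ioc).2 (ae_of_all _ hK))

/-- The error made by replacing the window by a smaller continuous cutoff. -/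
lemma abs_integral_kern_window_sub_le {L : ℝ≥0} (hL : 1 ≤ L) {R : ℝ} (hR : 2 * L ≤ R)
    {φ : C(ℝ≥0∞, ℝ)} {C : ℝ} (hC : ∀ z, |kern φ z| ≤ C) (μ : ProbabilityMeasure ℝ≥0∞) :
    |(∫ z in window R ×ˢ window R, kern φ z ∂((μ : Measure ℝ≥0∞).prod (μ : Measure ℝ≥0∞)))
      - ∫ z, cutoff L z.1 * cutoff L z.2 * kern φ z
        ∂((μ : Measure ℝ≥0∞).prod (μ : Measure ℝ≥0∞))|
      ≤ 2 * C * ((∫ p in {0}ᶜ, cap L⁻¹ p ∂(μ : Measure ℝ≥0∞))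
        + (μ : Measure ℝ≥0∞).real (farWindow L R)) := by
  have hL0 : 0 < L := one_pos.trans_le hL
  have hL' : (1 : ℝ) ≤ L := by exact_mod_cast hL
  have hC0 : 0 ≤ C := (abs_nonneg _).trans (hC 0)
  set M := (μ : Measure ℝ≥0∞).prod (μ : Measure ℝ≥0∞)
  have hB : MeasurableSet (window R ×ˢ window R) :=
    (measurableSet_window R).prod (measurableSet_window R)
  have hk := integrable_kern φ.continuous.measurable hC M
  have hm := measurable_kern φ.continuous.measurable
  have hcm := (cutoff L).continuous.measurable
  have hchi : ∀ z : ℝ≥0∞ × ℝ≥0∞, 0 ≤ cutoff L z.1 * cutoff L z.2 ∧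
      cutoff L z.1 * cutoff L z.2 ≤ 1 := fun z =>
    ⟨mul_nonneg (cutoff_nonneg _ _) (cutoff_nonneg _ _),
      mul_le_one₀ (cutoff_le_one _ _) (cutoff_nonneg _ _) (cutoff_le_one _ _)⟩
  have hk2 : Integrable (fun z => cutoff L z.1 * cutoff L z.2 * kern φ z) M := by
    refine Integrable.of_bound (C := C) (((hcm.comp measurable_fst).mul
      (hcm.comp measurable_snd)).mul hm).aestronglyMeasurable (ae_of_all _ fun z => ?_)
    rw [Real.norm_eq_abs, abs_mul, abs_of_nonneg (hchi z).1]
    calc _ ≤ 1 * C := mul_le_mul (hchi z).2 (hC z) (abs_nonneg _) zero_le_one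
      _ = C := one_mul C
  -- Window and cutoff give different integrands only if one wave number lies in `S`: nonzero and at
  -- most `1/L`, or between `L` and `R`. Zero is left out since the kernel vanishes there.
  set S : Set ℝ≥0∞ := (Set.Iic ((L⁻¹ : ℝ≥0) : ℝ≥0∞) ∩ {0}ᶜ) ∪ farWindow L R with hS
  have hSlow : MeasurableSet (Set.Iic ((L⁻¹ : ℝ≥0) : ℝ≥0∞) ∩ {0}ᶜ) :=
    measurableSet_Iic.inter (measurableSet_singleton 0).compl
  have hSm : MeasurableSet S := hSlow.union (measurableSet_farWindow L R)
  have hind : Integrable (S.indicator fun _ => (1 : ℝ)) (μ : Measure ℝ≥0∞) :=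
    (integrable_const 1).indicator hSm
  have hi1 : Integrable (fun z : ℝ≥0∞ × ℝ≥0∞ => S.indicator (fun _ => (1 : ℝ)) z.1) M :=
    hind.comp_fst _
  have hi2 : Integrable (fun z : ℝ≥0∞ × ℝ≥0∞ => S.indicator (fun _ => (1 : ℝ)) z.2) M :=
    hind.comp_snd _
  have mid : ∀ x : ℝ, 0 < x → x ≤ R → ENNReal.ofReal x ∉ S → 1 / (L : ℝ) ≤ x ∧ x ≤ L := by
    intro x hx hxR hxS
    simp only [hS, Set.mem_union, not_or] at hxS
    constructor
    · by_contra! hlt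
      refine hxS.1 ⟨?_, by simpa using hx⟩
      rw [Set.mem_Iic, ← ENNReal.ofReal_coe_nnreal]
      refine ENNReal.ofReal_le_ofReal ?_
      push_cast
      rw [← one_div]
      exact hlt.le
    · by_contra! hlt
      refine hxS.2 ⟨?_, ?_, ENNReal.ofReal_ne_top⟩
      · rw [← ENNReal.ofReal_coe_nnreal]
        exact ENNReal.ofReal_le_ofReal hlt.le
      · rwa [ENNReal.toReal_ofReal hx.le]
  have hwin : ∀ x : ℝ, 0 ≤ x → x ≤ R → 1 / (L : ℝ) ≤ x → ENNReal.ofReal x ∈ window R := by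
    intro x hx hxR hxL
    refine ⟨?_, ?_⟩ <;> rw [ENNReal.toReal_ofReal hx]
    · refine le_trans ?_ hxL
      exact one_div_le_one_div_of_le (by linarith) (by linarith)
    · exact hxR
  have hpt : ∀ z, |(window R ×ˢ window R).indicator (kern φ) z
      - cutoff L z.1 * cutoff L z.2 * kern φ z| ≤
        C * (S.indicator (fun _ => 1) z.1 + S.indicator (fun _ => 1) z.2) := by
    intro z
    have n1 : 0 ≤ S.indicator (fun _ => (1 : ℝ)) z.1 :=
      Set.indicator_nonneg (fun _ _ => zero_le_one) _
    have n2 : 0 ≤ S.indicator (fun _ => (1 : ℝ)) z.2 :=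
      Set.indicator_nonneg (fun _ _ => zero_le_one) _
    by_cases h0 : z.1.toReal = 0 ∨ z.2.toReal = 0
    · have : (window R ×ˢ window R).indicator (kern φ) z = 0 := by
        rw [Set.indicator_apply_eq_zero]; exact fun _ => kern_eq_zero _ h0
      rw [this, kern_eq_zero _ h0]
      simpa using mul_nonneg hC0 (add_nonneg n1 n2)
    push Not at h0
    obtain ⟨p, q⟩ := z
    obtain ⟨hp, hq⟩ : p ≠ ∞ ∧ q ≠ ∞ := by
      constructor <;> rintro rfl <;> simp at h0
    obtain ⟨x, hx, rfl⟩ : ∃ x, 0 ≤ x ∧ p = ENNReal.ofReal x :=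
      ⟨p.toReal, ENNReal.toReal_nonneg, (ENNReal.ofReal_toReal hp).symm⟩
    obtain ⟨y, hy, rfl⟩ : ∃ y, 0 ≤ y ∧ q = ENNReal.ofReal y :=
      ⟨q.toReal, ENNReal.toReal_nonneg, (ENNReal.ofReal_toReal hq).symm⟩
    rw [ENNReal.toReal_ofReal hx, ENNReal.toReal_ofReal hy] at h0
    have hx0 : 0 < x := lt_of_le_of_ne hx (Ne.symm h0.1)
    have hy0 : 0 < y := lt_of_le_of_ne hy (Ne.symm h0.2)
    simp only at n1 n2 ⊢
    -- Beyond `R ≥ 2L` both the window indicator and the cutoff vanish.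
    by_cases hout : R < x ∨ R < y
    · have e1 : (ENNReal.ofReal x, ENNReal.ofReal y) ∉ window R ×ˢ window R := by
        rintro ⟨⟨-, a⟩, -, b⟩
        simp only [ENNReal.toReal_ofReal hx] at a
        simp only [ENNReal.toReal_ofReal hy] at b
        rcases hout with h | h <;> linarith
      have e2 : cutoff L (ENNReal.ofReal x) * cutoff L (ENNReal.ofReal y) = 0 := by
        rcases hout with h | h
        · rw [cutoff_eq_zero hL0 hx (Or.inr (by linarith)), zero_mul]
        · rw [cutoff_eq_zero hL0 hy (Or.inr (by linarith)), mul_zero]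
      rw [Set.indicator_of_notMem e1, e2]
      simpa using mul_nonneg hC0 (add_nonneg n1 n2)
    push Not at hout
    by_cases hboth : ENNReal.ofReal x ∉ S ∧ ENNReal.ofReal y ∉ S
    · obtain ⟨a1, a2⟩ := mid x hx0 hout.1 hboth.1
      obtain ⟨b1, b2⟩ := mid y hy0 hout.2 hboth.2
      have e1 : (ENNReal.ofReal x, ENNReal.ofReal y) ∈ window R ×ˢ window R :=
        ⟨hwin x hx hout.1 a1, hwin y hy hout.2 b1⟩
      rw [Set.indicator_of_mem e1, cutoff_eq_one hL0 a1 a2, cutoff_eq_one hL0 b1 b2]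
      simpa using mul_nonneg hC0 (add_nonneg n1 n2)
    · have hge : 1 ≤ S.indicator (fun _ => (1 : ℝ)) (ENNReal.ofReal x)
          + S.indicator (fun _ => (1 : ℝ)) (ENNReal.ofReal y) := by
        by_cases hxS : ENNReal.ofReal x ∈ S
        · rw [Set.indicator_of_mem hxS]; linarith
        · have hyS : ENNReal.ofReal y ∈ S := by
            by_contra hyS; exact hboth ⟨hxS, hyS⟩
          rw [Set.indicator_of_mem hyS]; linarith
      have hc := hchi (ENNReal.ofReal x, ENNReal.ofReal y)
      simp only at hc
      have hone : |(window R ×ˢ window R).indicator (kern φ) (ENNReal.ofReal x, ENNReal.ofReal y)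
          - cutoff L (ENNReal.ofReal x) * cutoff L (ENNReal.ofReal y)
            * kern φ (ENNReal.ofReal x, ENNReal.ofReal y)| ≤ C := by
        set κ := cutoff L (ENNReal.ofReal x) * cutoff L (ENNReal.ofReal y)
        have hkk := hC (ENNReal.ofReal x, ENNReal.ofReal y)
        set k := kern φ (ENNReal.ofReal x, ENNReal.ofReal y) with hkdef
        by_cases hmem : (ENNReal.ofReal x, ENNReal.ofReal y) ∈ window R ×ˢ window R
        · rw [Set.indicator_of_mem hmem, ← hkdef, show k - κ * k = (1 - κ) * k by ring, abs_mul,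
            abs_of_nonneg (by linarith)]
          calc (1 - κ) * |k| ≤ 1 * C :=
                mul_le_mul (by linarith) hkk (abs_nonneg _) zero_le_one
            _ = C := one_mul C
        · rw [Set.indicator_of_notMem hmem, zero_sub, abs_neg, abs_mul, abs_of_nonneg hc.1]
          calc κ * |k| ≤ 1 * C := mul_le_mul hc.2 hkk (abs_nonneg _) zero_le_one
            _ = C := one_mul C
      exact hone.trans (le_mul_of_one_le_right hC0 hge)
  have hSle : (μ : Measure ℝ≥0∞).real S ≤ (∫ p in {0}ᶜ, cap L⁻¹ p ∂(μ : Measure ℝ≥0∞))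
      + (μ : Measure ℝ≥0∞).real (farWindow L R) := by
    refine (measureReal_union_le _ _).trans (add_le_add_left ?_ _)
    rw [← measureReal_restrict_apply measurableSet_Iic]
    exact measureReal_Iic_le_integral_cap _ (inv_pos.2 hL0)
  rw [← integral_indicator hB, ← integral_sub (hk.indicator hB) hk2]
  calc _
      ≤ ∫ z, C * (S.indicator (fun _ => (1 : ℝ)) z.1 + S.indicator (fun _ => (1 : ℝ)) z.2) ∂M := by
        refine (abs_integral_le_integral_abs).trans (integral_mono
          ((hk.indicator hB).sub hk2).abs ((hi1.add hi2).const_mul C) hpt)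
    _ = 2 * C * (μ : Measure ℝ≥0∞).real S := by
        rw [integral_const_mul, integral_add hi1 hi2, integral_fun_fst (S.indicator fun _ => (1 : ℝ)),
          integral_fun_snd (S.indicator fun _ => (1 : ℝ)), integral_indicator_const _ hSm]
        simp only [probReal_univ, smul_eq_mul, mul_one]
        ring
    _ ≤ _ := mul_le_mul_of_nonneg_left hSle (by positivity)

/-! ### Time-integrated identities for the scheme and passage to the limit. -/

namespace IsEulerScheme

variable {R l τ : ℝ} {u : ℕ → ProbabilityMeasure ℝ≥0∞}

/-- The measure is frozen during a time step while `Φ` evolves, and jumps at the end of it; hence `D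
r` is paired with the current measure and the kernel is taken at the right end `(⌊r/τ⌋ + 1) τ`. -/
lemma integral_sub_eq (h : IsEulerScheme R (l * τ) u) (hτ : 0 < τ)
    {Φ D : ℝ → C(ℝ≥0∞, ℝ)} (hΦ : Continuous Φ) (hD : Continuous D)
    (hΦD : ∀ r, 0 < r → HasDerivAt Φ (D r) r) (N : ℕ) :
    (∫ p, Φ (N * τ) p ∂(u N : Measure ℝ≥0∞)) - ∫ p, Φ 0 p ∂(u 0 : Measure ℝ≥0∞) =
      ∫ r in (0 : ℝ)..(N * τ), ((∫ p, D r p ∂(u ⌊r / τ⌋₊ : Measure ℝ≥0∞)) +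
        l * ∫ z in window R ×ˢ window R, kern (Φ ((⌊r / τ⌋₊ + 1 : ℕ) * τ)) z
          ∂((u ⌊r / τ⌋₊ : Measure ℝ≥0∞).prod (u ⌊r / τ⌋₊ : Measure ℝ≥0∞))) := by
  have hle : ∀ i : ℕ, (i * τ : ℝ) ≤ (i + 1 : ℕ) * τ := fun i => by gcongr; simp
  have hcont : ∀ (i : ℕ) {F : ℝ → C(ℝ≥0∞, ℝ)}, Continuous F →
      Continuous fun r => ∫ p, F r p ∂(u i : Measure ℝ≥0∞) := fun i F hF =>
    (integralFunctional (u i : Measure ℝ≥0∞)).continuous.comp hF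
  have hii : ∀ i : ℕ, IntervalIntegrable (fun r => ∫ p, D r p ∂(u i : Measure ℝ≥0∞)) volume
      (i * τ) ((i + 1 : ℕ) * τ) := fun i => (hcont i hD).intervalIntegrable _ _
  have hstep : ∀ i : ℕ, (∫ p, Φ ((i + 1 : ℕ) * τ) p ∂(u (i + 1) : Measure ℝ≥0∞))
      - ∫ p, Φ (i * τ) p ∂(u i : Measure ℝ≥0∞) =
      ∫ r in (i * τ : ℝ)..((i + 1 : ℕ) * τ), ((∫ p, D r p ∂(u i : Measure ℝ≥0∞)) +
        l * ∫ z in window R ×ˢ window R, kern (Φ ((i + 1 : ℕ) * τ)) z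
          ∂((u i : Measure ℝ≥0∞).prod (u i : Measure ℝ≥0∞))) := by
    intro i
    have ftc : ∫ r in (i * τ : ℝ)..((i + 1 : ℕ) * τ), ∫ p, D r p ∂(u i : Measure ℝ≥0∞) =
        (∫ p, Φ ((i + 1 : ℕ) * τ) p ∂(u i : Measure ℝ≥0∞))
          - ∫ p, Φ (i * τ) p ∂(u i : Measure ℝ≥0∞) := by
      refine intervalIntegral.integral_eq_sub_of_hasDerivAt_of_le (hle i)
        (f := fun r => ∫ p, Φ r p ∂(u i : Measure ℝ≥0∞)) (hcont i hΦ).continuousOn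
        (fun r hr => ?_) (hii i)
      have hr0 : 0 < r := lt_of_le_of_lt (by positivity) hr.1
      exact (integralFunctional (u i : Measure ℝ≥0∞)).hasFDerivAt.comp_hasDerivAt r (hΦD r hr0)
    rw [intervalIntegral.integral_add (hii i) intervalIntegrable_const, ftc,
      intervalIntegral.integral_const, h.integral_eq i]
    push_cast
    rw [smul_eq_mul]
    ring
  have tele := Finset.sum_range_sub (fun i : ℕ => ∫ p, Φ (i * τ) p ∂(u i : Measure ℝ≥0∞)) N
  simp only [Nat.cast_zero, zero_mul] at tele
  rw [← tele, Finset.sum_congr rfl fun i _ => hstep i]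
  exact sum_integral_eq_integral_floor hτ fun i => (hii i).add intervalIntegrable_const

/-- The dissipation estimate with `a = L`, read as a time integral. It is uniform in `R` and `τ` and
shows that large finite wave numbers carry little energy for most times, as the limit of the
collision term requires. -/
lemma integral_sq_farWindow_le (h : IsEulerScheme R (l * τ) u) (hR : 1 ≤ R) (hl : 0 < l)
    (hτ : 0 < τ) {L : ℝ≥0} (hL : 1 ≤ L) {t : ℝ} (ht : 0 ≤ t) :
    ∫ r in (0 : ℝ)..t, (u ⌊r / τ⌋₊ : Measure ℝ≥0∞).real (farWindow L R) ^ 2 ≤ 1 / (4 * L * l) := by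
  have hL' : (0 : ℝ) < L := one_pos.trans_le hL
  set g : ℕ → ℝ := fun i => (u i : Measure ℝ≥0∞).real (farWindow L R) ^ 2 with hg
  have hg0 : ∀ i, 0 ≤ g i := fun i => sq_nonneg _
  have hg1 : ∀ i, |g i| ≤ 1 := fun i => by
    rw [abs_of_nonneg (hg0 i)]
    exact pow_le_one₀ measureReal_nonneg measureReal_le_one
  have htN : t ≤ (⌊t / τ⌋₊ + 1 : ℕ) * τ := by
    have := (Nat.lt_floor_add_one (t / τ)).le
    rw [div_le_iff₀ hτ] at this
    exact_mod_cast this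
  set N := ⌊t / τ⌋₊ + 1
  calc ∫ r in (0 : ℝ)..t, g ⌊r / τ⌋₊ ≤ ∫ r in (0 : ℝ)..(N * τ), g ⌊r / τ⌋₊ := by
        refine intervalIntegral.integral_mono_interval le_rfl ht htN (ae_of_all _ fun r => hg0 _) ?_
        exact intervalIntegrable_of_measurable_of_abs_le (measurable_floor_comp τ) (ht.trans htN)
          fun r _ => hg1 _
    _ = ∑ i ∈ Finset.range N, τ * g i := by
        rw [← sum_integral_eq_integral_floor hτ (f := fun i _ => g i)
          fun i => intervalIntegrable_const]
        refine Finset.sum_congr rfl fun i _ => ?_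
        rw [intervalIntegral.integral_const]
        push_cast
        rw [smul_eq_mul]
        ring
    _ ≤ 1 / (4 * L * l) := by
        rw [le_div_iff₀ (by positivity), Finset.sum_mul]
        refine (Finset.sum_le_sum fun i _ => le_of_eq ?_).trans
          (h.sum_sq_le hR (mul_pos hl hτ).le hL N)
        simp only [hg, farWindow]
        ring

end IsEulerScheme

lemma abs_integral_le_of_abs_le_one {X : Type*} [MeasurableSpace X] {μ : Measure X}
    [IsProbabilityMeasure μ] {f : X → ℝ} {C : ℝ} (hC : ∀ x, |f x| ≤ C) : |∫ x, f x ∂μ| ≤ C := by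
  simpa using abs_integral_le_of_abs_le (μ := μ) hC

lemma abs_cutoff_mul_kern_le {L : ℝ≥0} {φ : ℝ≥0∞ → ℝ} {C : ℝ} (hC : ∀ z, |kern φ z| ≤ C)
    (z : ℝ≥0∞ × ℝ≥0∞) : |cutoff L z.1 * cutoff L z.2 * kern φ z| ≤ C := by
  rw [abs_mul, abs_of_nonneg (mul_nonneg (cutoff_nonneg _ _) (cutoff_nonneg _ _))]
  exact (mul_le_of_le_one_left (abs_nonneg _)
    (mul_le_one₀ (cutoff_le_one _ _) (cutoff_nonneg _ _) (cutoff_le_one _ _))).trans (hC z)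

lemma tendsto_cutoff {p : ℝ≥0∞} (hp : p.toReal ≠ 0) :
    Tendsto (fun k : ℕ => cutoff (k + 1) p) atTop (𝓝 1) := by
  have htop : p ≠ ∞ := by rintro rfl; simp at hp
  have h0 : 0 < p.toReal := lt_of_le_of_ne ENNReal.toReal_nonneg hp.symm
  refine tendsto_atTop_of_eventually_const (i₀ := ⌈p.toReal⌉₊ + ⌈1 / p.toReal⌉₊) fun k hk => ?_
  have a := Nat.le_ceil p.toReal
  have b := Nat.le_ceil (1 / p.toReal)
  have hk' : (⌈p.toReal⌉₊ : ℝ) + ⌈1 / p.toReal⌉₊ ≤ k := by exact_mod_cast hk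
  have c0 : (0 : ℝ) ≤ ⌈p.toReal⌉₊ := Nat.cast_nonneg _
  have c1 : (0 : ℝ) ≤ ⌈1 / p.toReal⌉₊ := Nat.cast_nonneg _
  rw [← ENNReal.ofReal_toReal htop]
  refine cutoff_eq_one (by positivity) ?_ ?_
  · push_cast
    rw [one_div_le (by positivity) h0]
    linarith
  · push_cast
    linarith

lemma tendsto_integral_cutoff_mul_kern {φ : C(ℝ≥0∞, ℝ)} {C : ℝ} (hC : ∀ z, |kern φ z| ≤ C)
    (M : Measure (ℝ≥0∞ × ℝ≥0∞)) [IsFiniteMeasure M] :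
    Tendsto (fun k : ℕ => ∫ z, cutoff (k + 1) z.1 * cutoff (k + 1) z.2 * kern φ z ∂M) atTop
      (𝓝 (∫ z, kern φ z ∂M)) := by
  refine tendsto_integral_of_dominated_convergence (fun _ => C) (fun k => ?_)
    (integrable_const _) (fun k => ae_of_all _ fun z => ?_) (ae_of_all _ fun z => ?_)
  · have hcm := (cutoff (k + 1)).continuous.measurable
    exact (((hcm.comp measurable_fst).mul (hcm.comp measurable_snd)).mul
      (measurable_kern φ.continuous.measurable)).aestronglyMeasurable
  · rw [Real.norm_eq_abs]
    exact abs_cutoff_mul_kern_le hC z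
  · by_cases h0 : z.1.toReal = 0 ∨ z.2.toReal = 0
    · simp [kern_eq_zero _ h0]
    · push Not at h0
      simpa using ((tendsto_cutoff h0.1).mul (tendsto_cutoff h0.2)).mul_const (kern φ z)

lemma tendsto_integral_cap_inv (μ : ProbabilityMeasure ℝ≥0∞) :
    Tendsto (fun k : ℕ => ∫ p in {0}ᶜ, cap (k + 1)⁻¹ p ∂(μ : Measure ℝ≥0∞)) atTop (𝓝 0) := by
  have := tendsto_integral_cap_zero ((μ : Measure ℝ≥0∞).restrict {0}ᶜ)
  rw [measureReal_restrict_apply (measurableSet_singleton 0)] at this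
  simpa using this

/-- If `aₙ` is within `e k` of `b k n` for large `n`, with `b k n → b k → b∞` and `e k → 0`, then
`aₙ → b∞`. -/
lemma tendsto_of_tendsto_approx {a : ℕ → ℝ} {b : ℕ → ℕ → ℝ} {b' e : ℕ → ℝ} {c : ℝ}
    (h : ∀ k, ∀ᶠ n in atTop, |a n - b k n| ≤ e k) (hb : ∀ k, Tendsto (b k) atTop (𝓝 (b' k)))
    (hb' : Tendsto b' atTop (𝓝 c)) (he : Tendsto e atTop (𝓝 0)) : Tendsto a atTop (𝓝 c) := by
  rw [Metric.tendsto_nhds]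
  intro ε hε
  obtain ⟨k, h1, h2⟩ := ((Metric.tendsto_nhds.1 hb' (ε / 3) (by positivity)).and
    (he.eventually (gt_mem_nhds (show (0 : ℝ) < ε / 3 by positivity)))).exists
  filter_upwards [h k, Metric.tendsto_nhds.1 (hb k) (ε / 3) (by positivity)] with n h3 h4
  rw [Real.dist_eq] at *
  rw [abs_lt] at *
  rw [abs_le] at h3
  constructor <;> linarith [h1.1, h1.2, h3.1, h3.2, h4.1, h4.2]

section limit

variable {R τ : ℕ → ℝ} {l : ℝ} {u : ℕ → ℕ → ProbabilityMeasure ℝ≥0∞} {μ : ProbabilityMeasure ℝ≥0∞}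
  {m : ℝ≥0 → ProbabilityMeasure ℝ≥0∞}

lemma tendsto_next_time (hτ : ∀ n, 0 < τ n) (hτ0 : Tendsto τ atTop (𝓝 0)) {r : ℝ} (hr : 0 ≤ r) :
    Tendsto (fun n => ((⌊r / τ n⌋₊ + 1 : ℕ) * τ n : ℝ)) atTop (𝓝 r) := by
  have h1 : Tendsto (fun n => r + τ n) atTop (𝓝 r) := by simpa using hτ0.const_add r
  refine tendsto_of_tendsto_of_tendsto_of_le_of_le tendsto_const_nhds h1 (fun n => ?_) fun n => ?_
  · have := (Nat.lt_floor_add_one (r / τ n)).le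
    rw [div_le_iff₀ (hτ n)] at this
    exact_mod_cast this
  · have := Nat.floor_le (div_nonneg hr (hτ n).le)
    rw [le_div_iff₀ (hτ n)] at this
    push_cast
    linarith

lemma next_time_mem {τ r t : ℝ} (hτ : 0 < τ) (hτ1 : τ ≤ 1) (hr : 0 ≤ r) (hrt : r ≤ t) :
    ((⌊r / τ⌋₊ + 1 : ℕ) * τ : ℝ) ∈ Set.Icc 0 (t + 1) := by
  have := Nat.floor_le (div_nonneg hr hτ.le)
  rw [le_div_iff₀ hτ] at this
  refine ⟨by positivity, ?_⟩
  push_cast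
  linarith

lemma tendsto_pairing {X : Type*} [TopologicalSpace X] [CompactSpace X] [MeasurableSpace X]
    [OpensMeasurableSpace X] {f : ℕ → C(X, ℝ)} {g : C(X, ℝ)} {κ : ℕ → ProbabilityMeasure X}
    {ν : ProbabilityMeasure X} (hf : Tendsto f atTop (𝓝 g)) (hκ : Tendsto κ atTop (𝓝 ν)) :
    Tendsto (fun n => ∫ x, f n x ∂(κ n : Measure X)) atTop (𝓝 (∫ x, g x ∂(ν : Measure X))) :=
  (continuous_integral_pairing.tendsto (g, ν)).comp (hf.prodMk_nhds hκ)

/-- Convergence of the collision terms of Euler schemes. -/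
lemma tendsto_integral_collision (hR : Tendsto R atTop atTop) (hR1 : ∀ n, 1 ≤ R n) (hl : 0 < l)
    (hτ : ∀ n, 0 < τ n) (hτ1 : ∀ n, τ n ≤ 1) (hτ0 : Tendsto τ atTop (𝓝 0))
    (hu : ∀ n, IsEulerScheme (R n) (l * τ n) (u n)) (hμ : ∀ n, u n 0 = μ)
    (hmc : Continuous m)
    (hm : ∀ t : ℝ≥0, Tendsto (fun n => u n ⌊(t : ℝ) / τ n⌋₊) atTop (𝓝 (m t)))
    {Φ : ℝ → C(ℝ≥0∞, ℝ)} (hΦ : Continuous Φ) {t C : ℝ} (ht : 0 ≤ t)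
    (hC : ∀ r ∈ Set.Icc 0 (t + 1), ∀ z, |kern (Φ r) z| ≤ C) :
    Tendsto (fun n => ∫ r in (0 : ℝ)..t,
        ∫ z in window (R n) ×ˢ window (R n), kern (Φ ((⌊r / τ n⌋₊ + 1 : ℕ) * τ n)) z
          ∂((u n ⌊r / τ n⌋₊ : Measure ℝ≥0∞).prod (u n ⌊r / τ n⌋₊ : Measure ℝ≥0∞))) atTop
      (𝓝 (∫ r in (0 : ℝ)..t, ∫ z, kern (Φ r) z
          ∂((m r.toNNReal : Measure ℝ≥0∞).prod (m r.toNNReal : Measure ℝ≥0∞)))) := by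
  have hC0 : 0 ≤ C := (abs_nonneg _).trans (hC 0 ⟨le_rfl, by linarith⟩ 0)
  have hm' : ∀ r : ℝ, 0 ≤ r → Tendsto (fun n => u n ⌊r / τ n⌋₊) atTop (𝓝 (m r.toNNReal)) :=
    fun r hr => by simpa [Real.coe_toNNReal r hr] using hm r.toNNReal
  set κ : ℕ → ℝ := fun k => ∫ p in {0}ᶜ, cap (k + 1)⁻¹ p ∂(μ : Measure ℝ≥0∞) with hκ
  -- Dissipation controls only the time integral of the square of the far energy `T`, by `η² /
  -- (4l)`; the inequality `T ≤ η + T² / η` converts this into a bound on the integral of `T` that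
  -- vanishes with `η`.
  set η : ℕ → ℝ := fun k => 1 / √(k + 1) with hη
  have hη0 : ∀ k, 0 < η k := fun k => by simp only [hη]; positivity
  have hηlim : Tendsto η atTop (𝓝 0) := by
    have h1 : Tendsto (fun k : ℕ => √((k : ℝ) + 1)) atTop atTop :=
      Real.tendsto_sqrt_atTop.comp (tendsto_atTop_add_const_right _ _ tendsto_natCast_atTop_atTop)
    simpa [hη, Function.comp_def] using tendsto_inv_atTop_zero.comp h1
  refine tendsto_of_tendsto_approx
    (b := fun k n => ∫ r in (0 : ℝ)..t, ∫ z, cutoff (k + 1) z.1 * cutoff (k + 1) z.2 *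
      kern (Φ ((⌊r / τ n⌋₊ + 1 : ℕ) * τ n)) z
        ∂((u n ⌊r / τ n⌋₊ : Measure ℝ≥0∞).prod (u n ⌊r / τ n⌋₊ : Measure ℝ≥0∞)))
    (b' := fun k => ∫ r in (0 : ℝ)..t, ∫ z, cutoff (k + 1) z.1 * cutoff (k + 1) z.2 *
      kern (Φ r) z ∂((m r.toNNReal : Measure ℝ≥0∞).prod (m r.toNNReal : Measure ℝ≥0∞)))
    (e := fun k => 2 * C * (t * κ k + t * η k + η k / (4 * l))) ?_ ?_ ?_ ?_
  -- Error of the cutoff at level `k`, uniform in all large `n`: `κ k` comes from small wave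
  -- numbers, the `η k` terms from large ones. The remaining goals are `n → ∞` at fixed `k`, then `k
  -- → ∞`.
  · intro k
    have hL1 : (1 : ℝ≥0) ≤ k + 1 := by simp
    filter_upwards [hR.eventually_ge_atTop (2 * ((k : ℝ) + 1))] with n hn
    set T : ℕ → ℝ := fun i => (u n i : Measure ℝ≥0∞).real (farWindow (k + 1) (R n)) with hT
    set g : ℕ → ℝ := fun i => ∫ z in window (R n) ×ˢ window (R n), kern (Φ ((i + 1 : ℕ) * τ n)) z
          ∂((u n i : Measure ℝ≥0∞).prod (u n i : Measure ℝ≥0∞)) with hg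
    set g' : ℕ → ℝ := fun i => ∫ z, cutoff (k + 1) z.1 * cutoff (k + 1) z.2 *
      kern (Φ ((i + 1 : ℕ) * τ n)) z
          ∂((u n i : Measure ℝ≥0∞).prod (u n i : Measure ℝ≥0∞)) with hg'
    have hbd : ∀ r ∈ Set.Ioc 0 t, ∀ z, |kern (Φ ((⌊r / τ n⌋₊ + 1 : ℕ) * τ n)) z| ≤ C :=
      fun r hr => hC _ (next_time_mem (hτ n) (hτ1 n) hr.1.le hr.2)
    have ig : IntervalIntegrable (fun r => g ⌊r / τ n⌋₊) volume 0 t :=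
      intervalIntegrable_of_measurable_of_abs_le (measurable_floor_comp _) ht fun r hr =>
        IsEulerScheme.abs_integral_kern_le (hbd r hr) _ _
    have ig' : IntervalIntegrable (fun r => g' ⌊r / τ n⌋₊) volume 0 t :=
      intervalIntegrable_of_measurable_of_abs_le (measurable_floor_comp _) ht fun r hr =>
        abs_integral_le_of_abs_le_one fun z => abs_cutoff_mul_kern_le (hbd r hr) z
    have iT : IntervalIntegrable (fun r => T ⌊r / τ n⌋₊ ^ 2) volume 0 t :=
      intervalIntegrable_of_measurable_of_abs_le (K := 1)
        ((measurable_floor_comp (g := T) _).pow_const 2) ht fun r hr => by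
        rw [abs_of_nonneg (sq_nonneg _)]
        exact pow_le_one₀ measureReal_nonneg measureReal_le_one
    have hpt : ∀ r ∈ Set.Ioc 0 t, ‖g ⌊r / τ n⌋₊ - g' ⌊r / τ n⌋₊‖ ≤
        2 * C * (κ k + η k + T ⌊r / τ n⌋₊ ^ 2 / η k) := by
      intro r hr
      have h1 := abs_integral_kern_window_sub_le hL1 (by exact_mod_cast hn) (hbd r hr)
        (u n ⌊r / τ n⌋₊)
      have h2 := (hu n).integral_indicator_cap_le (mul_pos hl (hτ n)).le (k + 1)⁻¹ ⌊r / τ n⌋₊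
      rw [hμ] at h2
      have h3 : T ⌊r / τ n⌋₊ ≤ η k + T ⌊r / τ n⌋₊ ^ 2 / η k := by
        rw [← sub_le_iff_le_add', le_div_iff₀ (hη0 k)]
        nlinarith [sq_nonneg (T ⌊r / τ n⌋₊ - η k), sq_nonneg (T ⌊r / τ n⌋₊), sq_nonneg (η k)]
      rw [Real.norm_eq_abs]
      refine h1.trans (mul_le_mul_of_nonneg_left ?_ (by positivity))
      simp only [hκ]
      linarith
    rw [← intervalIntegral.integral_sub ig ig', ← Real.norm_eq_abs]
    refine (intervalIntegral.norm_integral_le_of_norm_le ht (ae_of_all _ fun r hr => hpt r hr)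
      (((intervalIntegrable_const).add (iT.div_const _)).const_mul _)).trans ?_
    rw [intervalIntegral.integral_const_mul,
      intervalIntegral.integral_add intervalIntegrable_const (iT.div_const _),
      intervalIntegral.integral_const, intervalIntegral.integral_div, sub_zero, smul_eq_mul]
    refine mul_le_mul_of_nonneg_left ?_ (by positivity)
    have h4 := (hu n).integral_sq_farWindow_le (hR1 n) hl (hτ n) hL1 ht
    have h5 : (∫ r in (0 : ℝ)..t, T ⌊r / τ n⌋₊ ^ 2) / η k ≤ η k / (4 * l) := by
      rw [div_le_iff₀ (hη0 k)]
      refine h4.trans_eq ?_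
      have : η k * η k = 1 / (k + 1) := by
        simp only [hη]
        rw [div_mul_div_comm, Real.mul_self_sqrt (by positivity), one_mul]
      rw [div_mul_eq_mul_div, this]
      push_cast
      field_simp
    linarith [mul_add t (κ k) (η k)]
  · intro k
    obtain ⟨Ψ, hΨ, hΨe⟩ := exists_continuous_cutoff_mul_kern (L := (k : ℝ≥0) + 1) (by positivity)
    refine intervalIntegral.tendsto_integral_filter_of_dominated_convergence (fun _ => C)
      (Eventually.of_forall fun n => ?_) (Eventually.of_forall fun n => ae_of_all _ fun r hr => ?_)
      intervalIntegrable_const (ae_of_all _ fun r hr => ?_)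
    · exact (measurable_floor_comp (g := fun i => ∫ z, cutoff (k + 1) z.1 * cutoff (k + 1) z.2 *
        kern (Φ ((i + 1 : ℕ) * τ n)) z
          ∂((u n i : Measure ℝ≥0∞).prod (u n i : Measure ℝ≥0∞))) (τ n)).aestronglyMeasurable
    · rw [Set.uIoc_of_le ht] at hr
      rw [Real.norm_eq_abs]
      exact abs_integral_le_of_abs_le_one fun z => abs_cutoff_mul_kern_le
        (hC _ (next_time_mem (hτ n) (hτ1 n) hr.1.le hr.2)) z
    · rw [Set.uIoc_of_le ht] at hr
      simp only [← hΨe]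
      exact tendsto_pairing
        (κ := fun n => (u n ⌊r / τ n⌋₊).prod (u n ⌊r / τ n⌋₊))
        (ν := (m r.toNNReal).prod (m r.toNNReal))
        ((hΨ.tendsto _).comp ((hΦ.tendsto r).comp (tendsto_next_time hτ hτ0 hr.1.le)))
        ((ProbabilityMeasure.continuous_prod.tendsto (m r.toNNReal, m r.toNNReal)).comp
          ((hm' r hr.1.le).prodMk_nhds (hm' r hr.1.le)))
  · refine intervalIntegral.tendsto_integral_filter_of_dominated_convergence (fun _ => C)
      (Eventually.of_forall fun k => ?_) (Eventually.of_forall fun k => ae_of_all _ fun r hr => ?_)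
      intervalIntegrable_const (ae_of_all _ fun r hr => ?_)
    · obtain ⟨Ψ, hΨ, hΨe⟩ := exists_continuous_cutoff_mul_kern (L := (k : ℝ≥0) + 1) (by positivity)
      have hmr : Continuous fun r : ℝ => m r.toNNReal := hmc.comp continuous_real_toNNReal
      have : Continuous fun r : ℝ => ∫ z, Ψ (Φ r) z
          ∂((m r.toNNReal : Measure ℝ≥0∞).prod (m r.toNNReal : Measure ℝ≥0∞)) :=
        continuous_integral_pairing.comp ((hΨ.comp hΦ).prodMk
          (ProbabilityMeasure.continuous_prod.comp (hmr.prodMk hmr)))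
      simp only [hΨe] at this
      exact this.aestronglyMeasurable
    · rw [Set.uIoc_of_le ht] at hr
      rw [Real.norm_eq_abs]
      exact abs_integral_le_of_abs_le_one fun z => abs_cutoff_mul_kern_le
        (hC _ ⟨hr.1.le, by linarith [hr.2]⟩) z
    · rw [Set.uIoc_of_le ht] at hr
      exact tendsto_integral_cutoff_mul_kern (hC r ⟨hr.1.le, by linarith [hr.2]⟩) _
  · have h1 : Tendsto κ atTop (𝓝 0) := tendsto_integral_cap_inv μ
    have := (((h1.const_mul t).add (hηlim.const_mul t)).add (hηlim.div_const (4 * l))).const_mul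
      (2 * C)
    simpa using this

/-- The weak formulation for the limit of Euler schemes. -/
lemma weak_identity_of_tendsto (hR : Tendsto R atTop atTop) (hR1 : ∀ n, 1 ≤ R n) (hl : 0 < l)
    (hτ : ∀ n, 0 < τ n) (hτ1 : ∀ n, τ n ≤ 1) (hτ0 : Tendsto τ atTop (𝓝 0))
    (hu : ∀ n, IsEulerScheme (R n) (l * τ n) (u n)) (hμ : ∀ n, u n 0 = μ) (hmc : Continuous m)
    (hm : ∀ t : ℝ≥0, Tendsto (fun n => u n ⌊(t : ℝ) / τ n⌋₊) atTop (𝓝 (m t)))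
    {Φ D : ℝ → C(ℝ≥0∞, ℝ)} (hΦ : Continuous Φ) (hD : Continuous D)
    (hΦD : ∀ r, 0 < r → HasDerivAt Φ (D r) r) {t C : ℝ} (ht : 0 ≤ t)
    (hC : ∀ r ∈ Set.Icc 0 (t + 1), ∀ z, |kern (Φ r) z| ≤ C) :
    (∫ p, Φ t p ∂(m t.toNNReal : Measure ℝ≥0∞)) - ∫ p, Φ 0 p ∂(μ : Measure ℝ≥0∞) =
      ∫ r in (0 : ℝ)..t, ((∫ p, D r p ∂(m r.toNNReal : Measure ℝ≥0∞)) +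
        l * ∫ z, kern (Φ r) z
          ∂((m r.toNNReal : Measure ℝ≥0∞).prod (m r.toNNReal : Measure ℝ≥0∞))) := by
  have hC0 : 0 ≤ C := (abs_nonneg _).trans (hC 0 ⟨le_rfl, by linarith⟩ 0)
  have hm' : ∀ r : ℝ, 0 ≤ r → Tendsto (fun n => u n ⌊r / τ n⌋₊) atTop (𝓝 (m r.toNNReal)) :=
    fun r hr => by simpa [Real.coe_toNNReal r hr] using hm r.toNNReal
  have hmr : Continuous fun r : ℝ => m r.toNNReal := hmc.comp continuous_real_toNNReal
  obtain ⟨K, hK⟩ := isCompact_Icc.exists_bound_of_continuousOn (s := Set.Icc 0 t) hD.continuousOn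
  set A : ℕ → ℝ → ℝ := fun n r => ∫ p, D r p ∂(u n ⌊r / τ n⌋₊ : Measure ℝ≥0∞) with hA
  set Q : ℕ → ℝ → ℝ := fun n r => ∫ z in window (R n) ×ˢ window (R n),
    kern (Φ ((⌊r / τ n⌋₊ + 1 : ℕ) * τ n)) z
      ∂((u n ⌊r / τ n⌋₊ : Measure ℝ≥0∞).prod (u n ⌊r / τ n⌋₊ : Measure ℝ≥0∞)) with hQ
  have mA : ∀ n, Measurable (A n) := by
    intro n
    have h1 : Measurable fun q : ℕ × ℝ => ∫ p, D q.2 p ∂(u n q.1 : Measure ℝ≥0∞) :=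
      measurable_from_prod_countable_right fun i =>
        ((integralFunctional (u n i : Measure ℝ≥0∞)).continuous.comp hD).measurable
    exact h1.comp ((Nat.measurable_floor.comp (measurable_id.div_const _)).prodMk measurable_id)
  have mQ : ∀ n, Measurable (Q n) := fun n =>
    measurable_floor_comp (g := fun i => ∫ z in window (R n) ×ˢ window (R n),
      kern (Φ ((i + 1 : ℕ) * τ n)) z ∂((u n i : Measure ℝ≥0∞).prod (u n i : Measure ℝ≥0∞))) (τ n)
  have bA : ∀ n, ∀ r ∈ Set.Ioc 0 t, |A n r| ≤ K := fun n r hr =>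
    (abs_integral_le_norm _ _).trans (hK r ⟨hr.1.le, hr.2⟩)
  have bQ : ∀ n, ∀ r ∈ Set.Ioc 0 t, |Q n r| ≤ C := fun n r hr =>
    IsEulerScheme.abs_integral_kern_le (hC _ (next_time_mem (hτ n) (hτ1 n) hr.1.le hr.2)) _ _
  have iA : ∀ n, IntervalIntegrable (A n) volume 0 t := fun n =>
    intervalIntegrable_of_measurable_of_abs_le (mA n) ht (bA n)
  have iQ : ∀ n, IntervalIntegrable (Q n) volume 0 t := fun n =>
    intervalIntegrable_of_measurable_of_abs_le (mQ n) ht (bQ n)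
  have lA : Tendsto (fun n => ∫ r in (0 : ℝ)..t, A n r) atTop
      (𝓝 (∫ r in (0 : ℝ)..t, ∫ p, D r p ∂(m r.toNNReal : Measure ℝ≥0∞))) := by
    refine intervalIntegral.tendsto_integral_filter_of_dominated_convergence (fun _ => K)
      (Eventually.of_forall fun n => (mA n).aestronglyMeasurable)
      (Eventually.of_forall fun n => ae_of_all _ fun r hr => ?_)
      intervalIntegrable_const (ae_of_all _ fun r hr => ?_)
    · rw [Set.uIoc_of_le ht] at hr
      exact bA n r hr
    · rw [Set.uIoc_of_le ht] at hr
      exact tendsto_pairing tendsto_const_nhds (hm' r hr.1.le)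
  have lQ := tendsto_integral_collision hR hR1 hl hτ hτ1 hτ0 hu hμ hmc hm hΦ ht hC
  have lN : Tendsto (fun n => (⌊t / τ n⌋₊ * τ n : ℝ)) atTop (𝓝 t) := by
    have := (tendsto_next_time hτ hτ0 ht).sub hτ0
    rw [sub_zero] at this
    refine this.congr fun n => ?_
    push_cast
    ring
  -- The discrete identity reaches only the last grid time before `t`; the missing interval shrinks
  -- with `τ n` and its integrand is bounded.
  have lrest : Tendsto (fun n => ∫ r in (⌊t / τ n⌋₊ * τ n : ℝ)..t, (A n r + l * Q n r)) atTop
      (𝓝 0) := by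
    have h1 : Tendsto (fun n => (K + l * C) * |t - ⌊t / τ n⌋₊ * τ n|) atTop (𝓝 0) := by
      simpa using ((tendsto_const_nhds (x := t)).sub lN).abs.const_mul (K + l * C)
    refine squeeze_zero_norm (fun n => ?_) h1
    refine intervalIntegral.norm_integral_le_of_norm_le_const fun r hr => ?_
    have hle : (⌊t / τ n⌋₊ * τ n : ℝ) ≤ t := by
      have := Nat.floor_le (div_nonneg ht (hτ n).le)
      rwa [le_div_iff₀ (hτ n)] at this
    rw [Set.uIoc_of_le hle] at hr
    have hr' : r ∈ Set.Ioc 0 t := ⟨lt_of_le_of_lt (by have := (hτ n).le; positivity) hr.1, hr.2⟩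
    rw [Real.norm_eq_abs]
    refine (abs_add_le _ _).trans (add_le_add (bA n r hr') ?_)
    rw [abs_mul, abs_of_pos hl]
    exact mul_le_mul_of_nonneg_left (bQ n r hr') hl.le
  have hid : ∀ n, (∫ p, Φ (⌊t / τ n⌋₊ * τ n) p ∂(u n ⌊t / τ n⌋₊ : Measure ℝ≥0∞))
      - ∫ p, Φ 0 p ∂(μ : Measure ℝ≥0∞) = (∫ r in (0 : ℝ)..t, A n r)
        + l * (∫ r in (0 : ℝ)..t, Q n r)
        - ∫ r in (⌊t / τ n⌋₊ * τ n : ℝ)..t, (A n r + l * Q n r) := by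
    intro n
    have hle : (⌊t / τ n⌋₊ * τ n : ℝ) ≤ t := by
      have := Nat.floor_le (div_nonneg ht (hτ n).le)
      rwa [le_div_iff₀ (hτ n)] at this
    have h0 : (0 : ℝ) ≤ ⌊t / τ n⌋₊ * τ n := by have := (hτ n).le; positivity
    have iF : IntervalIntegrable (fun r => A n r + l * Q n r) volume 0 t :=
      (iA n).add ((iQ n).const_mul l)
    have h1 := (hu n).integral_sub_eq (hτ n) hΦ hD hΦD ⌊t / τ n⌋₊
    rw [hμ] at h1
    rw [h1, ← intervalIntegral.integral_const_mul, ← intervalIntegral.integral_add (iA n)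
      ((iQ n).const_mul l), eq_sub_iff_add_eq]
    refine intervalIntegral.integral_add_adjacent_intervals
      (f := fun r => A n r + l * Q n r) (iF.mono_set ?_) (iF.mono_set ?_)
    · rw [Set.uIcc_of_le h0, Set.uIcc_of_le ht]; exact Set.Icc_subset_Icc le_rfl hle
    · rw [Set.uIcc_of_le hle, Set.uIcc_of_le ht]; exact Set.Icc_subset_Icc h0 le_rfl
  have lleft : Tendsto (fun n => (∫ p, Φ (⌊t / τ n⌋₊ * τ n) p ∂(u n ⌊t / τ n⌋₊ : Measure ℝ≥0∞))
      - ∫ p, Φ 0 p ∂(μ : Measure ℝ≥0∞)) atTop (𝓝 ((∫ p, Φ t p ∂(m t.toNNReal : Measure ℝ≥0∞))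
        - ∫ p, Φ 0 p ∂(μ : Measure ℝ≥0∞))) :=
    (tendsto_pairing ((hΦ.tendsto t).comp lN) (hm' t ht)).sub_const _
  have lright := (lA.add (lQ.const_mul l)).sub lrest
  rw [sub_zero] at lright
  rw [tendsto_nhds_unique (lleft.congr hid) lright, ← intervalIntegral.integral_const_mul,
    intervalIntegral.integral_add]
  · have : Continuous fun r : ℝ => ∫ p, D r p ∂(m r.toNNReal : Measure ℝ≥0∞) :=
      continuous_integral_pairing.comp (hD.prodMk hmr)
    exact this.intervalIntegrable _ _
  · refine IntervalIntegrable.const_mul ?_ l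
    have hκ : Measurable fun r : ℝ => (m r.toNNReal : Measure ℝ≥0∞) :=
      measurable_toMeasure_of_continuous (κ := fun r : ℝ => (m r.toNNReal).toFiniteMeasure)
        (ProbabilityMeasure.toFiniteMeasure_continuous.comp hmr)
    refine intervalIntegrable_of_measurable_of_abs_le
      (measurable_integral_of_measurable (measurable_prod_of_measurable hκ) (M := 1)
        (fun r => by simp) (f := fun q : ℝ × (ℝ≥0∞ × ℝ≥0∞) => kern (Φ q.1) q.2) ?_) ht
      fun r hr => abs_integral_le_of_abs_le_one (hC r ⟨hr.1.le, by linarith [hr.2]⟩)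
    exact measurable_kern_uncurry (measurable_uncurry_of_continuous hΦ)

end limit

/-! ### Global existence. -/

/-- Lipschitz continuity in time, up to the step size, of Euler schemes. -/
lemma IsEulerScheme.abs_integral_floor_sub_le {R l τ : ℝ} {u : ℕ → ProbabilityMeasure ℝ≥0∞}
    (h : IsEulerScheme R (l * τ) u) (hl : 0 ≤ l) (hτ : 0 < τ) (φ : C(ℝ≥0∞, ℝ)) {C : ℝ}
    (hC : ∀ z, |kern φ z| ≤ C) (s t : ℝ≥0) :
    |(∫ p, φ p ∂(u ⌊(s : ℝ) / τ⌋₊ : Measure ℝ≥0∞)) - ∫ p, φ p ∂(u ⌊(t : ℝ) / τ⌋₊ : Measure ℝ≥0∞)|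
      ≤ l * C * (dist s t + τ) := by
  have hC0 : 0 ≤ C := (abs_nonneg _).trans (hC 0)
  wlog hst : s ≤ t generalizing s t
  · rw [abs_sub_comm, dist_comm]
    exact this t s (le_of_not_ge hst)
  have hst' : (s : ℝ) ≤ t := hst
  have hfl : ⌊(s : ℝ) / τ⌋₊ ≤ ⌊(t : ℝ) / τ⌋₊ := Nat.floor_le_floor (by gcongr)
  obtain ⟨k, hk⟩ := Nat.exists_eq_add_of_le hfl
  have h1 := h.abs_integral_sub_le (mul_nonneg hl hτ.le) φ hC ⌊(s : ℝ) / τ⌋₊ k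
  rw [← hk, abs_sub_comm] at h1
  refine h1.trans ?_
  have h2 := Nat.floor_le (div_nonneg t.coe_nonneg hτ.le)
  have h3 := (Nat.lt_floor_add_one ((s : ℝ) / τ)).le
  rw [le_div_iff₀ hτ, hk] at h2
  rw [div_le_iff₀ hτ] at h3
  push_cast at h2
  have h4 : k * τ ≤ dist s t + τ := by
    rw [NNReal.dist_eq, abs_sub_comm, abs_of_nonneg (sub_nonneg.2 hst')]
    linarith
  calc l * τ * C * k = l * C * (k * τ) := by ring
    _ ≤ _ := mul_le_mul_of_nonneg_left h4 (by positivity)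

/-- The collision term is quadratic: after normalization one factor `c` rescales the measure and the
other becomes the speed `l` of the scheme. -/
lemma collision_smul {φ : ℝ≥0∞ → ℝ} (hφ : Measurable φ) {C : ℝ} (hC : ∀ z, |kern φ z| ≤ C)
    (c : ℝ≥0) (μ : ProbabilityMeasure ℝ≥0∞) :
    collision φ ((c • μ.toFiniteMeasure : FiniteMeasure ℝ≥0∞) : Measure ℝ≥0∞) =
      c * (c * ∫ z, kern φ z ∂((μ : Measure ℝ≥0∞).prod (μ : Measure ℝ≥0∞))) := by
  rw [collision_eq hφ hC, FiniteMeasure.toMeasure_smul]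
  have : (c • (μ.toFiniteMeasure : Measure ℝ≥0∞)).prod (c • (μ.toFiniteMeasure : Measure ℝ≥0∞))
      = c • c • ((μ : Measure ℝ≥0∞).prod (μ : Measure ℝ≥0∞)) := by
    change ((c : ℝ≥0∞) • (μ : Measure ℝ≥0∞)).prod ((c : ℝ≥0∞) • (μ : Measure ℝ≥0∞)) =
      (c : ℝ≥0∞) • (c : ℝ≥0∞) • ((μ : Measure ℝ≥0∞).prod (μ : Measure ℝ≥0∞))
    rw [Measure.prod_smul_left, Measure.prod_smul_right]
  rw [this, integral_smul_nnreal_measure, integral_smul_nnreal_measure]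
  rfl

lemma integral_smul_toFiniteMeasure (c : ℝ≥0) (μ : ProbabilityMeasure ℝ≥0∞) (f : ℝ≥0∞ → ℝ) :
    ∫ p, f p ∂((c • μ.toFiniteMeasure : FiniteMeasure ℝ≥0∞) : Measure ℝ≥0∞) =
      c * ∫ p, f p ∂(μ : Measure ℝ≥0∞) := by
  rw [FiniteMeasure.toMeasure_smul, integral_smul_nnreal_measure]
  rfl

lemma isWeakSolution_zero : IsWeakSolution 0 fun _ => 0 where
  continuous := continuous_const
  weak φ _ _ t := by simp [collision]

/-- Global existence of weak solutions. -/
lemma exists_isWeakSolution (G₀ : FiniteMeasure ℝ≥0∞) :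
    ∃ G : ℝ≥0 → FiniteMeasure ℝ≥0∞, IsWeakSolution G₀ G ∧ G 0 = G₀ := by
  rcases eq_or_ne G₀ 0 with rfl | h0
  · exact ⟨_, isWeakSolution_zero, rfl⟩
  have hl : (0 : ℝ) < G₀.mass := by
    have := pos_iff_ne_zero.2 (G₀.mass_nonzero_iff.2 h0)
    exact_mod_cast this
  set l : ℝ := (G₀.mass : ℝ) with hldef
  set μ : ProbabilityMeasure ℝ≥0∞ := G₀.normalize with hμdef
  set R : ℕ → ℝ := fun n => n + 1 with hR
  -- This choice makes `8 (l τ) R³ = l / (l + 1) ≤ 1`, the condition for an Euler step to produce a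
  -- probability measure.
  set τ : ℕ → ℝ := fun n => 1 / (8 * (l + 1) * (n + 1) ^ 3) with hτdef
  have hR1 : ∀ n, 1 ≤ R n := fun n => by simp [hR]
  have hRlim : Tendsto R atTop atTop :=
    tendsto_atTop_add_const_right _ _ tendsto_natCast_atTop_atTop
  have hτ : ∀ n, 0 < τ n := fun n => by simp only [hτdef]; positivity
  have hτle : ∀ n : ℕ, τ n ≤ 1 / ((n : ℝ) + 1) := fun n => by
    refine one_div_le_one_div_of_le (by positivity) ?_
    have h1 : (n : ℝ) + 1 ≤ (n + 1) ^ 3 := le_self_pow₀ (hR1 n) (by norm_num)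
    have h2 : (1 : ℝ) ≤ 8 * (l + 1) := by linarith
    calc (n : ℝ) + 1 ≤ (n + 1) ^ 3 := h1
      _ ≤ _ := le_mul_of_one_le_left (by positivity) h2
  have hτ1 : ∀ n, τ n ≤ 1 := fun n => (hτle n).trans (div_le_one_of_le₀ (hR1 n) (by positivity))
  have hτ0 : Tendsto τ atTop (𝓝 0) :=
    squeeze_zero (fun n => (hτ n).le) hτle tendsto_one_div_add_atTop_nhds_zero_nat
  have hstep : ∀ n, 8 * (l * τ n) * R n ^ 3 ≤ 1 := fun n => by
    have : 8 * (l * τ n) * R n ^ 3 = l / (l + 1) := by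
      simp only [hτdef, hR]
      field_simp
    rw [this]
    exact div_le_one_of_le₀ (by linarith) (by linarith)
  choose u hu0 hu using fun n =>
    exists_isEulerScheme (hR1 n) (mul_pos hl (hτ n)).le (hstep n) μ
  obtain ⟨k, hk, m, hmc, hm⟩ := exists_subseq_tendsto (u := fun n t => u n ⌊(t : ℝ) / τ n⌋₊) hτ0
    fun φ ⟨C, hC⟩ => ⟨l * C, mul_nonneg hl.le ((abs_nonneg _).trans (hC 0)), fun n s t =>
      (hu n).abs_integral_floor_sub_le hl.le (hτ n) φ hC s t⟩
  have hself : G₀.mass • μ.toFiniteMeasure = G₀ := (G₀.self_eq_mass_smul_normalize).symm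
  have hm0 : m 0 = μ := by
    refine tendsto_nhds_unique (hm 0) ?_
    simp only [NNReal.coe_zero, zero_div, Nat.floor_zero, hu0]
    exact tendsto_const_nhds
  refine ⟨fun t => G₀.mass • (m t).toFiniteMeasure, ⟨?_, fun φ hφ hb t => ?_⟩, ?_⟩
  · exact (continuous_const_smul (T := FiniteMeasure ℝ≥0∞) G₀.mass).comp
      (ProbabilityMeasure.toFiniteMeasure_continuous.comp hmc)
  · obtain ⟨C, -, hC⟩ := hasBoundedKernels_iff.1 hb (t + 1)
    have hmax : ∀ r : ℝ, 0 ≤ r → max r 0 = r := fun r hr => max_eq_left hr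
    -- The test function is extended by its value at `0`; near any `r > 0` nothing changes, so its
    -- derivative there is still `timeDeriv φ r`.
    have main := weak_identity_of_tendsto (R := R ∘ k) (τ := τ ∘ k) (u := u ∘ k) (μ := μ) (m := m)
      (hRlim.comp hk.tendsto_atTop) (fun n => hR1 _) hl (fun n => hτ _) (fun n => hτ1 _)
      (hτ0.comp hk.tendsto_atTop) (fun n => hu _) (fun n => hu0 _) hmc hm
      (Φ := fun r => φ (max r 0)) (D := fun r => timeDeriv φ (max r 0)) (t := t) (C := C)
      (continuous_comp_max_zero hφ.continuousOn)
      (continuous_comp_max_zero (continuousOn_timeDeriv hφ)) (fun r hr => ?_) t.coe_nonneg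
      (fun r hr z => by simpa only [hmax r hr.1] using hC r hr z)
    · simp only [hmax _ t.coe_nonneg, max_self, Real.toNNReal_coe] at main
      rw [integral_smul_toFiniteMeasure]
      nth_rw 2 [← hself]
      rw [integral_smul_toFiniteMeasure, ← mul_sub, main, ← intervalIntegral.integral_const_mul]
      refine intervalIntegral.integral_congr fun r hr => ?_
      rw [Set.uIcc_of_le t.coe_nonneg] at hr
      simp only [hmax r hr.1]
      rw [integral_smul_toFiniteMeasure, collision_smul (φ r).continuous.measurable
        (hC r ⟨hr.1, by linarith [hr.2]⟩), ← mul_add]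
    · have h1 : HasDerivAt φ (timeDeriv φ r) r :=
        ((hφ.differentiableOn one_ne_zero r hr.le).hasDerivWithinAt).hasDerivAt (Ici_mem_nhds hr)
      have h2 : (fun s => φ (max s 0)) =ᶠ[𝓝 r] φ := by
        filter_upwards [Ici_mem_nhds hr] with s hs
        rw [hmax s hs]
      rw [hmax r hr.le]
      exact h1.congr_of_eventuallyEq h2
  · simp only [hm0, hself]

end

end ThreeWave

/-! ### Assembly of the theorem. -/

theorem theorem3p1 (G₀ : FiniteMeasure ℝ≥0∞) :
    -- global existence and conservation of energy
    (∃ G : ℝ≥0 → FiniteMeasure ℝ≥0∞, ThreeWave.IsWeakSolution G₀ G ∧ G 0 = G₀ ∧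
      ∀ t, (G t).mass = G₀.mass) ∧
    -- global existence with finite mass
    (ThreeWave.mass G₀ < ∞ →
      ∃ G : ℝ≥0 → FiniteMeasure ℝ≥0∞, ThreeWave.IsWeakSolutionFiniteMass G₀ G ∧ G 0 = G₀ ∧
        (∀ s t, s ≤ t → ThreeWave.mass (G t) ≤ ThreeWave.mass (G s)) ∧
        ∀ t, (G t).mass = G₀.mass) ∧
    -- energy cascade
    (G₀ {0} = 0 → G₀ {∞} = 0 →
      -- monotonicity of the energy at infinity
      (∀ G : ℝ≥0 → FiniteMeasure ℝ≥0∞,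
        ThreeWave.IsWeakSolution G₀ G ∨ ThreeWave.IsWeakSolutionFiniteMass G₀ G →
        Monotone (fun t => G t {∞})) ∧
      -- strict growth at infinity, no energy near zero
      (G₀ ≠ 0 → ∀ G : ℝ≥0 → FiniteMeasure ℝ≥0∞,
        ThreeWave.IsWeakSolution G₀ G ∨ ThreeWave.IsWeakSolutionFiniteMass G₀ G →
        (∀ t₀, ∃ t₁, t₀ < t₁ ∧ G t₀ {∞} < G t₁ {∞}) ∧
        (∃ t, 0 < t ∧ 0 < G t {∞}) ∧
        (∀ t, G t {0} = 0) ∧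
        (∀ ε : ℝ≥0, 0 < ε → ε < 1 → ∃ R : ℝ≥0, 0 < R ∧
          ∀ t, G t (Set.Iio (R : ℝ≥0∞)) ≤ ε * G₀.mass)) ∧
      -- rate of the cascade, with constants that depend on the initial datum only
      (G₀ ≠ 0 → ∃ C₁ C₂ T T' : ℝ, ∃ r : ℝ≥0, ∃ Tr : ℝ,
        0 < C₁ ∧ 0 < C₂ ∧ 0 < T ∧ 0 < T' ∧ 0 < r ∧ 0 < Tr ∧
        ∀ G : ℝ≥0 → FiniteMeasure ℝ≥0∞,
          ThreeWave.IsWeakSolution G₀ G ∨ ThreeWave.IsWeakSolutionFiniteMass G₀ G →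
          (∀ t : ℝ≥0, T < t → C₁ - C₂ / √(t : ℝ) < G t {∞}) ∧
          (∀ t : ℝ≥0, T' < t → C₁ / 2 < G t {∞}) ∧
          (∀ t : ℝ≥0, Tr < t → C₁ ≤ G t (Set.Ici (r : ℝ≥0∞)))) ∧
      -- full cascade
      (∀ G : ℝ≥0 → FiniteMeasure ℝ≥0∞,
        ThreeWave.IsWeakSolution G₀ G ∨ ThreeWave.IsWeakSolutionFiniteMass G₀ G →
        Tendsto G atTop (𝓝 (G₀.mass • ThreeWave.diracInfty)))) ∧
    -- data concentrated at infinity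
    (∀ E : ℝ≥0, ∀ G : ℝ≥0 → FiniteMeasure ℝ≥0∞,
      ThreeWave.IsWeakSolution (E • ThreeWave.diracInfty) G ∨
        ThreeWave.IsWeakSolutionFiniteMass (E • ThreeWave.diracInfty) G →
      ∀ t, G t = E • ThreeWave.diracInfty) := by
  have weak : ∀ {H : FiniteMeasure ℝ≥0∞} {G : ℝ≥0 → FiniteMeasure ℝ≥0∞},
      ThreeWave.IsWeakSolution H G ∨ ThreeWave.IsWeakSolutionFiniteMass H G →
      ThreeWave.IsWeakSolution H G := fun h =>
    h.elim id ThreeWave.IsWeakSolutionFiniteMass.isWeakSolution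
  refine ⟨?_, fun hm => ?_, fun h0 htop => ⟨fun G hG => (weak hG).monotone_apply_top,
    fun hne G hG => ?_, fun hne => ?_, fun G hG => (weak hG).tendsto h0⟩,
    fun E G hG => (weak hG).eq_smul_diracInfty⟩
  · obtain ⟨G, hG, hG0⟩ := ThreeWave.exists_isWeakSolution G₀
    exact ⟨G, hG, hG0, hG.mass_eq⟩
  · obtain ⟨G, hG, hG0⟩ := ThreeWave.exists_isWeakSolution G₀
    exact ⟨G, hG.isWeakSolutionFiniteMass hm, hG0, fun s t hst => hG.antitone_mass hst, hG.mass_eq⟩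
  -- Without finite energy the datum would be a multiple of `δ_∞`, and having no atom at `∞` it
  -- would be zero.
  · have hpos : 0 < (G₀ : Measure ℝ≥0∞).real {∞}ᶜ := by
      refine lt_of_le_of_ne measureReal_nonneg fun hc => hne ?_
      rw [ThreeWave.eq_smul_diracInfty hc.symm, FiniteMeasure.smul_apply] at htop
      rw [← FiniteMeasure.mass_zero_iff]
      simpa [ThreeWave.diracInfty, FiniteMeasure.mk_apply] using htop
    have hlt := (weak hG).exists_apply_top_lt h0 hpos
    obtain ⟨t, ht, hGt⟩ := hlt 0
    exact ⟨hlt, ⟨t, ht, zero_le.trans_lt hGt⟩, (weak hG).apply_zero h0,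
      fun ε hε _ => (weak hG).exists_apply_Iio_le h0 hne hε⟩
  · obtain ⟨C₁, C₂, T, T', r, Tr, h⟩ := ThreeWave.exists_cascade_rate h0 hne
    exact ⟨C₁, C₂, T, T', r, Tr, h.1, h.2.1, h.2.2.1, h.2.2.2.1, h.2.2.2.2.1, h.2.2.2.2.2.1,
      fun G hG => h.2.2.2.2.2.2 G (weak hG)⟩
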